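/- Let $k$ be a commutative ring with unit, $d\ge 0$, $\mathfrak m=(x_1,\dots,x_d)\subset k[x_1,\dots,x_d]$, $A=k[x_1,\dots,x_d]/\mathfrak m^2$ and $\bar{\mathfrak m}=\mathfrak m/\mathfrak m^2$. For $q\ge 0$ let $d_i\colon A^{\otimes q+2}\to A^{\otimes q+1}$ (tensor products over $k$) be $d_i(a_0\otimes\cdots\otimes a_{q+1})=a_0\otimes\cdots\otimes a_ia_{i+1}\otimes\cdots\otimes a_{q+1}$ for $0\le i\le q$ and $d_{q+1}(a_0\otimes\cdots\otimes a_{q+1})=a_{q+1}a_0\otimes a_1\otimes\cdots\otimes a_q$; put $b=\sum_{i=0}^{q+1}(-1)^id_i$ and $b'=\sum_{i=0}^{q}(-1)^id_i$. On $A^{\otimes q+1}$ put $t(a_0\otimes\cdots\otimes a_q)=(-1)^q\,a_q\otimes a_0\otimes\cdots\otimes a_{q-1}$ and $N=1+t+\cdots+t^q$. The negative cyclic homology $HC^-_n(A)$ ($n\in\mathbb Z$) is the homology of the total complex, formed with direct products, of the second quadrant double complex which has $A^{\otimes q+1}$ in column $-p$ and row $q$ ($p,q\ge 0$), vertical differential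 $b$ in even columns and $-b'$ in odd columns, and horizontal differential, from column $-p$ to column $-p-1$, equal to $N$ for $p$ even and $1-t$ for $p$ odd. The weight of a tensor monomial in $A^{\otimes q+1}$ is the total number of $x_i$'s in it. All these maps preserve weight; let $(HC^-)^{(w)}_n(A)$ be the homology of the (product) total complex of the weight $w$ part of the double complex. For $w>0$ let $C_w=\langle\alpha:\alpha^w=1\rangle$ act on $\bar{\mathfrak m}^{\otimes w}$ (tensor power over $k$) by $\alpha(m_1\otimes\cdots\otimes m_w)=(-1)^{w-1}\,m_w\otimes m_1\otimes\cdots\otimes m_{w-1}$, and trivially on $k$. Then: (1) For every $q\ge 0$, $A^{\otimes q+1}$ is the direct sum of its weight $w$ parts ($w\ge 0$), the resulting projections of the double complex onto its weight parts commute with $b$, $b'$ and $t$, and for every $n\in\mathbb Z$ the induced map $$HC^-_n(A)\longrightarrow\prod_{w\ge 0}(HC^-)^{(w)}_n(A)$$ is an isomorphism. (2) $(HC^-)^{(0)}_n(A)\cong k$ if $n$ is even and $n\le 0$, and $(HC^-)^{(0)}_n(A)=0$ otherwise. (3) For $w>0$: $(HC^-)^{(w)}_n(A)=0$ if $n>w$,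 and if $n\le w$ there are isomorphisms of $k$-modules $$(HC^-)^{(w)}_n(A)\;\cong\;\operatorname{Ext}^{\,w-n}_{k[C_w]}\bigl(k,\bar{\mathfrak m}^{\otimes w}\bigr)\;\cong\;H^{w-n}\bigl(C_w;\bar{\mathfrak m}^{\otimes w}\bigr).$$ -/

import Mathlib

open scoped TensorProduct
open CategoryTheory

universe u

noncomputable section

/-! ### The cyclic operators and the negative cyclic double complex -/

/-- The data of the `b`-columns and `b'`-columns of a cyclic (Tsygan) double complex: modules
`obj q` (`q ≥ 0`, playing the role of `A^{⊗ (q+1)}`), the boundaries `b` and `b'`, and the signed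
cyclic operators `t`, with the identities that make rows and columns into a double complex. -/
structure TsyganData (k : Type u) [CommRing k] where
  obj : ℕ → ModuleCat.{u} k
  b : ∀ q, obj (q + 1) →ₗ[k] obj q
  b' : ∀ q, obj (q + 1) →ₗ[k] obj q
  t : ∀ q, obj q →ₗ[k] obj q
  b_b : ∀ q, b q ∘ₗ b (q + 1) = 0
  b'_b' : ∀ q, b' q ∘ₗ b' (q + 1) = 0
  t_pow : ∀ q, t q ^ (q + 1) = 1
  b_one_sub_t : ∀ q, b q ∘ₗ (1 - t (q + 1)) = (1 - t q) ∘ₗ b' q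
  b'_norm : ∀ q, b' q ∘ₗ (∑ i ∈ Finset.range (q + 2), t (q + 1) ^ i) =
    (∑ i ∈ Finset.range (q + 1), t q ^ i) ∘ₗ b q

namespace TsyganData

variable {k : Type u} [CommRing k]

/-- The norm operator `N_q = 1 + t_q + ⋯ + t_q^q`. -/
def norm (T : TsyganData k) (q : ℕ) : T.obj q →ₗ[k] T.obj q :=
  ∑ i ∈ Finset.range (q + 1), T.t q ^ i

/-- The vertical differential, from row `q + 1` to row `q`, in the column `-p` of the second
quadrant double complex: `b` in even columns and `-b'` in odd columns (the sign makes the squares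
anticommute, so that the total differential squares to zero). -/
def vert (T : TsyganData k) (p q : ℕ) : T.obj (q + 1) →ₗ[k] T.obj q :=
  if Even p then T.b q else -T.b' q

/-- The horizontal differential in row `q`, from the column `-p` to the column `-(p + 1)`:
`N` out of even columns, `1 - t` out of odd columns. -/
def horiz (T : TsyganData k) (p q : ℕ) : T.obj q →ₗ[k] T.obj q :=
  if Even p then T.norm q else 1 - T.t q

/-- The positions `(-p, q)` (with `p, q ≥ 0`) of total degree `n`, that is, `q - p = n`. -/
abbrev Pos (n : ℤ) : Type := {x : ℕ × ℕ // (x.2 : ℤ) - (x.1 : ℤ) = n}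

/-- The degree `n` part of the total complex: the direct *product* of all terms of total
degree `n` of the second quadrant double complex. -/
abbrev Tot (T : TsyganData k) (n : ℤ) : Type u := ∀ x : Pos n, T.obj x.1.2

/-- The component at the position `(-p, q)` of the total differential: the vertical differential
from `(-p, q + 1)` plus, if `p > 0`, the horizontal differential from `(-(p - 1), q)`. -/
def totDComponent (T : TsyganData k) (n m : ℤ) (h : m + 1 = n) :
    ∀ p q : ℕ, (q : ℤ) - (p : ℤ) = m → (T.Tot n →ₗ[k] T.obj q)
  | 0, q, hx => T.vert 0 q ∘ₗ
      (LinearMap.proj (⟨(0, q + 1), by push_cast at hx ⊢; omega⟩ : Pos n) : T.Tot n →ₗ[k] _)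
  | p + 1, q, hx => T.vert (p + 1) q ∘ₗ
        (LinearMap.proj (⟨(p + 1, q + 1), by push_cast at hx ⊢; omega⟩ : Pos n) :
          T.Tot n →ₗ[k] _) +
      T.horiz p q ∘ₗ
        (LinearMap.proj (⟨(p, q), by push_cast at hx ⊢; omega⟩ : Pos n) : T.Tot n →ₗ[k] _)

/-- The total differential, from degree `n` to degree `m = n - 1`. -/
def totD (T : TsyganData k) (n m : ℤ) (h : m + 1 = n) : T.Tot n →ₗ[k] T.Tot m :=
  LinearMap.pi fun x => T.totDComponent n m h x.1.1 x.1.2 x.2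

theorem one_sub_t_norm (T : TsyganData k) (q : ℕ) : (1 - T.t q) ∘ₗ T.norm q = 0 := by
  have := mul_neg_geom_sum (T.t q) (q + 1)
  rw [T.t_pow, sub_self] at this
  exact this

theorem norm_one_sub_t (T : TsyganData k) (q : ℕ) : T.norm q ∘ₗ (1 - T.t q) = 0 := by
  have := geom_sum_mul_neg (T.t q) (q + 1)
  rw [T.t_pow, sub_self] at this
  exact this

theorem vert_vert (T : TsyganData k) (p q : ℕ) : T.vert p q ∘ₗ T.vert p (q + 1) = 0 := by
  unfold vert
  split_ifs
  · exact T.b_b q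
  · rw [LinearMap.neg_comp, LinearMap.comp_neg, neg_neg, T.b'_b']

theorem horiz_horiz (T : TsyganData k) (p q : ℕ) : T.horiz (p + 1) q ∘ₗ T.horiz p q = 0 := by
  unfold horiz
  by_cases h : Even p
  · have h' : ¬ Even (p + 1) := by simpa [Nat.even_add_one] using h
    rw [if_neg h', if_pos h, T.one_sub_t_norm]
  · have h' : Even (p + 1) := by simpa [Nat.even_add_one] using h
    rw [if_pos h', if_neg h, T.norm_one_sub_t]

theorem vert_horiz (T : TsyganData k) (p q : ℕ) :
    T.vert (p + 1) q ∘ₗ T.horiz p (q + 1) + T.horiz p q ∘ₗ T.vert p q = 0 := by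
  unfold horiz vert
  by_cases h : Even p
  · have h' : ¬ Even (p + 1) := by simpa [Nat.even_add_one] using h
    rw [if_neg h', if_pos h, if_pos h, if_pos h, LinearMap.neg_comp]
    unfold norm
    rw [T.b'_norm, neg_add_cancel]
  · have h' : Even (p + 1) := by simpa [Nat.even_add_one] using h
    rw [if_pos h', if_neg h, if_neg h, if_neg h, T.b_one_sub_t, LinearMap.comp_neg, add_neg_cancel]

theorem totD_totD (T : TsyganData k) (n m l : ℤ) (h : m + 1 = n) (h' : l + 1 = m) :
    T.totD m l h' ∘ₗ T.totD n m h = 0 := by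
  ext f ⟨⟨p, q⟩, hx⟩
  have vv := fun p q x => LinearMap.congr_fun (T.vert_vert p q) x
  have hh := fun p q x => LinearMap.congr_fun (T.horiz_horiz p q) x
  have vh := fun p q x => LinearMap.congr_fun (T.vert_horiz p q) x
  simp only [LinearMap.comp_apply, LinearMap.zero_apply, LinearMap.add_apply] at vv hh vh
  rcases p with _ | _ | p
  · simp [totD, totDComponent, vv]
  · simp [totD, totDComponent, vv, vh]
  · simp only [totD, totDComponent, LinearMap.comp_apply, LinearMap.pi_apply, LinearMap.add_apply,
      LinearMap.proj_apply, map_add, vv, hh, zero_add, add_zero, LinearMap.zero_apply,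
      Pi.zero_apply]
    exact vh _ _ _

/-- The (product) total complex of the second quadrant double complex whose columns are numbered
`⋯, -2, -1, 0` and whose rows are numbered `0, 1, 2, ⋯`, with `obj q` at every position of row `q`,
with the vertical differentials `vert` (downwards) and the horizontal ones `horiz` (to the left). -/
def negComplex (T : TsyganData k) : ChainComplex (ModuleCat.{u} k) ℤ where
  X n := ModuleCat.of k (T.Tot n)
  d n m := if h : m + 1 = n then ModuleCat.ofHom (T.totD n m h) else 0
  shape n m h := dif_neg h
  d_comp_d' n m l h h' := by
    have h : m + 1 = n := h
    have h' : l + 1 = m := h'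
    rw [dif_pos h, dif_pos h', ← ModuleCat.ofHom_comp, T.totD_totD]
    rfl

/-- The homology of the total complex of the negative cyclic double complex. -/
def negHomology (T : TsyganData k) (n : ℤ) : ModuleCat.{u} k := T.negComplex.homology n

/-- Morphisms: linear maps commuting with `b`, `b'` and `t`. -/
@[ext]
structure Hom (S T : TsyganData k) where
  app : ∀ q, S.obj q →ₗ[k] T.obj q
  app_b : ∀ q, app q ∘ₗ S.b q = T.b q ∘ₗ app (q + 1)
  app_b' : ∀ q, app q ∘ₗ S.b' q = T.b' q ∘ₗ app (q + 1)
  app_t : ∀ q, app q ∘ₗ S.t q = T.t q ∘ₗ app q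

variable {S T : TsyganData k}

theorem Hom.app_t_pow (f : Hom S T) (q i : ℕ) :
    f.app q ∘ₗ (S.t q ^ i) = (T.t q ^ i) ∘ₗ f.app q := by
  induction i with
  | zero => rfl
  | succ i ih =>
    rw [pow_succ, pow_succ, Module.End.mul_eq_comp, Module.End.mul_eq_comp, ← LinearMap.comp_assoc,
      ih, LinearMap.comp_assoc, f.app_t, LinearMap.comp_assoc]

theorem Hom.app_vert (f : Hom S T) (p q : ℕ) :
    f.app q ∘ₗ S.vert p q = T.vert p q ∘ₗ f.app (q + 1) := by
  unfold vert
  split_ifs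
  · exact f.app_b q
  · rw [LinearMap.neg_comp, LinearMap.comp_neg, f.app_b']

theorem Hom.app_horiz (f : Hom S T) (p q : ℕ) :
    f.app q ∘ₗ S.horiz p q = T.horiz p q ∘ₗ f.app q := by
  unfold horiz norm
  split_ifs
  · ext x
    have := fun i => LinearMap.congr_fun (f.app_t_pow q i) x
    simp only [LinearMap.comp_apply] at this
    simp [this]
  · rw [LinearMap.comp_sub, LinearMap.sub_comp, f.app_t]
    rfl

/-- The map of total complexes induced by a morphism, applied component by component. -/
def Hom.negComplexMap (f : Hom S T) : S.negComplex ⟶ T.negComplex where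
  f n := ModuleCat.ofHom (Y := T.Tot n)
    (LinearMap.pi fun x => f.app x.1.2 ∘ₗ (LinearMap.proj x : S.Tot n →ₗ[k] _))
  comm' n m h := by
    have h : m + 1 = n := h
    have hv := fun p q x => LinearMap.congr_fun (f.app_vert p q) x
    have hh := fun p q x => LinearMap.congr_fun (f.app_horiz p q) x
    simp only [LinearMap.comp_apply] at hv hh
    simp only [negComplex, dif_pos h]
    ext z ⟨⟨p, q⟩, hx⟩
    rcases p with _ | p
    · simp [totD, totDComponent, hv]
    · simp [totD, totDComponent, hv, hh]

/-- The map on negative cyclic homology induced by a morphism. -/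
def Hom.negHomologyMap (f : Hom S T) (n : ℤ) : S.negHomology n →ₗ[k] T.negHomology n :=
  (HomologicalComplex.homologyMap f.negComplexMap n).hom

/-- The restriction of `b`, `b'`, `t` to a family of submodules that they preserve. -/
def restrict (T : TsyganData k) (W : ∀ q, Submodule k (T.obj q))
    (hb : ∀ q, ∀ x ∈ W (q + 1), T.b q x ∈ W q) (hb' : ∀ q, ∀ x ∈ W (q + 1), T.b' q x ∈ W q)
    (ht : ∀ q, ∀ x ∈ W q, T.t q x ∈ W q) : TsyganData k where
  obj q := ModuleCat.of k (W q)
  b q := (T.b q).restrict (hb q)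
  b' q := (T.b' q).restrict (hb' q)
  t q := (T.t q).restrict (ht q)
  b_b q := by
    ext x
    exact LinearMap.congr_fun (T.b_b q) x.1
  b'_b' q := by
    ext x
    exact LinearMap.congr_fun (T.b'_b' q) x.1
  t_pow q := by
    rw [Module.End.pow_restrict]
    ext x
    exact LinearMap.congr_fun (T.t_pow q) x.1
  b_one_sub_t q := by
    ext x
    exact LinearMap.congr_fun (T.b_one_sub_t q) x.1
  b'_norm q := by
    ext x
    have key : ∀ (q i : ℕ) (y : W q),
        (((T.t q).restrict (ht q) ^ i) y : T.obj q) = (T.t q ^ i) y := fun q i y => by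
      rw [Module.End.pow_restrict]
      rfl
    have := LinearMap.congr_fun (T.b'_norm q) x.1
    simp only [LinearMap.comp_apply, LinearMap.sum_apply, map_sum, Submodule.coe_sum,
      LinearMap.coe_restrict_apply, key] at this ⊢
    exact this

/-- The inclusion of a restriction. -/
def restrictInclusion (T : TsyganData k) (W : ∀ q, Submodule k (T.obj q))
    (hb : ∀ q, ∀ x ∈ W (q + 1), T.b q x ∈ W q) (hb' : ∀ q, ∀ x ∈ W (q + 1), T.b' q x ∈ W q)
    (ht : ∀ q, ∀ x ∈ W q, T.t q x ∈ W q) : Hom (T.restrict W hb hb' ht) T where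
  app q := (W q).subtype
  app_b _ := rfl
  app_b' _ := rfl
  app_t _ := rfl

end TsyganData

/-! ### The Hochschild boundaries and the cyclic operator of an algebra -/

section Hochschild

/-- The `i`-th face of an `(n + 2)`-tuple `(a_0, …, a_{n+1})`:
`(a_0, …, a_i a_{i+1}, …, a_{n+1})` for `i ≤ n`, and `(a_{n+1} a_0, a_1, …, a_n)` for
`i = n + 1`. -/
def faceTuple {A : Type*} [Mul A] {n : ℕ} (i : Fin (n + 2)) (a : Fin (n + 2) → A) :
    Fin (n + 1) → A := fun j =>
  if (i : ℕ) = n + 1 then (if j = 0 then a (Fin.last (n + 1)) * a 0 else a j.castSucc)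
  else if (j : ℕ) < i then a j.castSucc
  else if (j : ℕ) = i then a j.castSucc * a j.succ
  else a j.succ

theorem exists_eq_val {A : Type*} {n : ℕ} (a : Fin (n + 1) → A) :
    ∃ c : ℕ → A, a = fun (j : Fin (n + 1)) => c (j : ℕ) :=
  ⟨fun l => if h : l < n + 1 then a ⟨l, h⟩ else a 0, by
    ext j
    have := j.2
    simp [this]⟩

theorem cons_val {A : Type*} {n : ℕ} (x : A) (c : ℕ → A) :
    (Fin.cons x fun i : Fin n => c (i : ℕ) : Fin (n + 1) → A) =
      fun (j : Fin (n + 1)) => if (j : ℕ) = 0 then x else c ((j : ℕ) - 1) := by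
  ext j
  refine Fin.cases ?_ (fun j => ?_) j <;> simp

variable (k : Type u) [CommRing k] (A : Type u) [Ring A] [Algebra k A]

theorem faceTuple_update {n : ℕ} (i : Fin (n + 2)) (a : Fin (n + 2) → A) (m : Fin (n + 2)) :
    ∃ (j : Fin (n + 1)) (g : A →ₗ[k] A), ∀ x,
      faceTuple i (Function.update a m x) = Function.update (faceTuple i a) j (g x) := by
  obtain ⟨i, hi⟩ := i
  by_cases h : i = n + 1
  · rcases Fin.eq_castSucc_or_eq_last m with ⟨m, rfl⟩ | rfl
    · by_cases hm : m = 0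
      · subst hm
        refine ⟨0, LinearMap.mulLeft k (a (Fin.last _)), fun x => ?_⟩
        ext j
        by_cases hj : j = 0 <;> simp [faceTuple, h, hj, Function.update_apply, Fin.ext_iff]
      · refine ⟨m, LinearMap.id, fun x => ?_⟩
        ext j
        simp only [Fin.ext_iff, Fin.val_zero] at hm
        by_cases hj : j = 0
        · subst hj
          have : ¬ (n + 1 = (m : ℕ)) := by omega
          simp [faceTuple, h, Fin.ext_iff, Ne.symm hm, this]
        · simp [faceTuple, h, hj, Function.update_apply, Fin.ext_iff]
    · refine ⟨0, LinearMap.mulRight k (a 0), fun x => ?_⟩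
      ext j
      have := j.2
      by_cases hj : j = 0 <;> simp [faceTuple, h, hj, Function.update_apply, Fin.ext_iff]
      intro; omega
  · have key : faceTuple (A := A) (⟨i, hi⟩ : Fin (n + 2)) = fun a (j : Fin (n + 1)) =>
        if (j : ℕ) < i then a j.castSucc
        else if (j : ℕ) = i then a j.castSucc * a j.succ else a j.succ := by
      ext a j; simp [faceTuple, h]
    rw [key]; clear key
    have hm := m.2
    rcases lt_trichotomy (m : ℕ) i with h1 | h1 | h1
    · refine ⟨⟨m, by omega⟩, LinearMap.id, fun x => ?_⟩
      ext j
      simp only [Function.update_apply, Fin.ext_iff, Fin.val_castSucc, Fin.val_succ,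
        LinearMap.id_apply]
      grind
    · refine ⟨⟨m, by omega⟩, LinearMap.mulRight k (a ⟨m + 1, by omega⟩), fun x => ?_⟩
      ext j
      simp only [Function.update_apply, Fin.ext_iff, Fin.val_castSucc, Fin.val_succ,
        LinearMap.mulRight_apply]
      split_ifs <;> first | rfl | omega | (congr 2; simp only [Fin.ext_iff, Fin.val_succ]; omega)
    · by_cases h2 : (m : ℕ) = i + 1
      · refine ⟨⟨i, by omega⟩, LinearMap.mulLeft k (a ⟨i, by omega⟩), fun x => ?_⟩
        ext j
        simp only [Function.update_apply, Fin.ext_iff, Fin.val_castSucc, Fin.val_succ,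
          LinearMap.mulLeft_apply]
        split_ifs <;>
          first | rfl | omega | (congr 2; simp only [Fin.ext_iff, Fin.val_castSucc]; omega)
      · refine ⟨⟨m - 1, by omega⟩, LinearMap.id, fun x => ?_⟩
        ext j
        simp only [Function.update_apply, Fin.ext_iff, Fin.val_castSucc, Fin.val_succ,
          LinearMap.id_apply]
        split_ifs <;> first | rfl | omega

/-- The face map `d_i : A^{⊗ (n+2)} → A^{⊗ (n+1)}`. -/
def face (n : ℕ) (i : Fin (n + 2)) :
    (⨂[k] _ : Fin (n + 2), A) →ₗ[k] (⨂[k] _ : Fin (n + 1), A) :=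
  PiTensorProduct.lift
    { toFun := fun a => PiTensorProduct.tprod k (faceTuple i a)
      map_update_add' := by
        intro inst a m x y
        obtain rfl : inst = instDecidableEqFin _ := Subsingleton.elim _ _
        obtain ⟨j, g, h⟩ := faceTuple_update k A i a m
        simp [h]
      map_update_smul' := by
        intro inst a m c x
        obtain rfl : inst = instDecidableEqFin _ := Subsingleton.elim _ _
        obtain ⟨j, g, h⟩ := faceTuple_update k A i a m
        simp [h] }

@[simp]
theorem face_tprod (n : ℕ) (i : Fin (n + 2)) (a : Fin (n + 2) → A) :
    face k A n i (PiTensorProduct.tprod k a) = PiTensorProduct.tprod k (faceTuple i a) := by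
  simp [face]

/-- The Hochschild boundary `b = ∑_{i=0}^{n+1} (-1)^i d_i : A^{⊗ (n+2)} → A^{⊗ (n+1)}`. -/
def hochschildB (n : ℕ) : (⨂[k] _ : Fin (n + 2), A) →ₗ[k] (⨂[k] _ : Fin (n + 1), A) :=
  ∑ i : Fin (n + 2), (-1 : k) ^ (i : ℕ) • face k A n i

/-- The bar boundary `b' = ∑_{i=0}^{n} (-1)^i d_i : A^{⊗ (n+2)} → A^{⊗ (n+1)}`, which omits the
last face. -/
def barB (n : ℕ) : (⨂[k] _ : Fin (n + 2), A) →ₗ[k] (⨂[k] _ : Fin (n + 1), A) :=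
  ∑ i : Fin (n + 1), (-1 : k) ^ (i : ℕ) • face k A n i.castSucc

/-- The action of the symmetric group on `M^{⊗ w}` by signed permutation of the factors. -/
def signedPerm (M : Type u) [AddCommGroup M] [Module k M] (w : ℕ) :
    Representation k (Equiv.Perm (Fin w)) (⨂[k] _ : Fin w, M) where
  toFun σ := ((Equiv.Perm.sign σ : ℤ) : k) •
    (PiTensorProduct.reindex k (fun _ : Fin w => M) σ).toLinearMap
  map_one' := by
    ext a
    simp
    rfl
  map_mul' σ τ := by
    ext a
    simp only [map_mul, Units.val_mul, Int.cast_mul, LinearMap.compMultilinearMap_apply,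
      LinearMap.smul_apply, LinearEquiv.coe_coe, Module.End.mul_apply,
      PiTensorProduct.reindex_tprod, map_smul, smul_smul]
    rw [mul_comm]
    rfl

/-- The cyclic operator on `M^{⊗ (n+1)}`:
`t (m_0 ⊗ ⋯ ⊗ m_n) = (-1)^n (m_n ⊗ m_0 ⊗ ⋯ ⊗ m_{n-1})`. -/
def cyclicT (M : Type u) [AddCommGroup M] [Module k M] (n : ℕ) :
    (⨂[k] _ : Fin (n + 1), M) →ₗ[k] (⨂[k] _ : Fin (n + 1), M) :=
  (-1 : k) ^ n • (PiTensorProduct.reindex k (fun _ : Fin (n + 1) => M)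
    (finRotate (n + 1))).toLinearMap

theorem cyclicT_tprod (M : Type u) [AddCommGroup M] [Module k M] (n : ℕ) (a : Fin (n + 1) → M) :
    cyclicT k M n (PiTensorProduct.tprod k a) =
      (-1 : k) ^ n • PiTensorProduct.tprod k (Fin.cons (a (Fin.last n)) fun i => a i.castSucc) := by
  simp only [cyclicT, LinearMap.smul_apply, LinearEquiv.coe_coe, PiTensorProduct.reindex_tprod]
  congr 2
  ext j
  refine Fin.cases ?_ (fun j => ?_) j
  · simp only [Fin.cons_zero]
    congr 1
  · simp only [Fin.cons_succ]
    congr 1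
    rw [Equiv.symm_apply_eq, finRotate_apply, Fin.coeSucc_eq_succ]

theorem cyclicT_eq_signedPerm (M : Type u) [AddCommGroup M] [Module k M] (n : ℕ) :
    cyclicT k M n = signedPerm k M (n + 1) (finRotate (n + 1)) := by
  simp [cyclicT, signedPerm, sign_finRotate]

theorem finRotate_pow_self (w : ℕ) : finRotate w ^ w = 1 := by
  rcases w with _ | _ | w
  · rfl
  · ext i; omega
  · have h := (isCycle_finRotate (n := w)).orderOf
    rw [support_finRotate, Finset.card_univ, Fintype.card_fin] at h
    have := pow_orderOf_eq_one (finRotate (w + 2))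
    rwa [h] at this

theorem cyclicT_pow (M : Type u) [AddCommGroup M] [Module k M] (n : ℕ) :
    cyclicT k M n ^ (n + 1) = 1 := by
  rw [cyclicT_eq_signedPerm, ← map_pow, finRotate_pow_self, map_one]

theorem faceTuple_faceTuple {n : ℕ} (i : Fin (n + 2)) (j : Fin (n + 3)) (h : i.castSucc < j)
    (a : Fin (n + 3) → A) :
    faceTuple i (faceTuple j a) =
      faceTuple (j.pred (Fin.ne_zero_of_lt h)) (faceTuple i.castSucc a) := by
  obtain ⟨i, hi⟩ := i
  obtain ⟨j, hj⟩ := j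
  have hij : i < j := h
  obtain ⟨c, rfl⟩ := exists_eq_val a
  ext ⟨l, hl⟩
  simp only [faceTuple, Fin.pred_mk, Fin.castSucc_mk, Fin.succ_mk, Fin.ext_iff, Fin.val_zero,
    Fin.last]
  by_cases hj' : j = n + 2
  · subst hj'
    by_cases hi' : i = n + 1
    · subst hi'
      by_cases hl' : l = 0
      · subst hl'
        simp [mul_assoc]
      · have h1 : l ≠ n + 1 := by omega
        simp [hl', hl]
    · have h1 : i ≤ n := by omega
      by_cases hl' : l = 0
      · subst hl'
        by_cases hi0 : i = 0
        · subst hi0; simp [mul_assoc]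
        · have : 0 < i := by omega
          have h2 : ¬ n + 1 < i := by omega
          have h3 : n + 1 ≠ i := by omega
          have h4 : i ≠ n + 1 + 1 := by omega
          simp [hi', this, h2, h3, h4]
      · grind
  · by_cases hi' : i = n + 1
    · omega
    · have : i ≠ n + 2 := by omega
      have : j - 1 ≠ n + 1 := by omega
      have : i ≠ n + 1 := by omega
      grind

theorem face_succ_cyclicT (n : ℕ) (i : Fin (n + 1)) :
    face k A n i.succ ∘ₗ cyclicT k A (n + 1) = -(cyclicT k A n ∘ₗ face k A n i.castSucc) := by
  ext a
  simp only [LinearMap.compMultilinearMap_apply, LinearMap.comp_apply, cyclicT_tprod, map_smul,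
    face_tprod, LinearMap.neg_apply]
  rw [pow_succ, mul_neg_one, neg_smul]
  congr 3
  obtain ⟨c, rfl⟩ := exists_eq_val a
  ext ⟨l, hl⟩
  simp only [cons_val, Fin.val_last, Fin.val_castSucc]
  simp only [faceTuple, Fin.last, Fin.castSucc_mk, Fin.succ_mk, Fin.ext_iff, Fin.val_zero,
    Fin.val_succ, Fin.val_castSucc]
  obtain ⟨i, hi⟩ := i
  rcases l with _ | l
  · simp only [Fin.mk_zero, Fin.cons_zero]
    by_cases h1 : i = n
    · subst h1; simp
    · have h2 : i ≠ n + 1 := by omega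
      have h3 : ¬ n < i := by omega
      have h4 : n ≠ i := by omega
      simp [h1, h2, h3, h4]
  · have e : (⟨l + 1, hl⟩ : Fin (n + 1)) = Fin.succ ⟨l, by omega⟩ := rfl
    rw [e, Fin.cons_succ]
    grind

theorem face_zero_cyclicT (n : ℕ) :
    face k A n 0 ∘ₗ cyclicT k A (n + 1) = (-1 : k) ^ (n + 1) • face k A n (Fin.last (n + 1)) := by
  ext a
  simp only [LinearMap.compMultilinearMap_apply, LinearMap.comp_apply, cyclicT_tprod, map_smul,
    face_tprod, LinearMap.smul_apply]
  congr 2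
  obtain ⟨c, rfl⟩ := exists_eq_val a
  ext ⟨l, hl⟩
  simp only [cons_val, Fin.val_last, Fin.val_castSucc]
  simp only [faceTuple, Fin.last, Fin.castSucc_mk, Fin.succ_mk, Fin.ext_iff, Fin.val_zero]
  rcases Nat.eq_zero_or_pos l with rfl | hl0
  · simp
  · have : l ≠ 0 := by omega
    simp [this]

/-- The alternating sum of `d_i d_j` over all `i`, `j` vanishes by the simplicial identities. -/
theorem alternating_sum_comp {U V W : Type u} [AddCommGroup U] [AddCommGroup V] [AddCommGroup W]
    [Module k U] [Module k V] [Module k W] (m : ℕ) (F : Fin m → V →ₗ[k] W)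
    (G : Fin (m + 1) → U →ₗ[k] V)
    (h : ∀ (i : Fin m) (j : Fin (m + 1)) (hij : i.castSucc < j),
      F i ∘ₗ G j = F (j.pred (Fin.ne_zero_of_lt hij)) ∘ₗ G i.castSucc) :
    (∑ i : Fin m, (-1 : k) ^ (i : ℕ) • F i) ∘ₗ
      (∑ j : Fin (m + 1), (-1 : k) ^ (j : ℕ) • G j) = 0 := by
  have expand : (∑ i : Fin m, (-1 : k) ^ (i : ℕ) • F i) ∘ₗ
      (∑ j : Fin (m + 1), (-1 : k) ^ (j : ℕ) • G j) =
      ∑ x : Fin m × Fin (m + 1), (-1 : k) ^ (x.1 + x.2 : ℕ) • (F x.1 ∘ₗ G x.2) := by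
    ext u
    simp only [LinearMap.comp_apply, LinearMap.sum_apply, map_sum, LinearMap.smul_apply, map_smul,
      Fintype.sum_prod_type, pow_add, smul_smul, Finset.smul_sum]
    rw [Finset.sum_comm]
    exact Finset.sum_congr rfl fun i _ => Finset.sum_congr rfl fun j _ => by rw [mul_comm]
  rw [expand]
  have hlast : ∀ x : Fin m × Fin (m + 1), ¬ x.1.castSucc < x.2 → x.2 ≠ Fin.last m := fun x hx e => by
    rw [e] at hx
    exact hx (Fin.castSucc_lt_last x.1)
  have cancel : ∀ (i : Fin m) (j : Fin (m + 1)) (hij : i.castSucc < j),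
      (-1 : k) ^ (i + j : ℕ) • (F i ∘ₗ G j) +
        (-1 : k) ^ ((j.pred (Fin.ne_zero_of_lt hij)) + i.castSucc : ℕ) •
          (F (j.pred (Fin.ne_zero_of_lt hij)) ∘ₗ G i.castSucc) = 0 := fun i j hij => by
    rw [h i j hij, ← add_smul]
    have : (i + j : ℕ) = (j.pred (Fin.ne_zero_of_lt hij) : ℕ) + i.castSucc + 1 := by
      have : (i : ℕ) < j := hij
      simp only [Fin.val_pred, Fin.val_castSucc]
      omega
    rw [this, pow_succ, mul_neg_one, neg_add_cancel, zero_smul]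
  refine Finset.sum_involution (s := Finset.univ) (fun x _ =>
    if hx : x.1.castSucc < x.2 then (x.2.pred (Fin.ne_zero_of_lt hx), x.1.castSucc)
    else (x.2.castPred (hlast x hx), x.1.succ)) ?_ ?_ (fun _ _ => Finset.mem_univ _) ?_
  · rintro ⟨i, j⟩ -
    by_cases hij : i.castSucc < j
    · simp only [dif_pos hij]
      exact cancel i j hij
    · simp only [dif_neg hij]
      have hlt : (j.castPred (hlast (i, j) hij)).castSucc < i.succ := by
        rw [Fin.castSucc_castPred, Fin.lt_def, Fin.val_succ]
        have : (j : ℕ) ≤ i := not_lt.1 hij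
        omega
      have := cancel _ _ hlt
      simp only [Fin.castSucc_castPred, Fin.pred_succ] at this
      rw [add_comm]
      exact this
  · rintro ⟨i, j⟩ - -
    by_cases hij : i.castSucc < j
    · have : (i : ℕ) < j := hij
      simp only [dif_pos hij, ne_eq, Prod.mk.injEq, Fin.ext_iff, Fin.val_castSucc]
      omega
    · have : (j : ℕ) ≤ i := not_lt.1 hij
      simp only [dif_neg hij, ne_eq, Prod.mk.injEq, Fin.ext_iff, Fin.val_succ]
      omega
  · rintro ⟨i, j⟩ -
    by_cases hij : i.castSucc < j
    · have h' : (i : ℕ) < j := hij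
      have hn : ¬ (j.pred (Fin.ne_zero_of_lt hij)).castSucc < i.castSucc := by
        simp only [Fin.lt_def, Fin.val_castSucc, Fin.val_pred]
        omega
      simp only [dif_pos hij]
      rw [dif_neg hn]
      simp
    · have h' : (j : ℕ) ≤ i := not_lt.1 hij
      have hlt : (j.castPred (hlast (i, j) hij)).castSucc < i.succ := by
        rw [Fin.castSucc_castPred, Fin.lt_def, Fin.val_succ]
        omega
      simp only [dif_neg hij]
      rw [dif_pos hlt]
      simp

theorem hochschildB_hochschildB (n : ℕ) : hochschildB k A n ∘ₗ hochschildB k A (n + 1) = 0 :=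
  alternating_sum_comp k _ _ _ fun i j hij => by
    ext a
    simp [faceTuple_faceTuple A i j hij]

theorem barB_barB (n : ℕ) : barB k A n ∘ₗ barB k A (n + 1) = 0 :=
  alternating_sum_comp k _ _ _ fun i j hij => by
    have hij' : i.castSucc.castSucc < j.castSucc := hij
    ext a
    simp only [LinearMap.compMultilinearMap_apply, LinearMap.comp_apply, face_tprod]
    rw [faceTuple_faceTuple A i.castSucc j.castSucc hij']
    rfl

theorem hochschildB_eq (n : ℕ) :
    hochschildB k A n = barB k A n + (-1 : k) ^ (n + 1) • face k A n (Fin.last (n + 1)) := by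
  rw [hochschildB, Fin.sum_univ_castSucc]
  rfl

theorem hochschildB_comp_cyclicT (n : ℕ) :
    hochschildB k A n ∘ₗ cyclicT k A (n + 1) =
      (-1 : k) ^ (n + 1) • face k A n (Fin.last (n + 1)) + cyclicT k A n ∘ₗ barB k A n := by
  have h : hochschildB k A n ∘ₗ cyclicT k A (n + 1) =
      ∑ i : Fin (n + 2), (-1 : k) ^ (i : ℕ) • (face k A n i ∘ₗ cyclicT k A (n + 1)) := by
    ext a
    simp [hochschildB]
  rw [h, Fin.sum_univ_succ, face_zero_cyclicT]
  simp only [face_succ_cyclicT, Fin.val_zero, pow_zero, one_smul, Fin.val_succ, pow_succ,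
    mul_neg_one, smul_neg, neg_smul, neg_neg]
  congr 1
  ext a
  simp [barB]

theorem hochschildB_one_sub_cyclicT (n : ℕ) :
    hochschildB k A n ∘ₗ (1 - cyclicT k A (n + 1)) = (1 - cyclicT k A n) ∘ₗ barB k A n := by
  rw [LinearMap.comp_sub, hochschildB_comp_cyclicT, LinearMap.sub_comp, Module.End.one_eq_id,
    Module.End.one_eq_id, LinearMap.comp_id, LinearMap.id_comp, hochschildB_eq]
  abel

theorem face_comp_cyclicT_pow (n : ℕ) (i : Fin (n + 2)) :
    ((-1 : k) ^ (i : ℕ) • face k A n i) ∘ₗ cyclicT k A (n + 1) ^ (i : ℕ) =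
      (cyclicT k A n ^ (i : ℕ)) ∘ₗ face k A n 0 := by
  induction i using Fin.induction with
  | zero =>
    ext a
    simp
  | succ i ih =>
    rw [Fin.val_castSucc] at ih
    rw [Fin.val_succ, pow_succ', pow_succ', Module.End.mul_eq_comp, ← LinearMap.comp_assoc,
      LinearMap.smul_comp, face_succ_cyclicT, pow_succ', Module.End.mul_eq_comp,
      LinearMap.comp_assoc, ← ih]
    ext a
    simp

theorem barB_norm (n : ℕ) :
    barB k A n ∘ₗ (∑ i ∈ Finset.range (n + 2), cyclicT k A (n + 1) ^ i) =
      (∑ i ∈ Finset.range (n + 1), cyclicT k A n ^ i) ∘ₗ hochschildB k A n := by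
  set t := cyclicT k A (n + 1) with ht
  set s := cyclicT k A n with hs
  set N := ∑ i ∈ Finset.range (n + 2), t ^ i with hN
  set M := ∑ i ∈ Finset.range (n + 1), s ^ i with hM
  have htp : t ^ (n + 2) = 1 := cyclicT_pow k A (n + 1)
  have hsp : s ^ (n + 1) = 1 := cyclicT_pow k A n
  have h1 : ∀ i : ℕ, t ^ i * N = N := fun i => by
    induction i with
    | zero => simp
    | succ i ih =>
      have := mul_neg_geom_sum t (n + 2)
      rw [htp, sub_self, sub_mul, one_mul, sub_eq_zero] at this
      rw [pow_succ, mul_assoc, ← this, ih]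
  have h2 : ∀ i : ℕ, M * s ^ i = M := fun i => by
    induction i with
    | zero => simp
    | succ i ih =>
      have := geom_sum_mul_neg s (n + 1)
      rw [hsp, sub_self, mul_sub, mul_one, sub_eq_zero] at this
      rw [pow_succ', ← mul_assoc, ← this, ih]
  have h3 : ∀ i : Fin (n + 2), ((-1 : k) ^ (i : ℕ) • face k A n i) ∘ₗ N =
      (s ^ (i : ℕ)) ∘ₗ face k A n 0 ∘ₗ N := fun i => by
    rw [← LinearMap.comp_assoc, ← face_comp_cyclicT_pow, LinearMap.comp_assoc,
      ← Module.End.mul_eq_comp, h1]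
  have h4 : ∀ i : Fin (n + 2), M ∘ₗ ((-1 : k) ^ (i : ℕ) • face k A n i) =
      M ∘ₗ face k A n 0 ∘ₗ t ^ (n + 2 - (i : ℕ)) := fun i => by
    have e : t ^ (i : ℕ) * t ^ (n + 2 - (i : ℕ)) = 1 := by
      rw [← pow_add, Nat.add_sub_cancel' i.2.le, htp]
    calc M ∘ₗ ((-1 : k) ^ (i : ℕ) • face k A n i)
        = M ∘ₗ ((-1 : k) ^ (i : ℕ) • face k A n i) ∘ₗ (t ^ (i : ℕ) * t ^ (n + 2 - (i : ℕ))) := by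
          rw [e]; rfl
      _ = (M * s ^ (i : ℕ)) ∘ₗ face k A n 0 ∘ₗ t ^ (n + 2 - (i : ℕ)) := by
          rw [Module.End.mul_eq_comp, Module.End.mul_eq_comp, ← LinearMap.comp_assoc _ (t ^ _),
            face_comp_cyclicT_pow]
          rfl
      _ = _ := by rw [h2]
  have left : barB k A n ∘ₗ N = M ∘ₗ face k A n 0 ∘ₗ N := by
    have : barB k A n ∘ₗ N = ∑ i : Fin (n + 1),
        ((-1 : k) ^ (i : ℕ) • face k A n i.castSucc) ∘ₗ N := by
      ext a
      simp [barB]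
    rw [this, hM, ← Fin.sum_univ_eq_sum_range (fun i => s ^ i)]
    have e : ∀ i : Fin (n + 1), ((-1 : k) ^ (i : ℕ) • face k A n i.castSucc) ∘ₗ N =
        (s ^ (i : ℕ)) ∘ₗ face k A n 0 ∘ₗ N := fun i => h3 i.castSucc
    simp only [e]
    ext a
    simp
  have right : M ∘ₗ hochschildB k A n = M ∘ₗ face k A n 0 ∘ₗ N := by
    have : M ∘ₗ hochschildB k A n = ∑ i : Fin (n + 2),
        M ∘ₗ ((-1 : k) ^ (i : ℕ) • face k A n i) := by
      ext a
      simp [hochschildB]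
    rw [this, Finset.sum_congr rfl fun i _ => h4 i]
    have hN' : N = ∑ i : Fin (n + 2), t ^ (n + 2 - (i : ℕ)) := by
      rw [Fin.sum_univ_eq_sum_range (fun i => t ^ (n + 2 - i)), ← h1 1, pow_one, hN,
        Finset.mul_sum, ← Finset.sum_range_reflect]
      refine Finset.sum_congr rfl fun i hi => ?_
      rw [← pow_succ']
      congr 1
      have := Finset.mem_range.1 hi
      omega
    rw [hN']
    ext a
    simp
  rw [left, right]

/-- The negative cyclic double complex of a `k`-algebra `A`. -/
def tsyganOfAlgebra : TsyganData k where
  obj q := ModuleCat.of k (⨂[k] _ : Fin (q + 1), A)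
  b q := hochschildB k A q
  b' q := barB k A q
  t q := cyclicT k A q
  b_b q := hochschildB_hochschildB k A q
  b'_b' q := barB_barB k A q
  t_pow q := cyclicT_pow k A q
  b_one_sub_t q := hochschildB_one_sub_cyclicT k A q
  b'_norm q := barB_norm k A q

end Hochschild

/-! ### The ring `k[x_1, …, x_d] / 𝔪²` and its weights -/

section Weights

variable (k : Type u) [CommRing k] (d : ℕ)

/-- The ideal `𝔪 = (x_1, …, x_d)` of `k[x_1, …, x_d]`. -/
abbrev varIdeal : Ideal (MvPolynomial (Fin d) k) :=
  Ideal.span (Set.range fun i : Fin d => (MvPolynomial.X i : MvPolynomial (Fin d) k))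

/-- The ring `A = k[x_1, …, x_d] / 𝔪²`. -/
abbrev TruncPoly : Type u := MvPolynomial (Fin d) k ⧸ varIdeal k d ^ 2

/-- The class in `A` of the monomial `x^s`. -/
def monomialClass (s : Fin d →₀ ℕ) : TruncPoly k d :=
  Ideal.Quotient.mk (varIdeal k d ^ 2) (MvPolynomial.monomial s 1)

/-- The weight `w` part of `A^{⊗ (q+1)}`: the span of the tensor monomials in which the total number
of `x_i`'s is `w`. -/
def weightPart (w q : ℕ) : Submodule k (⨂[k] _ : Fin (q + 1), TruncPoly k d) :=
  Submodule.span k {z | ∃ s : Fin (q + 1) → (Fin d →₀ ℕ),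
    ∑ i, (s i).degree = w ∧ z = PiTensorProduct.tprod k fun i => monomialClass k d (s i)}

theorem faceTuple_monomialClass {n : ℕ} (i : Fin (n + 2)) (s : Fin (n + 2) → (Fin d →₀ ℕ)) :
    ∃ s' : Fin (n + 1) → (Fin d →₀ ℕ), ∑ j, (s' j).degree = ∑ j, (s j).degree ∧
      faceTuple i (fun j => monomialClass k d (s j)) = fun j => monomialClass k d (s' j) := by
  have hmul : ∀ a b : Fin d →₀ ℕ,
      monomialClass k d a * monomialClass k d b = monomialClass k d (a + b) := fun a b => by
    simp [monomialClass, ← map_mul, MvPolynomial.monomial_mul]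
  obtain ⟨i, hi⟩ := i
  by_cases h : i = n + 1
  · refine ⟨fun j => if j = 0 then s (Fin.last (n + 1)) + s 0 else s j.castSucc, ?_, ?_⟩
    · conv_rhs => rw [Fin.sum_univ_castSucc, Fin.sum_univ_succ]
      conv_lhs => rw [Fin.sum_univ_succ]
      simp only [if_true, Fin.succ_ne_zero, if_false, map_add, Fin.castSucc_zero]
      omega
    · ext j
      by_cases hj : j = 0 <;> simp [faceTuple, h, hj, hmul]
  · have hin : i < n + 1 := by omega
    refine ⟨fun j => if (j : ℕ) < i then s j.castSucc
      else if (j : ℕ) = i then s j.castSucc + s j.succ else s j.succ, ?_, ?_⟩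
    · rw [Fin.sum_univ_succAbove _ (⟨i, hin⟩ : Fin (n + 1)).succ,
        Fin.sum_univ_succAbove _ (⟨i, hin⟩ : Fin (n + 1)),
        Fin.sum_univ_succAbove _ (⟨i, hin⟩ : Fin (n + 1))]
      have e : (⟨i, hin⟩ : Fin (n + 1)).succ.succAbove ⟨i, hin⟩ = (⟨i, hin⟩ : Fin (n + 1)).castSucc :=
        Fin.succAbove_of_castSucc_lt _ _ Fin.castSucc_lt_succ
      rw [e, ← add_assoc]
      refine congrArg₂ (· + ·) ?_ (Finset.sum_congr rfl fun j _ => ?_)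
      · simp [add_comm]
      · by_cases hj : (j : ℕ) < i
        · have e1 : (⟨i, hin⟩ : Fin (n + 1)).succAbove j = j.castSucc :=
            Fin.succAbove_of_castSucc_lt _ _ hj
          have e2 : (⟨i, hin⟩ : Fin (n + 1)).succ.succAbove j.castSucc = j.castSucc.castSucc :=
            Fin.succAbove_of_castSucc_lt _ _ (by simp [Fin.lt_def]; omega)
          rw [e1, e2]
          simp [hj]
        · have e1 : (⟨i, hin⟩ : Fin (n + 1)).succAbove j = j.succ :=
            Fin.succAbove_of_le_castSucc _ _ (by simp [Fin.le_def]; omega)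
          have e2 : (⟨i, hin⟩ : Fin (n + 1)).succ.succAbove j.succ = j.succ.succ :=
            Fin.succAbove_of_le_castSucc _ _ (by simp [Fin.le_def]; omega)
          rw [e1, e2]
          have h1 : ¬ (j : ℕ) + 1 < i := by omega
          have h2 : ¬ (j : ℕ) + 1 = i := by omega
          simp [h1, h2]
    · ext j
      simp only [faceTuple, h, if_false, hmul]
      split_ifs <;> rfl

theorem face_mem_weightPart (w q : ℕ) (i : Fin (q + 2)) :
    ∀ x ∈ weightPart k d w (q + 1), face k (TruncPoly k d) q i x ∈ weightPart k d w q := by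
  intro x hx
  induction hx using Submodule.span_induction with
  | mem x hx =>
    obtain ⟨s, hs, rfl⟩ := hx
    obtain ⟨s', hs', e⟩ := faceTuple_monomialClass k d i s
    rw [face_tprod, e]
    exact Submodule.subset_span ⟨s', hs'.trans hs, rfl⟩
  | zero => simp
  | add x y _ _ hx hy => rw [map_add]; exact add_mem hx hy
  | smul c x _ hx => rw [map_smul]; exact Submodule.smul_mem _ _ hx

theorem hochschildB_mem_weightPart (w q : ℕ) :
    ∀ x ∈ weightPart k d w (q + 1), hochschildB k (TruncPoly k d) q x ∈ weightPart k d w q := by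
  intro x hx
  rw [hochschildB, LinearMap.sum_apply]
  exact sum_mem fun i _ => Submodule.smul_mem _ _ (face_mem_weightPart k d w q _ x hx)

theorem barB_mem_weightPart (w q : ℕ) :
    ∀ x ∈ weightPart k d w (q + 1), barB k (TruncPoly k d) q x ∈ weightPart k d w q := by
  intro x hx
  rw [barB, LinearMap.sum_apply]
  exact sum_mem fun i _ => Submodule.smul_mem _ _ (face_mem_weightPart k d w q _ x hx)

theorem cyclicT_mem_weightPart (w q : ℕ) :
    ∀ x ∈ weightPart k d w q, cyclicT k (TruncPoly k d) q x ∈ weightPart k d w q := by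
  intro x hx
  induction hx using Submodule.span_induction with
  | mem x hx =>
    obtain ⟨s, hs, rfl⟩ := hx
    rw [cyclicT, LinearMap.smul_apply, LinearEquiv.coe_coe, PiTensorProduct.reindex_tprod]
    refine Submodule.smul_mem _ _ (Submodule.subset_span
      ⟨fun i => s ((finRotate (q + 1)).symm i), ?_, rfl⟩)
    rw [← hs]
    exact Equiv.sum_comp (finRotate (q + 1)).symm fun i => (s i).degree
  | zero => simp
  | add x y _ _ hx hy => rw [map_add]; exact add_mem hx hy
  | smul c x _ hx => rw [map_smul]; exact Submodule.smul_mem _ _ hx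

/-- The negative cyclic double complex of `A = k[x_1, …, x_d] / 𝔪²`. -/
abbrev truncTsygan : TsyganData k := tsyganOfAlgebra k (TruncPoly k d)

/-- The weight `w` part of the negative cyclic double complex of `A`. -/
def weightTsygan (w : ℕ) : TsyganData k :=
  (truncTsygan k d).restrict (weightPart k d w) (hochschildB_mem_weightPart k d w)
    (barB_mem_weightPart k d w) (cyclicT_mem_weightPart k d w)

/-- The inclusion of the weight `w` part. -/
def weightInclusion (w : ℕ) : TsyganData.Hom (weightTsygan k d w) (truncTsygan k d) :=
  (truncTsygan k d).restrictInclusion (weightPart k d w) (hochschildB_mem_weightPart k d w)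
    (barB_mem_weightPart k d w) (cyclicT_mem_weightPart k d w)

/-- The negative cyclic homology `HC⁻_n(A)` over `k`. -/
abbrev HCneg (n : ℤ) : ModuleCat.{u} k := (truncTsygan k d).negHomology n

/-- The weight `w` part `(HC⁻)^{(w)}_n(A)` of negative cyclic homology: the homology of the weight
`w` part of the double complex. -/
abbrev HCnegWeight (w : ℕ) (n : ℤ) : ModuleCat.{u} k := (weightTsygan k d w).negHomology n

end Weights

/-! ### The cyclic group action and its cohomology -/

section CyclicGroup

variable (k : Type u) [CommRing k]

/-- The cyclic group `C_w` of order `w`, written multiplicatively. -/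
abbrev Cyc (w : ℕ) : Type u := ULift.{u} (Multiplicative (ZMod w))

/-- The generator `α` of `C_w`. -/
def Cyc.gen (w : ℕ) : Cyc.{u} w := ULift.up (Multiplicative.ofAdd 1)

/-- The homomorphism from `C_w` to the symmetric group sending `α` to the cyclic rotation
`i ↦ i + 1`. -/
def Cyc.toPerm (w : ℕ) : Cyc.{u} w →* Equiv.Perm (Fin w) :=
  (AddMonoidHom.toMultiplicativeLeft (ZMod.lift w
    ⟨zmultiplesHom (Additive (Equiv.Perm (Fin w))) (Additive.ofMul (finRotate w)), by
      simp only [zmultiplesHom_apply, natCast_zsmul, ← ofMul_pow, finRotate_pow_self, ofMul_one]⟩)).comp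
    MulEquiv.ulift.toMonoidHom

theorem Cyc.toPerm_gen (w : ℕ) : Cyc.toPerm w (Cyc.gen w) = finRotate w := by
  have h : ZMod.lift w ⟨zmultiplesHom (Additive (Equiv.Perm (Fin w))) (Additive.ofMul (finRotate w)),
      by simp only [zmultiplesHom_apply, natCast_zsmul, ← ofMul_pow, finRotate_pow_self,
        ofMul_one]⟩ ((1 : ℤ) : ZMod w) = Additive.ofMul (finRotate w) := by
    rw [ZMod.lift_coe]
    simp
  rw [Int.cast_one] at h
  exact congrArg Additive.toMul h

variable (d : ℕ)

/-- The `k`-module `𝔪̄ = 𝔪 / 𝔪²`. -/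
abbrev CotangentMod : Type u := (varIdeal k d).Cotangent

/-- The representation of `C_w` on `𝔪̄^{⊗ w}` in which the generator `α` acts by the signed cyclic
rotation. -/
def cycRep (w : ℕ) : Representation k (Cyc.{u} w) (⨂[k] _ : Fin w, CotangentMod k d) :=
  (signedPerm k (CotangentMod k d) w).comp (Cyc.toPerm w)

/-- The generator acts by
`α (m_1 ⊗ ⋯ ⊗ m_w) = (-1)^{w-1} (m_w ⊗ m_1 ⊗ ⋯ ⊗ m_{w-1})` (here `w = n + 1`). -/
theorem cycRep_gen_tprod (n : ℕ) (a : Fin (n + 1) → CotangentMod k d) :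
    cycRep k d (n + 1) (Cyc.gen (n + 1)) (PiTensorProduct.tprod k a) =
      (-1 : k) ^ n • PiTensorProduct.tprod k (Fin.cons (a (Fin.last n)) fun i => a i.castSucc) := by
  rw [cycRep, MonoidHom.comp_apply, Cyc.toPerm_gen, ← cyclicT_eq_signedPerm, cyclicT_tprod]

/-- The `k`-linear structure on the category of modules over a `k`-algebra `R`: the scalar `c` acts
on morphisms through multiplication by `c` on the target. -/
@[reducible]
def linearModuleCat (R : Type u) [Ring R] [Algebra k R] : Linear k (ModuleCat.{u} R) :=
  letI : ∀ M : ModuleCat.{u} R, Module k M := fun M => Module.restrictScalars k R M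
  haveI : ∀ M : ModuleCat.{u} R, IsScalarTower k R M := fun M => IsScalarTower.restrictScalars k R M
  { homModule := fun M N => inferInstance
    smul_comp := by
      intros
      ext
      simp
    comp_smul := by
      intros
      ext
      simp }

/-- `Ext^i_R(M, N)` for modules over a `k`-algebra `R`, as a `k`-module. -/
def extModule (R : Type u) [Ring R] [Algebra k R] (i : ℕ) (M N : ModuleCat.{u} R) :
    ModuleCat.{u} k :=
  letI := linearModuleCat k R
  ((Ext k (ModuleCat.{u} R) i).obj (Opposite.op M)).obj N

/-- `Ext^i_{k[C_w]}(k, 𝔪̄^{⊗ w})`, with the trivial action on `k`. -/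
def cycExt (w i : ℕ) : ModuleCat.{u} k :=
  extModule k (MonoidAlgebra k (Cyc.{u} w)) i
    (ModuleCat.of _ (Representation.trivial k (Cyc.{u} w) k).asModule)
    (ModuleCat.of _ (cycRep k d w).asModule)

/-- The group cohomology `H^i(C_w; 𝔪̄^{⊗ w})`. -/
def cycCohomology (w i : ℕ) : ModuleCat.{u} k := groupCohomology (Rep.of (cycRep k d w)) i

end CyclicGroup

end

/-! Write A = k ⊕ m̄ with m̄² = 0. Then A^{⊗(q+1)} is spanned by words of length q+1 in the letters
1, x_1, …, x_d, and such a word has weight at most q+1. So the weight w part of the double complex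
vanishes below row w-1, and its row w-1 is m̄^{⊗w} (`weightPart_eq`, `weightPart_eq_bot`,
`cotangentPowerEquiv`).

Let w = r+1 > 0. The odd columns are exact, because prepending a unit contracts b'
(`barB_insertOne`). In the even columns, words with a unit outside position 0 can be removed up to
boundaries (`sub_homotopy_mem`). The surviving words have w letters, or w+1 letters starting with 1,
so b only has homology in rows r and r+1. Let ρ be the map applying the augmentation to the first
factor (`augFace`). In rows r+1 and r the relations b = (1-t)ρ, ρ(1-t) = b' and ρb = 0 hold; the
first one expresses that b(1 ⊗ m_1 ⊗ ⋯ ⊗ m_w) = (1-t)(m_1 ⊗ ⋯ ⊗ m_w). `IsTwoRow` records this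
situation and `weightTsygan_isTwoRow` proves it.

A two-row total complex maps onto the periodic complex 1-t, N, 1-t, … on row r, which starts in
degree w (`toPeriodic`). The kernel of this map is acyclic: the equation `totD y = z` is solved
column by column, and the infinitely many corrections have a limit because the total complex is a
direct product (`exists_totD_eq`, `exists_totD_eq_of_toPeriodic_eq_zero`). The periodic complex
computes the cohomology of C_w. This agrees with Ext over k[C_w] because representations and modules
over the group ring form equivalent categories (`nonempty_extModule_linearEquiv_groupCohomology`).

In weight 0 only words of units occur, and an even column has homology k, in row 0 alone; the column
-p contributes it in degree -p.

Each row has only finitely many nonzero weights, so row by row the weight decomposition is a product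
decomposition. Product total complexes and homology of modules both commute with products
(`negHomologyMap_bijective`), which gives the splitting of HC⁻. -/

noncomputable section

/-! ### Homology of complexes of modules in terms of elements -/

section HomologyElements

variable {k : Type u} [CommRing k] {ι : Type*} {c : ComplexShape ι}

/-- The submodule of cycles in degree `i`. -/
def cycleSubmodule (C : HomologicalComplex (ModuleCat.{u} k) c) (i : ι) : Submodule k (C.X i) :=
  LinearMap.ker (C.d i (c.next i)).hom

theorem mem_cycleSubmodule (C : HomologicalComplex (ModuleCat.{u} k) c) (i : ι) (x : C.X i) :
    x ∈ cycleSubmodule C i ↔ ∀ j, C.d i j x = 0 := by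
  refine ⟨fun hx j => ?_, fun hx => hx _⟩
  by_cases h : c.Rel i j
  · obtain rfl := c.next_eq' h
    exact hx
  · rw [C.shape i j h]
    rfl

/-- The cycles in degree `i`, as cycles of the short complex that computes the homology. -/
def cycleSubmoduleEquiv (C : HomologicalComplex (ModuleCat.{u} k) c) (i : ι) :
    cycleSubmodule C i ≃ₗ[k] LinearMap.ker (C.sc i).g.hom where
  toFun x := ⟨x.1, x.2⟩
  invFun x := ⟨x.1, x.2⟩
  map_add' _ _ := rfl
  map_smul' _ _ := rfl
  left_inv _ := rfl
  right_inv _ := rfl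

/-- The class of a cycle in homology. -/
def homologyClass (C : HomologicalComplex (ModuleCat.{u} k) c) (i : ι) :
    cycleSubmodule C i →ₗ[k] C.homology i :=
  ((C.sc i).moduleCatHomologyIso.inv.hom ∘ₗ
    Submodule.mkQ (LinearMap.range (C.sc i).moduleCatToCycles)) ∘ₗ
      (cycleSubmoduleEquiv C i).toLinearMap

theorem homologyClass_surjective (C : HomologicalComplex (ModuleCat.{u} k) c) (i : ι) :
    Function.Surjective (homologyClass C i) :=
  (((ConcreteCategory.bijective_of_isIso (C.sc i).moduleCatHomologyIso.inv).2).comp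
    (Submodule.mkQ_surjective _)).comp (cycleSubmoduleEquiv C i).surjective

theorem homologyClass_eq_zero_iff (C : HomologicalComplex (ModuleCat.{u} k) c) (i : ι)
    (x : cycleSubmodule C i) :
    homologyClass C i x = 0 ↔ ∃ j y, C.d j i y = x.1 := by
  have hinj := (ConcreteCategory.bijective_of_isIso (C.sc i).moduleCatHomologyIso.inv).1
  have : homologyClass C i x = 0 ↔
      Submodule.mkQ (LinearMap.range (C.sc i).moduleCatToCycles) (cycleSubmoduleEquiv C i x) = 0 :=
    ⟨fun h => hinj (h.trans (map_zero (C.sc i).moduleCatHomologyIso.inv.hom).symm),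
      fun h => (congrArg _ h).trans (map_zero (C.sc i).moduleCatHomologyIso.inv.hom)⟩
  rw [this, Submodule.mkQ_apply, Submodule.Quotient.mk_eq_zero]
  constructor
  · rintro ⟨y, hy⟩
    exact ⟨c.prev i, y, congrArg Subtype.val hy⟩
  · rintro ⟨j, y, hy⟩
    by_cases h : c.Rel j i
    · obtain rfl := c.prev_eq' h
      exact ⟨y, Subtype.ext hy⟩
    · rw [C.shape j i h] at hy
      have : x = 0 := Subtype.ext hy.symm
      rw [this]
      exact zero_mem _

theorem homologyMap_homologyClass {C D : HomologicalComplex (ModuleCat.{u} k) c} (f : C ⟶ D)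
    (i : ι) (x : cycleSubmodule C i) (hx : f.f i x.1 ∈ cycleSubmodule D i) :
    HomologicalComplex.homologyMap f i (homologyClass C i x) =
      homologyClass D i ⟨f.f i x.1, hx⟩ := by
  -- In terms of `homologyπ` the class becomes natural in the complex: naturality of `homologyπ`
  -- reduces the claim to an equality of cycles.
  have key : ∀ (C : HomologicalComplex (ModuleCat.{u} k) c) (x : cycleSubmodule C i),
      homologyClass C i x = (C.sc i).homologyπ ((C.sc i).moduleCatCyclesIso.inv (cycleSubmoduleEquiv C i x)) := fun C x => by
    have := congrArg (fun g => g.hom (cycleSubmoduleEquiv C i x)) (C.sc i).moduleCatCyclesIso_inv_π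
    exact this.symm
  rw [key, key]
  have h1 := congrArg (fun g => g.hom ((C.sc i).moduleCatCyclesIso.inv (cycleSubmoduleEquiv C i x)))
    (HomologicalComplex.homologyπ_naturality f i)
  refine h1.trans ?_
  refine congrArg (D.sc i).homologyπ.hom ?_
  -- The inclusion of cycles is injective, so the two cycles may be compared in `D.X i`.
  apply (ModuleCat.mono_iff_injective (D.sc i).iCycles).1 inferInstance
  have h2 := congrArg (fun g => g.hom ((C.sc i).moduleCatCyclesIso.inv (cycleSubmoduleEquiv C i x)))
    (HomologicalComplex.cyclesMap_i f i)
  refine h2.trans ?_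
  have h3 := congrArg (fun g => g.hom (cycleSubmoduleEquiv C i x)) (C.sc i).moduleCatCyclesIso_inv_iCycles
  have h4 := congrArg (fun g => g.hom (cycleSubmoduleEquiv D i ⟨f.f i x.1, hx⟩))
    (D.sc i).moduleCatCyclesIso_inv_iCycles
  exact (congrArg (f.f i).hom h3).trans h4.symm

theorem subsingleton_homology (C : HomologicalComplex (ModuleCat.{u} k) c) (i : ι)
    (h : ∀ x, (∀ j, C.d i j x = 0) → ∃ j y, C.d j i y = x) : Subsingleton (C.homology i) := by
  refine subsingleton_of_forall_eq 0 fun z => ?_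
  obtain ⟨x, rfl⟩ := homologyClass_surjective C i z
  exact (homologyClass_eq_zero_iff C i x).2 (h x.1 ((mem_cycleSubmodule C i _).1 x.2))

/-- Both targets are the quotient of `Z` by one and the same kernel. In the two comparisons of
homology that follow, `Z` is the module of cycles. -/
theorem nonempty_linearEquiv_of_ker_eq {Z V W : Type*} [AddCommGroup Z] [AddCommGroup V]
    [AddCommGroup W] [Module k Z] [Module k V] [Module k W] (a : Z →ₗ[k] V) (b : Z →ₗ[k] W)
    (ha : Function.Surjective a) (hb : Function.Surjective b)
    (h : ∀ z, a z = 0 ↔ b z = 0) : Nonempty (V ≃ₗ[k] W) :=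
  ⟨(a.quotKerEquivOfSurjective ha).symm.trans
    ((Submodule.quotEquivOfEq _ _ (by ext z; exact h z)).trans (b.quotKerEquivOfSurjective hb))⟩

theorem nonempty_homology_linearEquiv_module (C : HomologicalComplex (ModuleCat.{u} k) c) (i : ι)
    {V : Type*} [AddCommGroup V] [Module k V] (φ : C.X i →ₗ[k] V)
    (hb : ∀ j y, φ (C.d j i y) = 0)
    (surj : ∀ v, ∃ x, (∀ j, C.d i j x = 0) ∧ φ x = v)
    (inj : ∀ x, (∀ j, C.d i j x = 0) → φ x = 0 → ∃ j y, C.d j i y = x) :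
    Nonempty (C.homology i ≃ₗ[k] V) := by
  refine nonempty_linearEquiv_of_ker_eq (homologyClass C i) (φ ∘ₗ (cycleSubmodule C i).subtype)
    (homologyClass_surjective C i) (fun v => ?_) fun z => ?_
  · obtain ⟨x, hx, e⟩ := surj v
    exact ⟨⟨x, (mem_cycleSubmodule C i x).2 hx⟩, e⟩
  · rw [homologyClass_eq_zero_iff]
    refine ⟨?_, fun h => inj _ ((mem_cycleSubmodule C i _).1 z.2) h⟩
    rintro ⟨j, y, h⟩
    simp only [LinearMap.comp_apply, Submodule.subtype_apply, ← h, hb]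

/-- Only a linear map in one degree is required, not a chain map. This permits comparing a chain
complex indexed by ℤ with a cochain complex indexed by ℕ, whose differentials may differ by signs.
-/
theorem nonempty_homology_linearEquiv {ι' : Type*} {c' : ComplexShape ι'}
    (C : HomologicalComplex (ModuleCat.{u} k) c) (D : HomologicalComplex (ModuleCat.{u} k) c')
    (i : ι) (i' : ι') (φ : C.X i →ₗ[k] D.X i')
    (hc : ∀ x, (∀ j, C.d i j x = 0) → ∀ j, D.d i' j (φ x) = 0)
    (hb : ∀ j y, ∃ j' y', D.d j' i' y' = φ (C.d j i y))
    (surj : ∀ v, (∀ j, D.d i' j v = 0) →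
      ∃ x, (∀ j, C.d i j x = 0) ∧ ∃ j y, D.d j i' y = φ x - v)
    (inj : ∀ x, (∀ j, C.d i j x = 0) → (∃ j' y', D.d j' i' y' = φ x) → ∃ j y, C.d j i y = x) :
    Nonempty (C.homology i ≃ₗ[k] D.homology i') := by
  have hmem : ∀ x : cycleSubmodule C i, φ x.1 ∈ cycleSubmodule D i' := fun x =>
    (mem_cycleSubmodule D i' _).2 (hc _ ((mem_cycleSubmodule C i _).1 x.2))
  refine nonempty_linearEquiv_of_ker_eq (homologyClass C i)
    (homologyClass D i' ∘ₗ (φ ∘ₗ (cycleSubmodule C i).subtype).codRestrict _ hmem)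
    (homologyClass_surjective C i) (fun v => ?_) fun z => ?_
  · obtain ⟨v, rfl⟩ := homologyClass_surjective D i' v
    obtain ⟨x, hx, hj⟩ := surj v.1 ((mem_cycleSubmodule D i' _).1 v.2)
    refine ⟨⟨x, (mem_cycleSubmodule C i x).2 hx⟩, ?_⟩
    rw [LinearMap.comp_apply, ← sub_eq_zero, ← map_sub, homologyClass_eq_zero_iff]
    exact hj
  · rw [LinearMap.comp_apply, homologyClass_eq_zero_iff, homologyClass_eq_zero_iff]
    refine ⟨?_, fun h => inj _ ((mem_cycleSubmodule C i _).1 z.2) h⟩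
    rintro ⟨j, y, h⟩
    obtain ⟨j', y', h'⟩ := hb j y
    refine ⟨j', y', h'.trans ?_⟩
    rw [h]
    rfl

end HomologyElements

/-! ### `Ext` over a group ring and group cohomology -/

section ExtGroupRing

variable {k G : Type u} [CommRing k] [Group G]

theorem linearModuleCat_smul_apply (R : Type u) [Ring R] [Algebra k R] {M N : ModuleCat.{u} R}
    (a : k) (f : M ⟶ N) (x : M) :
    (letI := linearModuleCat k R; (a • f : M ⟶ N)) x = algebraMap k R a • f x := rfl


/-- This k-linearity of the functor makes the comparison of Hom complexes an isomorphism of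
complexes of k-modules, not just of abelian groups. -/
theorem toModuleMonoidAlgebra_map_smul {V W : Rep.{u} k G} (a : k) (f : V ⟶ W) :
    letI := linearModuleCat k (MonoidAlgebra k G)
    (Rep.toModuleMonoidAlgebra (k := k) (G := G)).map (a • f) =
      a • (Rep.toModuleMonoidAlgebra (k := k) (G := G)).map f := by
  ext x
  rw [linearModuleCat_smul_apply]
  refine Eq.trans ?_ (algebraMap_smul (M := W.ρ.asModule) (MonoidAlgebra k G) a _).symm
  rfl

instance : (Rep.toModuleMonoidAlgebra (k := k) (G := G)).Additive where
  map_add := rfl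

instance : (Rep.toModuleMonoidAlgebra (k := k) (G := G)).PreservesProjectiveObjects :=
  inferInstance

instance : (Rep.toModuleMonoidAlgebra (k := k) (G := G)).PreservesHomology :=
  inferInstance

/-- The functor from representations to k[G]-modules carries the standard resolution of the trivial
representation to a projective resolution. It is fully faithful, so it identifies the Hom complex
computing group cohomology with one computing Ext. -/
theorem nonempty_extModule_linearEquiv_groupCohomology (A : Rep.{u} k G) (n : ℕ) :
    Nonempty (extModule k (MonoidAlgebra k G) n
      (ModuleCat.of _ (Representation.trivial k G k).asModule)
      (ModuleCat.of _ A.ρ.asModule) ≃ₗ[k] groupCohomology A n) := by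
  let _ := linearModuleCat k (MonoidAlgebra k G)
  let F := Rep.toModuleMonoidAlgebra (k := k) (G := G)
  let P := Rep.standardResolution k G
  let Q : ProjectiveResolution (F.obj (Rep.trivial k G k)) := F.mapProjectiveResolution P
  let e : P.complex.linearYonedaObj k A ≅ Q.complex.linearYonedaObj k (F.obj A) :=
    HomologicalComplex.Hom.isoOfComponents (fun i => LinearEquiv.toModuleIso
      { toFun := fun f : (P.complex.X i ⟶ A) => F.map f
        invFun := fun f => F.preimage f
        map_add' := fun _ _ => rfl
        map_smul' := fun a f => toModuleMonoidAlgebra_map_smul a f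
        left_inv := fun f => F.preimage_map f
        right_inv := fun f => F.map_preimage f }) fun i j _ => by
      ext f
      exact (F.map_comp (P.complex.d j i) f).symm
  exact ⟨(Q.isoExt (R := k) n (F.obj A) ≪≫ HomologicalComplex.homologyMapIso e.symm n ≪≫
    (groupCohomologyIso A n P).symm).toLinearEquiv⟩

end ExtGroupRing

/-! ### Total complexes of double complexes with exact columns -/

namespace TsyganData

variable {k : Type u} [CommRing k] (T : TsyganData k)

theorem totD_apply_zero {n m : ℤ} (h : m + 1 = n) (z : T.Tot n) (q : ℕ)
    (hx : (q : ℤ) - ((0 : ℕ) : ℤ) = m) :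
    T.totD n m h z ⟨(0, q), hx⟩ =
      T.vert 0 q (z ⟨(0, q + 1), by push_cast at hx ⊢; omega⟩) := rfl

theorem totD_apply_succ {n m : ℤ} (h : m + 1 = n) (z : T.Tot n) (p q : ℕ)
    (hx : (q : ℤ) - ((p + 1 : ℕ) : ℤ) = m) :
    T.totD n m h z ⟨(p + 1, q), hx⟩ =
      T.vert (p + 1) q (z ⟨(p + 1, q + 1), by push_cast at hx ⊢; omega⟩) +
        T.horiz p q (z ⟨(p, q), by push_cast at hx ⊢; omega⟩) := rfl

theorem totD_eq_vert {n m : ℤ} (h : m + 1 = n) (z : T.Tot n) (p q : ℕ)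
    (hx : (q : ℤ) - (p : ℤ) = m) (hz : ∀ x : Pos n, x.1.1 < p → z x = 0) :
    T.totD n m h z ⟨(p, q), hx⟩ = T.vert p q (z ⟨(p, q + 1), by push_cast at hx ⊢; omega⟩) := by
  rcases p with _ | p
  · rfl
  · rw [totD_apply_succ, hz ⟨(p, q), _⟩ (Nat.lt_succ_self p), map_zero, add_zero]

/-- Column -p of the differential only receives columns -p and -(p-1). This triangular shape is what
allows equations to be solved column by column. -/
theorem totD_congr {n m : ℤ} (h : m + 1 = n) (y z : T.Tot n) (p q : ℕ)
    (hx : (q : ℤ) - (p : ℤ) = m) (hz : ∀ x : Pos n, x.1.1 ≤ p → y x = z x) :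
    T.totD n m h y ⟨(p, q), hx⟩ = T.totD n m h z ⟨(p, q), hx⟩ := by
  rcases p with _ | p
  · rw [totD_apply_zero, totD_apply_zero, hz _ le_rfl]
  · rw [totD_apply_succ, totD_apply_succ, hz _ le_rfl, hz _ (Nat.le_succ p)]

theorem negComplex_d_apply {n m : ℤ} (h : m + 1 = n) (z : T.Tot n) :
    T.negComplex.d n m z = T.totD n m h z := by
  simp only [negComplex, dif_pos h]
  rfl

theorem negComplex_cycle_iff {n m : ℤ} (h : m + 1 = n) (z : T.Tot n) :
    (∀ j, T.negComplex.d n j z = 0) ↔ T.totD n m h z = 0 := by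
  refine ⟨fun hz => (T.negComplex_d_apply h z).symm.trans (hz m), fun hz j => ?_⟩
  by_cases hj : j + 1 = n
  · obtain rfl : j = m := by omega
    exact (T.negComplex_d_apply h z).trans hz
  · rw [T.negComplex.shape n j hj]
    rfl

theorem negComplex_boundary_iff {n m : ℤ} (h : m + 1 = n) (z : T.Tot m) :
    (∃ j, ∃ y : T.negComplex.X j, T.negComplex.d j m y = z) ↔ ∃ y, T.totD n m h y = z := by
  constructor
  · rintro ⟨j, y, e⟩
    by_cases hj : m + 1 = j
    · obtain rfl : j = n := by omega
      exact ⟨y, (T.negComplex_d_apply h y).symm.trans e⟩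
    · rw [T.negComplex.shape j m hj] at e
      exact ⟨0, (map_zero _).trans e⟩
  · rintro ⟨y, e⟩
    exact ⟨n, y, (T.negComplex_d_apply h y).trans e⟩

/-- The column `-p` is exact in row `q`. -/
def ColExact (p : ℕ) : ℕ → Prop
  | 0 => Function.Surjective (T.vert p 0)
  | q + 1 => ∀ x, T.vert p q x = 0 → ∃ y, T.vert p (q + 1) y = x

variable {T}

/-- A partial solution `y` of `totD y = z` on the columns before column `P` can be modified in
column `P` if the equation can be solved there. -/
theorem exists_totD_eq_step {n m : ℤ} (h : n + 1 = m) (z : T.Tot n) (P : ℕ) (y : T.Tot m)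
    (hy : ∀ p q hx, p < P → T.totD m n h y ⟨(p, q), hx⟩ = z ⟨(p, q), hx⟩)
    (hP : ∀ q hx, ∃ c, T.vert P q c = z ⟨(P, q), hx⟩ - T.totD m n h y ⟨(P, q), hx⟩) :
    ∃ y' : T.Tot m, (∀ x, x.1.1 ≠ P → y' x = y x) ∧
      ∀ p q hx, p < P + 1 → T.totD m n h y' ⟨(p, q), hx⟩ = z ⟨(p, q), hx⟩ := by
  by_cases hq : ∃ q : ℕ, (q : ℤ) - (P : ℤ) = n
  · obtain ⟨q, hx⟩ := hq
    obtain ⟨c, hc⟩ := hP q hx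
    let x₀ : Pos m := ⟨(P, q + 1), by push_cast; omega⟩
    -- An entry in column `P` affects the differential in columns `P` and `P + 1` only, so the
    -- equations already solved remain solved.
    refine ⟨y + Pi.single x₀ c, fun x hxP => ?_, fun p q' hx' hp => ?_⟩
    · have : x ≠ x₀ := by
        rintro rfl
        exact hxP rfl
      simp [this]
    · have hzero : ∀ x : Pos m, x.1.1 < P → (Pi.single x₀ c : T.Tot m) x = 0 := fun x hxP => by
        have : x ≠ x₀ := by
          rintro rfl
          exact lt_irrefl _ hxP
        simp [this]
      rcases Nat.lt_succ_iff_lt_or_eq.1 hp with hp | rfl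
      · rw [← hy p q' hx' hp]
        refine T.totD_congr h _ _ p q' hx' fun x hxp => ?_
        rw [Pi.add_apply, hzero x (by omega), add_zero]
      · obtain rfl : q' = q := by omega
        rw [map_add, Pi.add_apply, T.totD_eq_vert h (Pi.single x₀ c) p q' hx hzero]
        have : (Pi.single x₀ c : T.Tot m) x₀ = c := Pi.single_eq_same _ _
        change _ + T.vert p q' ((Pi.single x₀ c : T.Tot m) x₀) = _
        rw [this, hc, add_sub_cancel]
  -- Column `P` has no position of degree `n`, so there is nothing to solve.
  · refine ⟨y, fun _ _ => rfl, fun p q hx hp => hy p q hx ?_⟩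
    refine lt_of_le_of_ne (Nat.lt_succ_iff.1 hp) ?_
    rintro rfl
    exact hq ⟨q, hx⟩

/-- The error of a partial solution of `totD y = z` on the columns before column `P`, for a
cycle `z`, is a vertical cycle in column `P`. -/
theorem vert_sub_totD_eq_zero {n m l : ℤ} (h : n + 1 = m) (h' : l + 1 = n) (z : T.Tot n)
    (hz : T.totD n l h' z = 0) (P : ℕ) (y : T.Tot m)
    (hy : ∀ p q hx, p < P → T.totD m n h y ⟨(p, q), hx⟩ = z ⟨(p, q), hx⟩) (q : ℕ) (hx) :
    T.vert P q (z ⟨(P, q + 1), hx⟩ - T.totD m n h y ⟨(P, q + 1), hx⟩) = 0 := by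
  have hw : T.totD n l h' (z - T.totD m n h y) = 0 := by
    rw [map_sub, hz, zero_sub, neg_eq_zero]
    exact LinearMap.congr_fun (T.totD_totD m n l h h') y
  have := T.totD_eq_vert h' (z - T.totD m n h y) P q (by push_cast at hx; omega) (by
    rintro ⟨⟨p, q⟩, hpq⟩ hp
    rw [Pi.sub_apply, hy p q hpq hp, sub_self])
  rw [hw] at this
  exact this.symm

theorem exists_vert_eq {n m l : ℤ} (h : n + 1 = m) (h' : l + 1 = n) (z : T.Tot n)
    (hz : T.totD n l h' z = 0) (P : ℕ) (y : T.Tot m)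
    (hy : ∀ p q hx, p < P → T.totD m n h y ⟨(p, q), hx⟩ = z ⟨(p, q), hx⟩) (q : ℕ) (hx)
    (hex : T.ColExact P q) :
    ∃ c, T.vert P q c = z ⟨(P, q), hx⟩ - T.totD m n h y ⟨(P, q), hx⟩ := by
  rcases q with _ | q
  · exact hex _
  · exact hex _ (vert_sub_totD_eq_zero h h' z hz P y hy q hx)

/-- A partial solution of `totD y = z` on the columns before column `P`, for a cycle `z`, extends
to a solution if the remaining columns are exact in the relevant rows. -/
theorem exists_totD_eq {n m l : ℤ} (h : n + 1 = m) (h' : l + 1 = n) (z : T.Tot n)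
    (hz : T.totD n l h' z = 0) (P : ℕ) (y : T.Tot m)
    (hy : ∀ p q hx, p < P → T.totD m n h y ⟨(p, q), hx⟩ = z ⟨(p, q), hx⟩)
    (hex : ∀ p q : ℕ, P ≤ p → (q : ℤ) - (p : ℤ) = n → T.ColExact p q) :
    ∃ y' : T.Tot m, (∀ x, x.1.1 < P → y' x = y x) ∧ T.totD m n h y' = z := by
  have step : ∀ (j : ℕ) (y : T.Tot m),
      (∀ p q hx, p < P + j → T.totD m n h y ⟨(p, q), hx⟩ = z ⟨(p, q), hx⟩) →
      ∃ y' : T.Tot m, (∀ x, x.1.1 ≠ P + j → y' x = y x) ∧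
        ∀ p q hx, p < P + (j + 1) → T.totD m n h y' ⟨(p, q), hx⟩ = z ⟨(p, q), hx⟩ :=
    fun j y hy => exists_totD_eq_step h z (P + j) y hy fun q hx =>
      exists_vert_eq h h' z hz (P + j) y hy q hx (hex _ _ (Nat.le_add_right _ _) hx)
  choose! next hnext₁ hnext₂ using step
  let f : ℕ → T.Tot m := fun j => Nat.rec y (fun j y => next j y) j
  have hf : ∀ j p q hx, p < P + j → T.totD m n h (f j) ⟨(p, q), hx⟩ = z ⟨(p, q), hx⟩ := fun j => by
    induction j with
    | zero => exact hy
    | succ j ih => exact hnext₂ j (f j) ih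
  have hstep : ∀ j x, x.1.1 ≠ P + j → f (j + 1) x = f j x := fun j => hnext₁ j (f j) (hf j)
  have hstable : ∀ (x : Pos m) (j i : ℕ), x.1.1 < P + j → f (j + i) x = f j x := fun x j i hx => by
    induction i with
    | zero => rfl
    | succ i ih => rw [← add_assoc, hstep _ _ (by omega), ih]
  -- Stage `j` of the construction changes column `P + j` only, so each coordinate is eventually
  -- constant and column `p` is final at stage `p + 1`. The limit may have infinitely many nonzero
  -- coordinates; it exists because the total complex is a product.
  refine ⟨fun x => f (x.1.1 + 1) x, fun x hx => ?_, ?_⟩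
  · have := hstable x 0 (x.1.1 + 1) (by omega)
    rwa [zero_add] at this
  · ext ⟨⟨p, q⟩, hx⟩
    rw [← hf (p + 1) p q hx (by omega)]
    refine T.totD_congr h _ _ p q hx fun x hxp => ?_
    obtain ⟨i, hi⟩ := Nat.exists_eq_add_of_le hxp
    have e : p + 1 = x.1.1 + 1 + i := by omega
    rw [e, hstable x (x.1.1 + 1) i (by omega)]

theorem subsingleton_negHomology (n : ℤ)
    (hex : ∀ p q : ℕ, (q : ℤ) - (p : ℤ) = n → T.ColExact p q) :
    Subsingleton (T.negHomology n) := by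
  have h : n - 1 + 1 = n := by omega
  refine subsingleton_homology T.negComplex n fun z hz => ?_
  refine (T.negComplex_boundary_iff (rfl : n + 1 = n + 1) z).2 ?_
  obtain ⟨y, -, hy⟩ := exists_totD_eq rfl h z ((T.negComplex_cycle_iff h z).1 hz) 0 0
    (fun p q hx hp => absurd hp p.not_lt_zero)
    fun p q _ => hex p q
  exact ⟨y, hy⟩

/-! ### Double complexes whose even columns have homology in two rows. -/

/-- A double complex whose bottom nonzero row is row `r`, with exact `b'`-columns, and whose
`b`-columns only have homology in the rows `r` and `r + 1`, where it is computed by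
`1 - t : T.obj r → T.obj r` through `ρ`. -/
structure IsTwoRow (T : TsyganData k) (r : ℕ) (ρ : T.obj (r + 1) →ₗ[k] T.obj r) : Prop where
  subsingleton : ∀ q < r, Subsingleton (T.obj q)
  bar_surjective : Function.Surjective (T.b' 0)
  bar_exact : ∀ q x, T.b' q x = 0 → ∃ y, T.b' (q + 1) y = x
  b_exact : ∀ q, r < q → ∀ x, T.b q x = 0 → ∃ y, T.b (q + 1) y = x
  b_exact_of_eq_zero : ∀ x, T.b r x = 0 → ρ x = 0 → ∃ y, T.b (r + 1) y = x
  b_eq : T.b r = (1 - T.t r) ∘ₗ ρ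
  comp_one_sub_t : ρ ∘ₗ (1 - T.t (r + 1)) = T.b' r
  comp_b : ρ ∘ₗ T.b (r + 1) = 0
  surjective : Function.Surjective ρ

theorem colExact_of_odd (hs : Function.Surjective (T.b' 0))
    (he : ∀ q x, T.b' q x = 0 → ∃ y, T.b' (q + 1) y = x) {p : ℕ} (hp : ¬ Even p) (q : ℕ) :
    T.ColExact p q := by
  rcases q with _ | q
  · intro x
    obtain ⟨y, hy⟩ := hs (-x)
    exact ⟨y, by simp [vert, hp, hy]⟩
  · intro x hx
    simp only [vert, hp, if_false, LinearMap.neg_apply, neg_eq_zero] at hx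
    obtain ⟨y, hy⟩ := he q (-x) (by rw [map_neg, hx, neg_zero])
    exact ⟨y, by simp [vert, hp, hy]⟩

namespace IsTwoRow

variable {r : ℕ} {ρ : T.obj (r + 1) →ₗ[k] T.obj r} (hT : T.IsTwoRow r ρ)

include hT in
theorem colExact (p q : ℕ) (h : r + 1 < q ∨ (¬ Even p)) : T.ColExact p q := by
  by_cases hp : Even p
  · obtain ⟨q, rfl⟩ : ∃ q', q = q' + 1 := ⟨q - 1, by have := h.resolve_right (not_not.2 hp); omega⟩
    intro x hx
    simp only [vert, hp, if_true] at hx ⊢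
    exact hT.b_exact q (by have := h.resolve_right (not_not.2 hp); omega) x hx
  · exact colExact_of_odd hT.bar_surjective hT.bar_exact hp q

end IsTwoRow

/-- The differentials `1 - t`, `N`, `1 - t`, … of the periodic complex of row `r`. -/
def periodicD (T : TsyganData k) (r i : ℕ) : T.obj r →ₗ[k] T.obj r :=
  if Even i then 1 - T.t r else T.norm r

theorem periodicD_succ (T : TsyganData k) (r i : ℕ) : T.periodicD r (i + 1) = T.horiz i r := by
  by_cases h : Even i <;> simp [periodicD, horiz, Nat.even_add_one, h]

/-- The projection of the total complex to the periodic complex of row `r`. -/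
def toPeriodic (T : TsyganData k) {r : ℕ} (ρ : T.obj (r + 1) →ₗ[k] T.obj r) (n : ℤ) :
    ∀ i : ℕ, n + i = r + 1 → (T.Tot n →ₗ[k] T.obj r)
  | 0, h => ρ ∘ₗ (LinearMap.proj (⟨(0, r + 1), by push_cast at h ⊢; omega⟩ : Pos n) : T.Tot n →ₗ[k] _)
  | i + 1, h => (LinearMap.proj (⟨(i, r), by push_cast at h ⊢; omega⟩ : Pos n) : T.Tot n →ₗ[k] _) +
      if Even i then 0 else ρ ∘ₗ
        (LinearMap.proj (⟨(i + 1, r + 1), by push_cast at h ⊢; omega⟩ : Pos n) : T.Tot n →ₗ[k] _)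

theorem toPeriodic_succ_apply {r : ℕ} (ρ : T.obj (r + 1) →ₗ[k] T.obj r) (n : ℤ) (i : ℕ)
    (h : n + (i + 1 : ℕ) = r + 1) (z : T.Tot n) :
    T.toPeriodic ρ n (i + 1) h z = z ⟨(i, r), by push_cast at h ⊢; omega⟩ +
      if Even i then 0 else ρ (z ⟨(i + 1, r + 1), by push_cast at h ⊢; omega⟩) := by
  by_cases hi : Even i <;> simp [toPeriodic, hi]

namespace IsTwoRow

variable {r : ℕ} {ρ : T.obj (r + 1) →ₗ[k] T.obj r} (hT : T.IsTwoRow r ρ)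

include hT

/-- The extra ρ-term of `toPeriodic` makes this work. In an odd column the coordinate in row r of a
differential contains -b' of an entry in row r+1. The same entry reaches the next column through
1-t, and ρ(1-t) = b' cancels the unwanted term. In an even column b = (1-t)ρ already has the desired
form. -/
theorem toPeriodic_totD {n m : ℤ} (h : m + 1 = n) (i : ℕ) (hi : n + i = r + 1)
    (hi' : m + (i + 1 : ℕ) = r + 1) (z : T.Tot n) :
    T.toPeriodic ρ m (i + 1) hi' (T.totD n m h z) = T.periodicD r i (T.toPeriodic ρ n i hi z) := by
  have h1 := fun x => LinearMap.congr_fun hT.b_eq x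
  have h2 := fun x => LinearMap.congr_fun hT.comp_one_sub_t x
  have h3 := fun x => LinearMap.congr_fun hT.comp_b x
  simp only [LinearMap.comp_apply, LinearMap.zero_apply] at h1 h2 h3
  rw [toPeriodic_succ_apply]
  rcases i with _ | i
  · rw [totD_apply_zero]
    simp [vert, h1, periodicD, toPeriodic]
  · rw [toPeriodic_succ_apply, totD_apply_succ, totD_apply_succ, periodicD_succ]
    by_cases hi : Even i
    · simp [vert, horiz, hi, Nat.even_add_one, h3, ← h2]
      abel
    · simp [vert, horiz, hi, Nat.even_add_one, h1]
      abel

theorem toPeriodic_surjective (n : ℤ) (i : ℕ) (hi : n + i = r + 1) :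
    Function.Surjective (T.toPeriodic ρ n i hi) := by
  intro v
  rcases i with _ | i
  · obtain ⟨c, rfl⟩ := hT.surjective v
    let x₀ : Pos n := ⟨(0, r + 1), by push_cast at hi ⊢; omega⟩
    exact ⟨Pi.single x₀ c, congrArg ρ (Pi.single_eq_same (M := fun x : Pos n => T.obj x.1.2) x₀ c)⟩
  · let x₀ : Pos n := ⟨(i, r), by push_cast at hi ⊢; omega⟩
    let x₁ : Pos n := ⟨(i + 1, r + 1), by push_cast at hi ⊢; omega⟩
    have hx : x₁ ≠ x₀ := fun e => by
      have := congrArg (fun x => x.1.1) e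
      exact absurd this (Nat.succ_ne_self i)
    refine ⟨Pi.single x₀ v, ?_⟩
    rw [toPeriodic_succ_apply]
    change (Pi.single x₀ v : T.Tot n) x₀ + (if Even i then 0 else ρ ((Pi.single x₀ v : T.Tot n) x₁)) = v
    rw [Pi.single_eq_same, Pi.single_eq_of_ne hx, map_zero, ite_self, add_zero]

/-- Acyclicity of the kernel of the projection. Degree n meets the early columns in rows below r,
where everything vanishes, and the late columns in rows above r+1, where all columns are exact. Only
the positions in rows r and r+1 use the vanishing of the projection of `z`. -/
theorem exists_totD_eq_of_toPeriodic_eq_zero {n m l : ℤ} (h : n + 1 = m) (h' : l + 1 = n) (i : ℕ)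
    (hi : n + i = r + 1) (z : T.Tot n) (hz : T.totD n l h' z = 0)
    (hz' : T.toPeriodic ρ n i hi z = 0) :
    ∃ y : T.Tot m, T.totD m n h y = z ∧
      ∀ (j : ℕ) (hj : m + j = r + 1), T.toPeriodic ρ m j hj y = 0 := by
  rcases i with _ | i
  -- In degree r+1 the critical position is row r+1 of column 0: its entry is a b-cycle killed by ρ,
  -- hence a b-boundary.
  · obtain ⟨y, -, hy⟩ := exists_totD_eq_step h z 0 0 (fun p q hx hp => absurd hp p.not_lt_zero)
      fun q hx => by
        obtain rfl : q = r + 1 := by push_cast at hi hx; omega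
        have hv := vert_sub_totD_eq_zero h h' z hz 0 0 (fun p q hx hp => absurd hp p.not_lt_zero)
          r hx
        rw [map_zero] at hv ⊢
        simp only [vert, Even.zero, if_true] at hv ⊢
        refine hT.b_exact_of_eq_zero _ hv ?_
        rw [Pi.zero_apply, sub_zero]
        exact hz'
    obtain ⟨y', -, hy'⟩ := exists_totD_eq h h' z hz 1 y hy fun p q hp hq =>
      hT.colExact p q (.inl (by push_cast at hi; omega))
    exact ⟨y', hy', fun j hj => by push_cast at hi; omega⟩
  · have hlow : ∀ (p q : ℕ) (hx : (q : ℤ) - (p : ℤ) = n) (a : T.obj q), p < i →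
        a = z ⟨(p, q), hx⟩ := fun p q hx a hp => by
      have := hT.subsingleton q (by push_cast at hi; omega)
      exact Subsingleton.elim _ _
    -- One degree higher, the projection reads column i-1 and, only if i is even and positive, also
    -- column i. For i = 0 it reads column 0.
    have hconcl : ∀ y : T.Tot m, (∀ x : Pos m, x.1.1 < i → y x = 0) →
        (Even i → ∀ x : Pos m, x.1.1 = i → y x = 0) →
        ∀ (j : ℕ) (hj : m + j = r + 1), T.toPeriodic ρ m j hj y = 0 := fun y h1 h2 j hj => by
      obtain rfl : j = i := by push_cast at hi; omega
      rcases j with _ | j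
      · simp only [toPeriodic, LinearMap.comp_apply, LinearMap.proj_apply]
        rw [h2 Even.zero _ rfl, map_zero]
      · rw [toPeriodic_succ_apply, h1 _ (Nat.lt_succ_self j), zero_add]
        by_cases hj : Even j
        · simp [hj]
        · rw [if_neg hj, h2 (by simp [Nat.even_add_one, hj]) _ rfl, map_zero]
    rw [toPeriodic_succ_apply] at hz'
    by_cases hie : Even i
    · rw [if_pos hie, add_zero] at hz'
      -- For even `i` the projection is the entry in row r of column i. It vanishes, so `y = 0`
      -- solves all columns up to i, and the critical column i+1 is an exact b'-column.
      obtain ⟨y, hy0, hy⟩ := exists_totD_eq h h' z hz (i + 1) 0 (fun p q hx hp => by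
        rcases Nat.lt_succ_iff_lt_or_eq.1 hp with hp | rfl
        · exact hlow p q hx _ hp
        · obtain rfl : q = r := by push_cast at hi; omega
          rw [hz', map_zero, Pi.zero_apply]) fun p q hp hq => by
        rcases hp.eq_or_lt with rfl | hp
        · exact hT.colExact _ _ (.inr (by simp [Nat.even_add_one, hie]))
        · exact hT.colExact p q (.inl (by push_cast at hi; omega))
      exact ⟨y, hy, hconcl y (fun x hx => hy0 x (by omega)) fun _ x hx => hy0 x (by omega)⟩
    · rw [if_neg hie] at hz'
      -- Row r is the lowest nonzero row, so exactness of the b'-column there amounts to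
      -- surjectivity.
      have hcol : ∀ x : T.obj r, ∃ c, T.vert i r c = x := fun x => by
        have := colExact_of_odd hT.bar_surjective hT.bar_exact hie r
        rcases r with _ | r
        · exact this x
        · have := hT.subsingleton r r.lt_succ_self
          exact ‹T.ColExact i (r + 1)› x (Subsingleton.elim _ _)
      obtain ⟨y₁, hy₁, hg₁⟩ := exists_totD_eq_step h z i 0 (fun p q hx hp => hlow p q hx _ hp)
        fun q hx => by
          obtain rfl : q = r := by push_cast at hi; omega
          exact hcol _
      have hpos : (r : ℤ) - (i : ℤ) = n := by push_cast at hi; omega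
      have e₁ := hg₁ i r hpos i.lt_succ_self
      rw [T.totD_eq_vert h y₁ i r hpos fun x hx => by
        rw [hy₁ x (by omega), Pi.zero_apply]] at e₁
      simp only [vert, hie, if_false, LinearMap.neg_apply] at e₁
      -- The correction made in column i enters column i+1 through 1-t, and ρ turns it into b'.
      -- Since -b' of that correction is the entry of `z` in row r, ρ of the remaining error is
      -- exactly the projection of `z`, which is zero.
      obtain ⟨y₂, hy₂, hg₂⟩ := exists_totD_eq_step h z (i + 1) y₁ hg₁ fun q hx => by
        obtain rfl : q = r + 1 := by push_cast at hi hx; omega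
        have hv := vert_sub_totD_eq_zero h h' z hz (i + 1) y₁ hg₁ r hx
        have hie' : Even (i + 1) := by simp [Nat.even_add_one, hie]
        simp only [vert, hie', if_true] at hv ⊢
        refine hT.b_exact_of_eq_zero _ hv ?_
        rw [totD_apply_succ, hy₁ _ (Nat.succ_ne_self i), Pi.zero_apply, map_zero, zero_add, map_sub]
        simp only [horiz, hie, if_false]
        have h2 := LinearMap.congr_fun hT.comp_one_sub_t
          (y₁ ⟨(i, r + 1), by push_cast at hi ⊢; omega⟩)
        rw [LinearMap.comp_apply] at h2
        rw [h2, sub_eq_add_neg, e₁, add_comm]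
        exact hz'
      obtain ⟨y, hy0, hy⟩ := exists_totD_eq h h' z hz (i + 2) y₂ hg₂ fun p q hp hq =>
        hT.colExact p q (.inl (by push_cast at hi; omega))
      refine ⟨y, hy, hconcl y (fun x hx => ?_) fun h => absurd h hie⟩
      rw [hy0 x (by omega), hy₂ x (by omega), hy₁ x (by omega), Pi.zero_apply]

/-- The homology of the total complex is that of the periodic complex of row `r`. -/
theorem nonempty_negHomology_linearEquiv (D : CochainComplex (ModuleCat.{u} k) ℕ) (n : ℤ) (i : ℕ)
    (hi : n + i = r + 1) (e : ∀ i, D.X i ≃ₗ[k] T.obj r)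
    (hker : ∀ i x, D.d i (i + 1) x = 0 ↔ T.periodicD r i (e i x) = 0)
    (hrange : ∀ i x, (∃ y, D.d i (i + 1) y = x) ↔ ∃ y, T.periodicD r i y = e (i + 1) x) :
    Nonempty (T.negHomology n ≃ₗ[k] D.homology i) := by
  have h : n - 1 + 1 = n := by omega
  have hi1 : n - 1 + (i + 1 : ℕ) = r + 1 := by push_cast; omega
  have hDker : ∀ x : D.X i, (∀ j, D.d i j x = 0) ↔ T.periodicD r i (e i x) = 0 := fun x => by
    rw [← hker]
    refine ⟨fun hx => hx _, fun hx j => ?_⟩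
    by_cases hj : i + 1 = j
    · subst hj
      exact hx
    · rw [D.shape i j hj]
      rfl
  have hcomm := fun z => hT.toPeriodic_totD h i hi hi1 z
  have hcycle : ∀ z : T.Tot n, T.totD n (n - 1) h z = 0 →
      T.periodicD r i (T.toPeriodic ρ n i hi z) = 0 := fun z hz => by
    rw [← hcomm, hz, map_zero]
  have hbound : ∀ z : T.Tot n, (∃ y, T.totD (n + 1) n rfl y = z) →
      ∃ j y, D.d j i y = (e i).symm (T.toPeriodic ρ n i hi z) := by
    rintro _ ⟨y, rfl⟩
    rcases i with _ | i
    -- Nothing maps into the start of the periodic complex; boundaries from degree r+2 project to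
    -- zero because ρb = 0.
    · refine ⟨0, 0, (map_zero _).trans ?_⟩
      have : T.toPeriodic ρ n 0 hi (T.totD (n + 1) n rfl y) = 0 := LinearMap.congr_fun hT.comp_b _
      rw [this, map_zero]
    · refine ⟨i, ?_⟩
      rw [hrange, LinearEquiv.apply_symm_apply]
      exact ⟨_, (hT.toPeriodic_totD rfl i (by push_cast at hi ⊢; omega) hi y).symm⟩
  refine nonempty_homology_linearEquiv T.negComplex D n i
    ((e i).symm.toLinearMap ∘ₗ T.toPeriodic ρ n i hi) (fun x hx => ?_) (fun j y => ?_)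
    (fun v hv => ?_) fun x hx hb => ?_
  · rw [hDker]
    have := hcycle x ((T.negComplex_cycle_iff h x).1 hx)
    exact (congrArg _ ((e i).apply_symm_apply _)).trans this
  · exact hbound _ ((T.negComplex_boundary_iff rfl _).1 ⟨j, y, rfl⟩)
  · rw [hDker] at hv
    -- An arbitrary lift of a periodic cycle has its differential in the acyclic kernel; subtracting
    -- a preimage lying in the kernel turns the lift into a cycle with the same projection.
    obtain ⟨x, hx⟩ := hT.toPeriodic_surjective n i hi (e i v)
    have hdx : T.toPeriodic ρ (n - 1) (i + 1) hi1 (T.totD n (n - 1) h x) = 0 := by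
      rw [hcomm, hx, hv]
    obtain ⟨x', hx', h0⟩ := hT.exists_totD_eq_of_toPeriodic_eq_zero h
      (by omega : n - 1 - 1 + 1 = n - 1) (i + 1) hi1 _
      (LinearMap.congr_fun (T.totD_totD n (n - 1) (n - 1 - 1) h (by omega)) x) hdx
    refine ⟨x - x', (T.negComplex_cycle_iff h _).2 (by rw [map_sub, hx', sub_self]), i, 0,
      (map_zero _).trans ?_⟩
    have : T.toPeriodic ρ n i hi (x - x') = e i v := by rw [map_sub, h0 i hi, sub_zero, hx]
    exact (sub_eq_zero.2 (((e i).symm_apply_eq).2 this)).symm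
  · refine (T.negComplex_boundary_iff (rfl : n + 1 = n + 1) x).2 ?_
    have hx := (T.negComplex_cycle_iff h x).1 hx
    change T.Tot n at x
    -- The periodic primitive is lifted to the total complex. After subtracting its differential the
    -- cycle has projection zero, so it bounds.
    obtain ⟨y, hy⟩ : ∃ y : T.Tot (n + 1),
        T.toPeriodic ρ n i hi (T.totD (n + 1) n rfl y) = T.toPeriodic ρ n i hi x := by
      obtain ⟨j, v, hv⟩ := hb
      by_cases hj : j + 1 = i
      · subst hj
        obtain ⟨v', hv'⟩ := (hrange j _).1 ⟨v, hv⟩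
        obtain ⟨y, hy⟩ := hT.toPeriodic_surjective (n + 1) j (by push_cast at hi ⊢; omega) v'
        refine ⟨y, ?_⟩
        rw [hT.toPeriodic_totD rfl j (by push_cast at hi ⊢; omega) hi, hy, hv']
        exact (e (j + 1)).apply_symm_apply _
      · rw [D.shape j i hj] at hv
        have hv0 : (e i).symm (T.toPeriodic ρ n i hi x) = 0 := hv.symm
        rw [LinearEquiv.map_eq_zero_iff] at hv0
        exact ⟨0, by rw [map_zero, map_zero, hv0]⟩
    obtain ⟨y', hy', -⟩ := hT.exists_totD_eq_of_toPeriodic_eq_zero rfl h i hi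
      (x - T.totD (n + 1) n rfl y) (by
        rw [map_sub, hx, zero_sub, neg_eq_zero]
        exact LinearMap.congr_fun (T.totD_totD (n + 1) n (n - 1) rfl h) y) (by
        rw [map_sub, hy, sub_self])
    exact ⟨y' + y, by rw [map_add, hy', sub_add_cancel]⟩

theorem subsingleton_negHomology (n : ℤ) (hn : (r : ℤ) + 1 < n) :
    Subsingleton (T.negHomology n) :=
  TsyganData.subsingleton_negHomology n fun p q hpq => hT.colExact p q (.inl (by omega))

end IsTwoRow

/-! ### Double complexes whose even columns have homology in row 0 only. -/

/-- If the `b'`-columns are exact, the `b`-columns are exact except in row `0`, and the maps into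
row `0` of the `b`-columns vanish, then row `0` of the `b`-columns gives the homology. -/
theorem nonempty_negHomology_linearEquiv_of_even (hs : Function.Surjective (T.b' 0))
    (he : ∀ q x, T.b' q x = 0 → ∃ y, T.b' (q + 1) y = x)
    (hb : ∀ q x, T.b q x = 0 → ∃ y, T.b (q + 1) y = x) (hb0 : T.b 0 = 0) (ht0 : T.t 0 = 1)
    (p : ℕ) (hp : Even p) :
    Nonempty (T.negHomology (-(p : ℤ)) ≃ₗ[k] T.obj 0) := by
  have hex : ∀ p' q : ℕ, (q = 0 → ¬ Even p') → T.ColExact p' q := fun p' q h => by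
    by_cases hp : Even p'
    · rcases q with _ | q
      · exact absurd hp (h rfl)
      · intro x hx
        simp only [vert, hp, if_true] at hx ⊢
        exact hb q x hx
    · exact colExact_of_odd hs he hp q
  have h : -(p : ℤ) - 1 + 1 = -(p : ℤ) := by omega
  let x₀ : Pos (-(p : ℤ)) := ⟨(p, 0), by simp⟩
  refine nonempty_homology_linearEquiv_module T.negComplex (-(p : ℤ))
    (LinearMap.proj x₀ : T.Tot (-(p : ℤ)) →ₗ[k] T.obj 0) (fun j y => ?_) (fun v => ?_)
    fun z hz hz0 => ?_
  · obtain ⟨y', hy'⟩ := (T.negComplex_boundary_iff (rfl : -(p : ℤ) + 1 = _) _).1 ⟨j, y, rfl⟩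
    rw [← hy']
    change T.totD (-(p : ℤ) + 1) (-(p : ℤ)) rfl y' x₀ = 0
    -- The position (-p, 0) receives b from row 1, which is zero, and 1-t from the odd column before
    -- it, which is zero in row 0.
    rcases p with _ | p
    · change T.vert 0 0 _ = 0
      simp [vert, hb0]
    · refine (T.totD_apply_succ rfl y' p 0 x₀.2).trans ?_
      have hp' : ¬ Even p := by simpa [Nat.even_add_one] using hp
      simp [vert, horiz, hp, hp', hb0, ht0]
  -- The single entry `v` is extended to a cycle. Among the equations that remain, row 0 occurs only
  -- in column p+1, an odd and hence exact column.
  · obtain ⟨y, hy, hy'⟩ := exists_totD_eq h (by omega : -(p : ℤ) - 1 - 1 + 1 = -(p : ℤ) - 1) 0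
      (map_zero _) (p + 1) (Pi.single x₀ v) (fun p' q hx hp' => by omega) fun p' q hp' hq =>
        hex p' q fun hq0 => by
          obtain rfl : p' = p + 1 := by omega
          simp [Nat.even_add_one, hp]
    refine ⟨y, (T.negComplex_cycle_iff h y).2 hy', ?_⟩
    refine (hy x₀ p.lt_succ_self).trans ?_
    exact Pi.single_eq_same (M := fun x : Pos (-(p : ℤ)) => T.obj x.1.2) x₀ v
  · refine (T.negComplex_boundary_iff (rfl : -(p : ℤ) + 1 = _) z).2 ?_
    have hz := (T.negComplex_cycle_iff h z).1 hz
    -- In columns up to p, degree -p has the single position (-p, 0), where `z` vanishes, so `0` is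
    -- a partial solution.
    obtain ⟨y, -, hy⟩ := exists_totD_eq rfl h z hz (p + 1) 0 (fun p' q hx hp' => by
        obtain ⟨rfl, rfl⟩ : p' = p ∧ q = 0 := by omega
        rw [map_zero]
        exact hz0.symm) fun p' q hp' hq => hex p' q fun hq0 => by omega
    exact ⟨y, hy⟩

/-- Degree n meets row 0 only in column n, and that column exists and is even precisely in the
excluded case. All other positions are exact. -/
theorem subsingleton_negHomology_of_not_even (hs : Function.Surjective (T.b' 0))
    (he : ∀ q x, T.b' q x = 0 → ∃ y, T.b' (q + 1) y = x)
    (hb : ∀ q x, T.b q x = 0 → ∃ y, T.b (q + 1) y = x) (n : ℤ) (hn : ¬ (Even n ∧ n ≤ 0)) :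
    Subsingleton (T.negHomology n) := by
  refine subsingleton_negHomology n fun p q hpq => ?_
  by_cases hp : Even p
  · rcases q with _ | q
    · refine absurd ⟨?_, by omega⟩ hn
      rw [← hpq, Nat.cast_zero, zero_sub, even_neg]
      exact_mod_cast hp
    · intro x hx
      simp only [vert, hp, if_true] at hx ⊢
      exact hb q x hx
  · exact colExact_of_odd hs he hp q

end TsyganData

/-! ### Negative cyclic homology and products of double complexes. -/

namespace TsyganData

variable {k : Type u} [CommRing k] {T : TsyganData k}

theorem Hom.negHomologyMap_homologyClass {S : TsyganData k} (f : Hom T S) (n : ℤ)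
    (x : cycleSubmodule T.negComplex n) (hx : f.negComplexMap.f n x.1 ∈ cycleSubmodule S.negComplex n) :
    f.negHomologyMap n (homologyClass T.negComplex n x) =
      homologyClass S.negComplex n ⟨f.negComplexMap.f n x.1, hx⟩ :=
  homologyMap_homologyClass f.negComplexMap n x hx

theorem Hom.totD_app {S : TsyganData k} (f : Hom T S) {n m : ℤ} (h : m + 1 = n) (z : T.Tot n) :
    S.totD n m h (fun x => f.app x.1.2 (z x)) = fun x => f.app x.1.2 (T.totD n m h z x) := by
  have := congrArg (fun g => g.hom z) (f.negComplexMap.comm n m)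
  refine Eq.trans ?_ (this.trans ?_)
  · exact (S.negComplex_d_apply h _).symm
  · exact congrArg (fun y : T.Tot m => fun x => f.app x.1.2 (y x)) (T.negComplex_d_apply h z)

/-- If the components of a family of morphisms identify `T` with a product, then the homology of
`T` is the product of the homologies. -/
theorem negHomologyMap_bijective {I : Type*} {S : I → TsyganData k} (f : ∀ i, Hom T (S i))
    (hf : ∀ q, Function.Bijective fun (x : T.obj q) i => (f i).app q x) (n : ℤ) :
    Function.Bijective fun (z : T.negHomology n) i => (f i).negHomologyMap n z := by
  have h : n - 1 + 1 = n := by omega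
  -- A family of elements of the product total complexes may be assembled coordinate by coordinate.
  -- With direct sums the assembled element need not have finite support.
  have hlift : ∀ (m : ℤ) (v : ∀ i, (S i).Tot m), ∃ x : T.Tot m, ∀ i, (fun y => (f i).app _ (x y)) =
      v i := fun m v => by
    choose g hg using fun y : Pos m => (hf y.1.2).2 fun i => v i y
    exact ⟨g, fun i => funext fun y => congrFun (hg y) i⟩
  have hinj : ∀ (m : ℤ) (x x' : T.Tot m), (∀ i, (fun y : Pos m => (f i).app _ (x y)) =
      fun y => (f i).app _ (x' y)) → x = x' := fun m x x' hx =>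
    funext fun y => (hf y.1.2).1 (funext fun i => congrFun (hx i) y)
  have hcyc : ∀ i (x : cycleSubmodule T.negComplex n),
      (f i).negComplexMap.f n x.1 ∈ cycleSubmodule (S i).negComplex n := fun i x => by
    have hx := (T.negComplex_cycle_iff h _).1 ((mem_cycleSubmodule _ _ _).1 x.2)
    refine (mem_cycleSubmodule _ _ _).2 (((S i).negComplex_cycle_iff h _).2 ?_)
    refine ((f i).totD_app h x.1).trans ?_
    rw [hx]
    exact funext fun y => map_zero _
  constructor
  · suffices hz : ∀ z : T.negHomology n, (∀ i, (f i).negHomologyMap n z = 0) → z = 0 by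
      intro z z' hzz
      refine sub_eq_zero.1 (hz _ fun i => ?_)
      rw [map_sub, sub_eq_zero]
      exact congrFun hzz i
    intro z hz
    obtain ⟨x, rfl⟩ := homologyClass_surjective T.negComplex n z
    refine (homologyClass_eq_zero_iff _ _ _).2 ?_
    have hy : ∀ i, ∃ y, (S i).totD (n + 1) n rfl y = fun p => (f i).app _ ((x.1 : T.Tot n) p) :=
      fun i => by
        have := (homologyClass_eq_zero_iff _ _ _).1
          (((f i).negHomologyMap_homologyClass n x (hcyc i x)).symm.trans (hz i))
        exact ((S i).negComplex_boundary_iff rfl _).1 this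
    choose y hy using hy
    obtain ⟨w, hw⟩ := hlift (n + 1) y
    refine (T.negComplex_boundary_iff (rfl : n + 1 = n + 1) _).2 ⟨w, hinj n _ _ fun i => ?_⟩
    rw [← hy, ← hw, (f i).totD_app]
  · intro v
    choose x hx using fun i => homologyClass_surjective (S i).negComplex n (v i)
    obtain ⟨w, hw⟩ := hlift n fun i => (x i).1
    have hwc : w ∈ cycleSubmodule T.negComplex n := by
      refine (mem_cycleSubmodule _ _ _).2 ((T.negComplex_cycle_iff h _).2 (hinj _ _ _ fun i => ?_))
      rw [← (f i).totD_app, hw i]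
      refine (((S i).negComplex_cycle_iff h _).1 ((mem_cycleSubmodule _ _ _).1 (x i).2)).trans ?_
      exact funext fun y => (map_zero _).symm
    refine ⟨homologyClass T.negComplex n ⟨w, hwc⟩, funext fun i => ?_⟩
    refine ((f i).negHomologyMap_homologyClass n ⟨w, hwc⟩ (hcyc i _)).trans ?_
    rw [← hx i]
    exact congrArg _ (Subtype.ext (hw i))

end TsyganData

/-! ### Words in the letters `1, x_1, …, x_d` -/

section Words

variable (k : Type u) [CommRing k] (d : ℕ)

/-- The elements `1, x_1, …, x_d` of `A`. -/
def letter : Option (Fin d) → TruncPoly k d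
  | none => 1
  | some i => Ideal.Quotient.mk _ (MvPolynomial.X i)

/-- The weight of a letter. -/
def letterWeight : Option (Fin d) → ℕ
  | none => 0
  | some _ => 1

/-- The exponent of a letter, as a monomial. -/
def letterExp : Option (Fin d) → (Fin d →₀ ℕ)
  | none => 0
  | some i => Finsupp.single i 1

theorem degree_letterExp (a : Option (Fin d)) : (letterExp d a).degree = letterWeight d a := by
  rcases a <;> simp [letterExp, letterWeight]

variable {d}

@[simp]
theorem letter_none : letter k d none = 1 := rfl

theorem letter_some_mul_letter_some (i j : Fin d) :
    letter k d (some i) * letter k d (some j) = 0 := by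
  rw [letter, letter, ← map_mul, Ideal.Quotient.eq_zero_iff_mem, pow_two]
  exact Ideal.mul_mem_mul (Ideal.subset_span ⟨i, rfl⟩) (Ideal.subset_span ⟨j, rfl⟩)

theorem monomialClass_zero : monomialClass k d 0 = 1 := by
  simp [monomialClass, ← MvPolynomial.C_apply]

theorem monomialClass_single (i : Fin d) :
    monomialClass k d (Finsupp.single i 1) = letter k d (some i) := rfl

theorem monomialClass_add (s t : Fin d →₀ ℕ) :
    monomialClass k d (s + t) = monomialClass k d s * monomialClass k d t := by
  simp [monomialClass, ← map_mul, MvPolynomial.monomial_mul]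

theorem monomialClass_letterExp (a : Option (Fin d)) :
    monomialClass k d (letterExp d a) = letter k d a := by
  rcases a with _ | i
  · exact monomialClass_zero k
  · rfl

/-- The class of a monomial is a letter of the same weight, or zero. -/
theorem monomialClass_eq (s : Fin d →₀ ℕ) :
    (∃ a, letterWeight d a = s.degree ∧ monomialClass k d s = letter k d a) ∨
      monomialClass k d s = 0 := by
  rcases eq_or_ne s 0 with rfl | hs
  · exact .inl ⟨none, by simp [letterWeight], monomialClass_zero k⟩
  obtain ⟨i, hi⟩ := Finsupp.ne_iff.1 hs
  obtain ⟨t, rfl⟩ : ∃ t, s = Finsupp.single i 1 + t :=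
    ⟨s - Finsupp.single i 1, (add_tsub_cancel_of_le (by
      rw [Finsupp.single_le_iff]; exact Nat.one_le_iff_ne_zero.2 hi)).symm⟩
  rcases eq_or_ne t 0 with rfl | ht
  · refine .inl ⟨some i, ?_, by rw [add_zero, monomialClass_single]⟩
    simp [letterWeight]
  obtain ⟨j, hj⟩ := Finsupp.ne_iff.1 ht
  obtain ⟨t, rfl⟩ : ∃ t', t = Finsupp.single j 1 + t' :=
    ⟨t - Finsupp.single j 1, (add_tsub_cancel_of_le (by
      rw [Finsupp.single_le_iff]; exact Nat.one_le_iff_ne_zero.2 hj)).symm⟩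
  right
  rw [monomialClass_add, monomialClass_add, monomialClass_single, monomialClass_single, ← mul_assoc,
    letter_some_mul_letter_some, zero_mul]

theorem span_range_letter : Submodule.span k (Set.range (letter k d)) = ⊤ := by
  refine eq_top_iff.2 fun x _ => ?_
  obtain ⟨f, rfl⟩ := Ideal.Quotient.mk_surjective x
  induction f using MvPolynomial.induction_on' with
  | monomial s a =>
    have : Ideal.Quotient.mk (varIdeal k d ^ 2) (MvPolynomial.monomial s a) =
        a • monomialClass k d s := by
      rw [monomialClass, ← Ideal.Quotient.mkₐ_eq_mk k, ← map_smul, MvPolynomial.smul_monomial,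
        smul_eq_mul, mul_one]
    rw [this]
    refine Submodule.smul_mem _ _ ?_
    rcases monomialClass_eq k s with ⟨l, -, e⟩ | e
    · rw [e]
      exact Submodule.subset_span ⟨l, rfl⟩
    · rw [e]
      exact zero_mem _
  | add f g hf hg =>
    rw [map_add]
    exact add_mem (hf trivial) (hg trivial)

variable (d) in
/-- The augmentation `A → k`. -/
def truncAug : TruncPoly k d →ₐ[k] k :=
  Ideal.Quotient.liftₐ _ (MvPolynomial.aeval fun _ => (0 : k)) fun a ha => by
    have h1 : varIdeal k d ≤ RingHom.ker (MvPolynomial.aeval fun _ : Fin d => (0 : k)) := by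
      rw [Ideal.span_le]
      rintro _ ⟨i, rfl⟩
      simp [RingHom.mem_ker]
    exact h1 (Ideal.pow_le_self two_ne_zero ha)

@[simp]
theorem truncAug_letter_some (i : Fin d) : truncAug k d (letter k d (some i)) = 0 := by
  refine (Ideal.Quotient.lift_mk _ _ _).trans ?_
  simp

variable (d) in
/-- The projections of `A = k ⊕ 𝔪̄` onto `k` and onto `𝔪̄`. -/
def truncProj (s : Bool) : TruncPoly k d →ₗ[k] TruncPoly k d :=
  if s then LinearMap.id - Algebra.linearMap k _ ∘ₗ (truncAug k d).toLinearMap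
  else Algebra.linearMap k _ ∘ₗ (truncAug k d).toLinearMap

theorem truncProj_letter (s : Bool) (a : Option (Fin d)) :
    truncProj k d s (letter k d a) = if s = a.isSome then letter k d a else 0 := by
  rcases a with _ | i <;> cases s <;> simp [truncProj]

/-- The tensor monomial of a word. -/
def word {n : ℕ} (a : Fin n → Option (Fin d)) : ⨂[k] _ : Fin n, TruncPoly k d :=
  PiTensorProduct.tprod k fun i => letter k d (a i)

/-- The weight of a word. -/
def wordWeight {n : ℕ} (a : Fin n → Option (Fin d)) : ℕ := ∑ i, letterWeight d (a i)

theorem wordWeight_le {n : ℕ} (a : Fin n → Option (Fin d)) : wordWeight a ≤ n := by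
  refine (Finset.sum_le_card_nsmul _ _ 1 fun i _ => ?_).trans (by simp)
  rcases a i <;> simp [letterWeight]

theorem span_range_word (n : ℕ) :
    Submodule.span k (Set.range (word k : (Fin n → Option (Fin d)) → _)) = ⊤ := by
  refine eq_top_iff.2 ?_
  rw [← PiTensorProduct.span_tprod_eq_top, Submodule.span_le]
  rintro _ ⟨x, rfl⟩
  have : ∀ i, ∃ c : Option (Fin d) → k, ∑ l, c l • letter k d l = x i := fun i => by
    have := span_range_letter k (d := d) ▸ (Submodule.mem_top (x := x i) (R := k))
    exact (Submodule.mem_span_range_iff_exists_fun k).1 this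
  choose c hc using this
  have e : PiTensorProduct.tprod k x =
      PiTensorProduct.tprod k fun i => ∑ l, c i l • letter k d l := by
    congr
    ext i
    exact (hc i).symm
  rw [e, MultilinearMap.map_sum]
  refine sum_mem fun r _ => ?_
  rw [MultilinearMap.map_smul_univ]
  exact Submodule.smul_mem _ _ (Submodule.subset_span ⟨r, rfl⟩)

/-- A monomial of degree at least 2 is zero in A, so a nonzero tensor monomial has only letters as
factors. -/
theorem weightPart_eq (w q : ℕ) :
    weightPart k d w q = Submodule.span k {z | ∃ a, wordWeight a = w ∧ z = word k a} := by
  refine le_antisymm (Submodule.span_le.2 ?_) (Submodule.span_le.2 ?_)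
  · rintro _ ⟨s, hs, rfl⟩
    by_cases h : ∃ i, monomialClass k d (s i) = 0
    · obtain ⟨i, hi⟩ := h
      rw [MultilinearMap.map_coord_zero _ i hi]
      exact zero_mem _
    · push Not at h
      choose a ha ha' using fun i => (monomialClass_eq k (s i)).resolve_right (h i)
      refine Submodule.subset_span ⟨a, ?_, ?_⟩
      · rw [wordWeight, ← hs]
        exact Finset.sum_congr rfl fun i _ => ha i
      · rw [word]
        congr
        ext i
        exact ha' i
  · rintro _ ⟨a, ha, rfl⟩
    refine Submodule.subset_span ⟨fun i => letterExp d (a i), ?_, ?_⟩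
    · rw [← ha]
      exact Finset.sum_congr rfl fun i _ => degree_letterExp d (a i)
    · rw [word]
      congr
      ext i
      exact (monomialClass_letterExp k (a i)).symm

theorem word_mem_weightPart {q : ℕ} (a : Fin (q + 1) → Option (Fin d)) :
    word k a ∈ weightPart k d (wordWeight a) q := by
  rw [weightPart_eq]
  exact Submodule.subset_span ⟨a, rfl, rfl⟩

theorem weightPart_eq_bot {w q : ℕ} (h : q + 1 < w) : weightPart k d w q = ⊥ := by
  rw [weightPart_eq, Submodule.span_eq_bot]
  rintro _ ⟨a, ha, -⟩
  have := wordWeight_le a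
  omega

variable (d) in
/-- The projection of `A^{⊗ n}` onto its weight `w` part. -/
def weightProj (w n : ℕ) : (⨂[k] _ : Fin n, TruncPoly k d) →ₗ[k] (⨂[k] _ : Fin n, TruncPoly k d) :=
  ∑ s : Fin n → Bool, if (∑ i, (s i).toNat) = w then
    PiTensorProduct.map fun i => truncProj k d (s i) else 0

/-- Exactly one Boolean vector in the sum, the pattern of non-unit letters of the word, gives a
summand that does not kill it. -/
theorem weightProj_word (w : ℕ) {n : ℕ} (a : Fin n → Option (Fin d)) :
    weightProj k d w n (word k a) = if wordWeight a = w then word k a else 0 := by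
  have hsum : (∑ i, ((a i).isSome).toNat) = wordWeight a :=
    Finset.sum_congr rfl fun i _ => by rcases a i <;> rfl
  rw [weightProj, LinearMap.sum_apply, Finset.sum_eq_single fun i => (a i).isSome]
  · rw [hsum]
    split_ifs
    · rw [word, PiTensorProduct.map_tprod]
      congr
      ext i
      rw [truncProj_letter, if_pos rfl]
    · rfl
  · intro s _ hs
    split_ifs
    · obtain ⟨i, hi⟩ := Function.ne_iff.1 hs
      rw [word, PiTensorProduct.map_tprod]
      refine MultilinearMap.map_coord_zero _ i ?_
      rw [truncProj_letter, if_neg hi]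
    · rfl
  · exact fun h => absurd (Finset.mem_univ _) h

theorem weightProj_of_mem {v w q : ℕ} {x : ⨂[k] _ : Fin (q + 1), TruncPoly k d}
    (hx : x ∈ weightPart k d v q) : weightProj k d w (q + 1) x = if v = w then x else 0 := by
  rw [weightPart_eq] at hx
  induction hx using Submodule.span_induction with
  | mem x hx =>
    obtain ⟨a, rfl, rfl⟩ := hx
    exact weightProj_word k w a
  | zero => simp
  | add x y _ _ hx hy =>
    rw [map_add, hx, hy]
    split_ifs <;> simp
  | smul c x _ hx =>
    rw [map_smul, hx]
    split_ifs <;> simp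

theorem linearMap_ext_word {n : ℕ} {V : Type*} [AddCommGroup V] [Module k V]
    {f g : (⨂[k] _ : Fin n, TruncPoly k d) →ₗ[k] V} (h : ∀ a, f (word k a) = g (word k a)) :
    f = g :=
  LinearMap.ext_on_range (span_range_word k n) h

theorem weightProj_mem (w q : ℕ) (x : ⨂[k] _ : Fin (q + 1), TruncPoly k d) :
    weightProj k d w (q + 1) x ∈ weightPart k d w q := by
  have hx := span_range_word k (d := d) (q + 1) ▸ (Submodule.mem_top (x := x) (R := k))
  induction hx using Submodule.span_induction with
  | mem x hx =>
    obtain ⟨a, rfl⟩ := hx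
    rw [weightProj_word]
    split_ifs with h
    · exact h ▸ word_mem_weightPart k a
    · exact zero_mem _
  | zero => simp
  | add x y _ _ hx hy => rw [map_add]; exact add_mem hx hy
  | smul c x _ hx => rw [map_smul]; exact Submodule.smul_mem _ _ hx

theorem sum_weightProj (n : ℕ) :
    ∑ w ∈ Finset.range (n + 1), weightProj k d w n = LinearMap.id := by
  refine linearMap_ext_word k fun a => ?_
  have := wordWeight_le a
  simp only [LinearMap.sum_apply, weightProj_word, LinearMap.id_apply]
  rw [Finset.sum_ite_eq, if_pos (Finset.mem_range.2 (by omega))]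

theorem weightPart_isInternal (q : ℕ) :
    DirectSum.IsInternal fun w : ℕ => weightPart k d w q := by
  rw [DirectSum.isInternal_submodule_iff_iSupIndep_and_iSup_eq_top]
  constructor
  · refine fun v => Submodule.disjoint_def.2 fun x hx hx' => ?_
    have h1 := weightProj_of_mem k (w := v) hx
    rw [if_pos rfl] at h1
    rw [← h1]
    have : (⨆ j, ⨆ _ : j ≠ v, weightPart k d j q) ≤ LinearMap.ker (weightProj k d v (q + 1)) :=
      iSup₂_le fun j hj y hy => by
        rw [LinearMap.mem_ker, weightProj_of_mem k hy, if_neg hj]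
    exact this hx'
  · rw [eq_top_iff, ← span_range_word, Submodule.span_le]
    rintro _ ⟨a, rfl⟩
    exact Submodule.mem_iSup_of_mem (wordWeight a) (word_mem_weightPart k a)

theorem weightProj_comp {q q' : ℕ}
    (f : (⨂[k] _ : Fin (q + 1), TruncPoly k d) →ₗ[k] (⨂[k] _ : Fin (q' + 1), TruncPoly k d))
    (hf : ∀ w, ∀ x ∈ weightPart k d w q, f x ∈ weightPart k d w q') (w : ℕ) :
    weightProj k d w (q' + 1) ∘ₗ f = f ∘ₗ weightProj k d w (q + 1) := by
  refine linearMap_ext_word k fun a => ?_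
  have h := word_mem_weightPart k a
  rw [LinearMap.comp_apply, LinearMap.comp_apply, weightProj_of_mem k h,
    weightProj_of_mem k (hf _ _ h)]
  split_ifs <;> simp

variable (d) in
/-- The projection of the double complex onto its weight `w` part. -/
def weightProjection (w : ℕ) : TsyganData.Hom (truncTsygan k d) (weightTsygan k d w) where
  app q := (weightProj k d w (q + 1)).codRestrict _ (weightProj_mem k w q)
  app_b q := LinearMap.ext fun x => Subtype.ext <| LinearMap.congr_fun
      (weightProj_comp k _ (fun w => hochschildB_mem_weightPart k d w q) w) x
  app_b' q := LinearMap.ext fun x => Subtype.ext <| LinearMap.congr_fun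
      (weightProj_comp k _ (fun w => barB_mem_weightPart k d w q) w) x
  app_t q := LinearMap.ext fun x => Subtype.ext <| LinearMap.congr_fun
      (weightProj_comp k _ (fun w => cyclicT_mem_weightPart k d w q) w) x

theorem weightProjection_inclusion_self (w q : ℕ) (x : (weightTsygan k d w).obj q) :
    (weightProjection k d w).app q ((weightInclusion k d w).app q x) = x :=
  Subtype.ext ((weightProj_of_mem k x.2).trans (if_pos rfl))

theorem weightProjection_inclusion_of_ne (v w : ℕ) (h : v ≠ w) (q : ℕ)
    (x : (weightTsygan k d v).obj q) :
    (weightProjection k d w).app q ((weightInclusion k d v).app q x) = 0 :=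
  Subtype.ext ((weightProj_of_mem k x.2).trans (if_neg h))

/-- Row q only carries weights up to q+1, so there the direct sum over all weights is also the
product. -/
theorem weightProjection_bijective (q : ℕ) : Function.Bijective
    fun (x : (truncTsygan k d).obj q) w => (weightProjection k d w).app q x := by
  constructor
  · intro x y hxy
    have h := fun x => LinearMap.congr_fun (sum_weightProj k (d := d) (q + 1)) x
    simp only [LinearMap.sum_apply, LinearMap.id_apply] at h
    refine (h x).symm.trans (Eq.trans ?_ (h y))
    exact Finset.sum_congr rfl fun w _ => congrArg Subtype.val (congrFun hxy w)
  · intro v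
    refine ⟨∑ w ∈ Finset.range (q + 2), (weightInclusion k d w).app q (v w), funext fun u => ?_⟩
    refine (map_sum ((weightProjection k d u).app q) _ _).trans ?_
    by_cases hu : u ∈ Finset.range (q + 2)
    · rw [Finset.sum_eq_single_of_mem u hu fun w _ hw =>
        weightProjection_inclusion_of_ne k w u hw q (v w), weightProjection_inclusion_self]
    · have : Subsingleton (weightPart k d u q) := by
        rw [weightPart_eq_bot k (by rw [Finset.mem_range] at hu; omega)]
        infer_instance
      exact Subsingleton.elim (α := weightPart k d u q) _ _

end Words

/-! ### Insertion of units and the contraction of the bar complex -/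

/-- Writing tuples as restrictions of functions on ℕ turns identities between faces and insertions
into case distinctions on natural numbers. -/
theorem insertNth_val {A : Type*} {n : ℕ} (p : Fin (n + 1)) (x : A) (c : ℕ → A) :
    (Fin.insertNth p x fun i : Fin n => c (i : ℕ) : Fin (n + 1) → A) =
      fun (i : Fin (n + 1)) => if (i : ℕ) < p then c i else if (i : ℕ) = p then x else c (i - 1) := by
  ext i
  refine Fin.succAboveCases p ?_ (fun i => ?_) i
  · simp
  · rw [Fin.insertNth_apply_succAbove]
    by_cases h : i.castSucc < p
    · have h' : (i : ℕ) < p := h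
      simp [Fin.succAbove_of_castSucc_lt _ _ h, h']
    · have h' : ¬ (i : ℕ) < p := h
      have h1 : ¬ (i : ℕ) + 1 < p := by omega
      have h2 : (i : ℕ) + 1 ≠ p := by omega
      simp [Fin.succAbove_of_le_castSucc _ _ (not_lt.1 h), h1, h2]

theorem removeNth_val {A : Type*} {n : ℕ} (p : Fin (n + 1)) (c : ℕ → A) :
    (Fin.removeNth p fun i : Fin (n + 1) => c (i : ℕ) : Fin n → A) =
      fun (i : Fin n) => if (i : ℕ) < p then c i else c (i + 1) := by
  ext i
  by_cases h : i.castSucc < p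
  · have h' : (i : ℕ) < p := h
    simp [Fin.removeNth, Fin.succAbove_of_castSucc_lt _ _ h, h']
  · have h' : ¬ (i : ℕ) < p := h
    simp [Fin.removeNth, Fin.succAbove_of_le_castSucc _ _ (not_lt.1 h), h']

section Insertion

variable (k : Type u) [CommRing k] (A : Type u) [Ring A] [Algebra k A]

/-- The insertion of the unit at position `p`. -/
def insertOne {n : ℕ} (p : Fin (n + 1)) :
    (⨂[k] _ : Fin n, A) →ₗ[k] (⨂[k] _ : Fin (n + 1), A) :=
  PiTensorProduct.lift ((PiTensorProduct.tprod k (s := fun _ : Fin (n + 1) => A)).curryMid p 1)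

@[simp]
theorem insertOne_tprod {n : ℕ} (p : Fin (n + 1)) (a : Fin n → A) :
    insertOne k A p (PiTensorProduct.tprod k a) =
      PiTensorProduct.tprod k (Fin.insertNth p 1 a : Fin (n + 1) → A) := by
  simp [insertOne]

variable {A}

theorem faceTuple_zero_insertNth_zero {n : ℕ} (a : Fin (n + 1) → A) :
    faceTuple 0 (Fin.insertNth 0 1 a : Fin (n + 2) → A) = a := by
  obtain ⟨c, rfl⟩ := exists_eq_val a
  rw [insertNth_val]
  ext ⟨l, hl⟩
  simp only [faceTuple, Fin.val_zero, Fin.val_castSucc, Fin.val_succ]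
  rcases l with _ | l <;> simp

theorem faceTuple_succ_insertNth_zero {n : ℕ} (i : Fin (n + 1)) (a : Fin (n + 2) → A) :
    faceTuple i.succ.castSucc (Fin.insertNth 0 1 a : Fin (n + 3) → A) =
      Fin.insertNth 0 1 (faceTuple i.castSucc a) := by
  obtain ⟨c, rfl⟩ := exists_eq_val a
  obtain ⟨i, hi⟩ := i
  ext ⟨l, hl⟩
  rcases l with _ | l
  · simp [faceTuple, insertNth_val]
    omega
  · have e : (⟨l + 1, hl⟩ : Fin (n + 2)) = Fin.succAbove 0 ⟨l, by omega⟩ := rfl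
    rw [e, Fin.insertNth_apply_succAbove, ← e, insertNth_val]
    simp only [faceTuple, Fin.val_zero, Fin.val_castSucc, Fin.val_succ]
    grind

theorem faceTuple_last_insertNth_zero {n : ℕ} (a : Fin (n + 1) → A) :
    faceTuple (Fin.last (n + 1)) (Fin.insertNth 0 1 a : Fin (n + 2) → A) =
      Fin.cons (a (Fin.last n)) fun i => a i.castSucc := by
  obtain ⟨c, rfl⟩ := exists_eq_val a
  simp only [Fin.val_last, Fin.val_castSucc]
  rw [cons_val, insertNth_val]
  ext ⟨l, hl⟩
  rcases l with _ | l <;> simp [faceTuple, Fin.ext_iff]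

variable (A)

theorem face_zero_insertOne_zero (n : ℕ) : face k A n 0 ∘ₗ insertOne k A 0 = LinearMap.id := by
  ext a
  simp only [LinearMap.compMultilinearMap_apply, LinearMap.comp_apply, insertOne_tprod,
    face_tprod, LinearMap.id_apply, faceTuple_zero_insertNth_zero]

theorem face_succ_insertOne_zero (n : ℕ) (i : Fin (n + 1)) :
    face k A (n + 1) i.succ.castSucc ∘ₗ insertOne k A 0 =
      insertOne k A 0 ∘ₗ face k A n i.castSucc := by
  ext a
  simp only [LinearMap.compMultilinearMap_apply, LinearMap.comp_apply, insertOne_tprod,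
    face_tprod, faceTuple_succ_insertNth_zero]

/-- The last face absorbs the prepended unit into the last factor, which moves to the front. The
signs (-1)^{n+1} of the face and (-1)^n of `cyclicT` differ by -1. -/
theorem face_last_insertOne_zero (n : ℕ) :
    (-1 : k) ^ (n + 1) • face k A n (Fin.last (n + 1)) ∘ₗ insertOne k A 0 = -cyclicT k A n := by
  ext a
  simp only [LinearMap.compMultilinearMap_apply, LinearMap.smul_apply, LinearMap.comp_apply,
    insertOne_tprod, face_tprod, faceTuple_last_insertNth_zero, LinearMap.neg_apply, cyclicT_tprod,
    pow_succ, mul_neg_one, neg_smul]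

theorem barB_zero_insertOne : barB k A 0 ∘ₗ insertOne k A 0 = LinearMap.id := by
  rw [← face_zero_insertOne_zero k A 0]
  ext a
  simp [barB]

/-- With s prepending a unit, d_0 s = id and d_{i+1} s = s d_i. The latter terms carry opposite
signs in b's and sb', and cancel. -/
theorem barB_insertOne (n : ℕ) :
    barB k A (n + 1) ∘ₗ insertOne k A 0 + insertOne k A 0 ∘ₗ barB k A n = LinearMap.id := by
  have h1 := fun x => LinearMap.congr_fun (face_zero_insertOne_zero k A (n + 1)) x
  have h2 := fun i x => LinearMap.congr_fun (face_succ_insertOne_zero k A n i) x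
  simp only [LinearMap.comp_apply] at h1 h2
  refine LinearMap.ext fun x => ?_
  simp only [LinearMap.add_apply, LinearMap.comp_apply, barB, LinearMap.sum_apply,
    LinearMap.smul_apply, map_sum, map_smul]
  rw [Fin.sum_univ_succ, Fin.castSucc_zero, h1]
  simp only [h2, Fin.val_succ, pow_succ, mul_neg_one, neg_smul, Finset.sum_neg_distrib,
    Fin.val_zero, pow_zero, one_smul, neg_add_cancel_right]

theorem hochschildB_insertOne_eq (n : ℕ) :
    hochschildB k A n ∘ₗ insertOne k A 0 = barB k A n ∘ₗ insertOne k A 0 - cyclicT k A n := by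
  rw [hochschildB_eq, LinearMap.add_comp, LinearMap.smul_comp, face_last_insertOne_zero,
    sub_eq_add_neg]

/-- This and the next two identities describe the faces of a word with a unit inserted at position
j+1; they feed `sub_homotopy_mem`. -/
theorem face_insertOne_self (n : ℕ) (j : Fin (n + 1)) :
    face k A n j.castSucc ∘ₗ insertOne k A j.succ = LinearMap.id := by
  ext a
  simp only [LinearMap.compMultilinearMap_apply, LinearMap.comp_apply, insertOne_tprod,
    face_tprod, LinearMap.id_apply]
  congr 1
  obtain ⟨c, rfl⟩ := exists_eq_val a
  obtain ⟨j, hj⟩ := j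
  rw [insertNth_val]
  ext ⟨l, hl⟩
  simp only [faceTuple, Fin.val_castSucc, Fin.val_succ]
  grind

theorem face_succ_insertOne_self (n : ℕ) (j : Fin (n + 1)) :
    face k A (n + 1) j.succ.castSucc ∘ₗ insertOne k A j.castSucc.succ = LinearMap.id := by
  ext a
  simp only [LinearMap.compMultilinearMap_apply, LinearMap.comp_apply, insertOne_tprod,
    face_tprod, LinearMap.id_apply]
  congr 1
  obtain ⟨c, rfl⟩ := exists_eq_val a
  obtain ⟨j, hj⟩ := j
  rw [insertNth_val]
  ext ⟨l, hl⟩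
  simp only [faceTuple, Fin.val_castSucc, Fin.val_succ]
  grind

theorem face_succ_insertOne_of_lt (n : ℕ) (j : Fin (n + 1)) (i : Fin (n + 2))
    (h : j.castSucc < i) :
    face k A (n + 1) i.succ ∘ₗ insertOne k A j.castSucc.succ =
      insertOne k A j.succ ∘ₗ face k A n i := by
  ext a
  simp only [LinearMap.compMultilinearMap_apply, LinearMap.comp_apply, insertOne_tprod,
    face_tprod]
  congr 1
  obtain ⟨c, rfl⟩ := exists_eq_val a
  obtain ⟨c', hc'⟩ := exists_eq_val (faceTuple i fun j : Fin (n + 2) => c (j : ℕ))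
  rw [hc', insertNth_val, insertNth_val]
  have hc'' : ∀ l : Fin (n + 1), faceTuple i (fun j : Fin (n + 2) => c (j : ℕ)) l = c' l :=
    congrFun hc'
  obtain ⟨j, hj⟩ := j
  obtain ⟨i, hi⟩ := i
  have hij : j < i := h
  ext ⟨l, hl⟩
  have h1 : ∀ (l : ℕ) (hl : l < n + 1), c' l = _ := fun l hl => (hc'' ⟨l, hl⟩).symm
  simp only [faceTuple, Fin.val_castSucc, Fin.val_succ, Fin.ext_iff, Fin.val_zero,
    Fin.val_last] at h1 ⊢
  rcases lt_trichotomy l (j + 1) with hlj | rfl | hlj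
  · have := h1 l (by omega)
    clear h1
    grind
  · clear h1
    grind
  · have := h1 (l - 1) (by omega)
    clear h1
    grind

end Insertion

/-! ### Faces, insertions and rotations of words -/

section WordOperations

variable (k : Type u) [CommRing k] (d : ℕ)

/-- The map `a_0 ⊗ ⋯ ⊗ a_n ↦ ε(a_0) a_1 ⊗ ⋯ ⊗ a_n`, with the augmentation `ε : A → k`. -/
def augFace (n : ℕ) :
    (⨂[k] _ : Fin (n + 1), TruncPoly k d) →ₗ[k] (⨂[k] _ : Fin n, TruncPoly k d) :=
  PiTensorProduct.lift (LinearMap.uncurryLeft (M := fun _ : Fin (n + 1) => TruncPoly k d)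
    ((truncAug k d).toLinearMap.smulRight (PiTensorProduct.tprod k)))

theorem augFace_tprod (n : ℕ) (a : Fin (n + 1) → TruncPoly k d) :
    augFace k d n (PiTensorProduct.tprod k a) =
      truncAug k d (a 0) • PiTensorProduct.tprod k (Fin.tail a) := by
  simp [augFace]

variable {d}

theorem truncAug_letter_of_ne {a : Option (Fin d)} (h : a ≠ none) :
    truncAug k d (letter k d a) = 0 := by
  obtain ⟨i, rfl⟩ := Option.ne_none_iff_exists'.1 h
  exact truncAug_letter_some k i

theorem augFace_word_of_eq {n : ℕ} {a : Fin (n + 1) → Option (Fin d)} (h : a 0 = none) :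
    augFace k d n (word k a) = word k (Fin.tail a) := by
  rw [word, augFace_tprod, h, letter_none, map_one, one_smul]
  rfl

theorem augFace_word_of_ne {n : ℕ} {a : Fin (n + 1) → Option (Fin d)} (h : a 0 ≠ none) :
    augFace k d n (word k a) = 0 := by
  rw [word, augFace_tprod, truncAug_letter_of_ne k h, zero_smul]

/-- The first factor of any face is a_0 or a product containing a_0, hence lies in the augmentation
ideal. -/
theorem augFace_face_word_of_ne {n : ℕ} {a : Fin (n + 2) → Option (Fin d)} (h : a 0 ≠ none)
    (i : Fin (n + 2)) : augFace k d n (face k (TruncPoly k d) n i (word k a)) = 0 := by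
  rw [word, face_tprod, augFace_tprod]
  have : truncAug k d (faceTuple i (fun j => letter k d (a j)) 0) = 0 := by
    have h0 := truncAug_letter_of_ne k h
    simp only [faceTuple, if_true, Fin.castSucc_zero]
    split_ifs with h1 h2 h3
    · rw [map_mul, h0, mul_zero]
    · exact h0
    · rw [map_mul, h0, zero_mul]
    · simp only [Fin.val_zero] at h2 h3
      omega
  rw [this, zero_smul]

theorem augFace_hochschildB_word_of_ne {n : ℕ} {a : Fin (n + 2) → Option (Fin d)} (h : a 0 ≠ none) :
    augFace k d n (hochschildB k (TruncPoly k d) n (word k a)) = 0 := by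
  rw [hochschildB, LinearMap.sum_apply, map_sum]
  refine Finset.sum_eq_zero fun i _ => ?_
  rw [LinearMap.smul_apply, map_smul, augFace_face_word_of_ne k h, smul_zero]

theorem insertOne_word {n : ℕ} (p : Fin (n + 1)) (a : Fin n → Option (Fin d)) :
    insertOne k (TruncPoly k d) p (word k a) =
      word k (Fin.insertNth p none a : Fin (n + 1) → Option (Fin d)) := by
  rw [word, insertOne_tprod, word]
  congr 1
  ext i
  refine Fin.succAboveCases p ?_ (fun i => ?_) i
  · simp
  · simp

theorem wordWeight_insertNth {n : ℕ} (p : Fin (n + 1)) (a : Fin n → Option (Fin d)) :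
    wordWeight (Fin.insertNth p none a : Fin (n + 1) → Option (Fin d)) = wordWeight a := by
  rw [wordWeight, Fin.sum_univ_succAbove _ p]
  simp [wordWeight, letterWeight]

theorem wordWeight_removeNth {n : ℕ} {p : Fin (n + 1)} {a : Fin (n + 1) → Option (Fin d)}
    (h : a p = none) : wordWeight (Fin.removeNth p a) = wordWeight a := by
  rw [wordWeight, wordWeight, Fin.sum_univ_succAbove _ p, h]
  simp [letterWeight, Fin.removeNth]

theorem insertOne_zero_augFace_word {n : ℕ} {a : Fin (n + 1) → Option (Fin d)} (h : a 0 = none) :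
    insertOne k (TruncPoly k d) 0 (augFace k d n (word k a)) = word k a := by
  rw [augFace_word_of_eq k h, insertOne_word]
  congr 1
  rw [Fin.insertNth_zero', ← h, Fin.cons_self_tail]

theorem augFace_insertOne_zero (n : ℕ) :
    augFace k d n ∘ₗ insertOne k (TruncPoly k d) 0 = LinearMap.id := by
  refine linearMap_ext_word k fun a => ?_
  rw [LinearMap.comp_apply, insertOne_word, Fin.insertNth_zero', augFace_word_of_eq k (by simp),
    Fin.tail_cons, LinearMap.id_apply]

theorem face_word_of_castSucc {n : ℕ} {a : Fin (n + 2) → Option (Fin d)} {i : Fin (n + 1)}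
    (h : a i.castSucc = none) :
    face k (TruncPoly k d) n i.castSucc (word k a) = word k (i.castSucc.removeNth a) := by
  rw [word, face_tprod, word]
  congr 1
  obtain ⟨c, rfl⟩ := exists_eq_val a
  rw [removeNth_val]
  obtain ⟨i, hi⟩ := i
  ext ⟨l, hl⟩
  simp only [faceTuple, Fin.val_castSucc, Fin.val_succ] at h ⊢
  have := letter_none k (d := d)
  grind

theorem face_word_of_succ {n : ℕ} {a : Fin (n + 2) → Option (Fin d)} {i : Fin (n + 1)}
    (h : a i.succ = none) :
    face k (TruncPoly k d) n i.castSucc (word k a) = word k (i.succ.removeNth a) := by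
  rw [word, face_tprod, word]
  congr 1
  obtain ⟨c, rfl⟩ := exists_eq_val a
  rw [removeNth_val]
  obtain ⟨i, hi⟩ := i
  ext ⟨l, hl⟩
  simp only [faceTuple, Fin.val_castSucc, Fin.val_succ] at h ⊢
  have := letter_none k (d := d)
  grind

theorem face_word_eq_zero {n : ℕ} {a : Fin (n + 2) → Option (Fin d)} {i : Fin (n + 1)}
    (h : a i.castSucc ≠ none) (h' : a i.succ ≠ none) :
    face k (TruncPoly k d) n i.castSucc (word k a) = 0 := by
  rw [word, face_tprod]
  refine MultilinearMap.map_coord_zero _ i ?_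
  obtain ⟨x, hx⟩ := Option.ne_none_iff_exists'.1 h
  obtain ⟨y, hy⟩ := Option.ne_none_iff_exists'.1 h'
  have hi : (i : ℕ) ≠ n + 1 := i.2.ne
  simp only [faceTuple, hi, if_false, Fin.val_castSucc, lt_irrefl, if_true, hx, hy]
  exact letter_some_mul_letter_some k x y

theorem cyclicT_word {n : ℕ} (a : Fin (n + 1) → Option (Fin d)) :
    cyclicT k (TruncPoly k d) n (word k a) =
      (-1 : k) ^ n • word k (Fin.cons (a (Fin.last n)) fun i => a i.castSucc) := by
  rw [word, cyclicT_tprod, word]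
  congr 2
  ext i
  refine Fin.cases ?_ (fun i => ?_) i <;> simp

theorem wordWeight_snoc {n : ℕ} (a : Fin (n + 1) → Option (Fin d)) :
    wordWeight (Fin.snoc (Fin.tail a) (a 0) : Fin (n + 1) → Option (Fin d)) = wordWeight a := by
  rw [wordWeight, wordWeight, Fin.sum_univ_castSucc, Fin.sum_univ_succ]
  simp [Fin.tail, add_comm]

theorem cyclicT_word_snoc {n : ℕ} (a : Fin (n + 1) → Option (Fin d)) :
    cyclicT k (TruncPoly k d) n
      (word k (Fin.snoc (Fin.tail a) (a 0) : Fin (n + 1) → Option (Fin d))) =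
      (-1 : k) ^ n • word k a := by
  rw [cyclicT_word]
  congr 2
  simp [Fin.cons_self_tail]

/-- A rotation invariant linear map on the words of weight `w` that vanishes on the words with
first letter in `Q` vanishes on the words with some letter in `Q`. -/
theorem eq_zero_of_rotation {n : ℕ} {V : Type*} [AddCommGroup V] [Module k V] (w : ℕ)
    (f : (⨂[k] _ : Fin (n + 1), TruncPoly k d) →ₗ[k] V)
    (hf : ∀ a : Fin (n + 1) → Option (Fin d), wordWeight a = w →
      f (cyclicT k (TruncPoly k d) n (word k a)) = f (word k a))
    (Q : Option (Fin d) → Prop)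
    (h0 : ∀ a : Fin (n + 1) → Option (Fin d), wordWeight a = w → Q (a 0) → f (word k a) = 0)
    (a : Fin (n + 1) → Option (Fin d)) (ha : wordWeight a = w) (i : Fin (n + 1)) (hi : Q (a i)) :
    f (word k a) = 0 := by
  induction i using Fin.induction generalizing a with
  | zero => exact h0 a ha hi
  | succ i ih =>
    -- Moving the first letter to the end shifts the letter at position i+1 to position i and keeps
    -- the weight.
    have h1 := ih (Fin.snoc (Fin.tail a) (a 0) : Fin (n + 1) → Option (Fin d))
      ((wordWeight_snoc a).trans ha) (by simpa [Fin.tail] using hi)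
    rw [← hf _ ((wordWeight_snoc a).trans ha), cyclicT_word_snoc, map_smul] at h1
    have h2 := congrArg (fun v => (-1 : k) ^ n • v) h1
    simpa only [smul_smul, ← pow_add, ← two_mul, pow_mul, neg_one_sq, one_pow, one_smul, smul_zero]
      using h2

/-- The span of the words with property `P`. -/
def wordSpan {n : ℕ} (P : (Fin n → Option (Fin d)) → Prop) :
    Submodule k (⨂[k] _ : Fin n, TruncPoly k d) :=
  Submodule.span k {z | ∃ a, P a ∧ z = word k a}

variable {k}

theorem word_mem_wordSpan {n : ℕ} {P : (Fin n → Option (Fin d)) → Prop}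
    {a : Fin n → Option (Fin d)} (h : P a) : word k a ∈ wordSpan k P :=
  Submodule.subset_span ⟨a, h, rfl⟩

theorem map_mem_of_mem_wordSpan {n : ℕ} {P : (Fin n → Option (Fin d)) → Prop} {V : Type*}
    [AddCommGroup V] [Module k V] (f : (⨂[k] _ : Fin n, TruncPoly k d) →ₗ[k] V)
    (N : Submodule k V) (h : ∀ a, P a → f (word k a) ∈ N) {x : ⨂[k] _ : Fin n, TruncPoly k d}
    (hx : x ∈ wordSpan k P) : f x ∈ N := by
  have : wordSpan k P ≤ N.comap f := by
    rw [wordSpan, Submodule.span_le]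
    rintro _ ⟨a, ha, rfl⟩
    exact h a ha
  exact this hx

theorem weightPart_eq_wordSpan (w q : ℕ) :
    weightPart k d w q = wordSpan k fun a => wordWeight a = w :=
  weightPart_eq k w q

theorem insertOne_mem_weightPart {w q : ℕ} (p : Fin (q + 2))
    {x : ⨂[k] _ : Fin (q + 1), TruncPoly k d} (hx : x ∈ weightPart k d w q) :
    insertOne k (TruncPoly k d) p x ∈ weightPart k d w (q + 1) := by
  rw [weightPart_eq_wordSpan] at hx
  refine map_mem_of_mem_wordSpan _ _ (fun a ha => ?_) hx
  rw [insertOne_word, weightPart_eq_wordSpan]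
  exact word_mem_wordSpan ((wordWeight_insertNth p a).trans ha)

theorem augFace_mem_weightPart {w q : ℕ} {x : ⨂[k] _ : Fin (q + 2), TruncPoly k d}
    (hx : x ∈ weightPart k d w (q + 1)) : augFace k d (q + 1) x ∈ weightPart k d w q := by
  rw [weightPart_eq_wordSpan] at hx
  refine map_mem_of_mem_wordSpan _ _ (fun a ha => ?_) hx
  by_cases h : a 0 = none
  · rw [augFace_word_of_eq k h, weightPart_eq_wordSpan]
    refine word_mem_wordSpan ?_
    rw [← ha, ← wordWeight_removeNth h]
    rfl
  · rw [augFace_word_of_ne k h]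
    exact zero_mem _

/-- With s prepending a unit, id - sρ kills the words starting with a unit, fixes the others, and is
the identity on the kernel of ρ. -/
theorem mem_wordSpan_of_augFace_eq_zero {w q : ℕ} {x : ⨂[k] _ : Fin (q + 1), TruncPoly k d}
    (hx : x ∈ weightPart k d w q) (h : augFace k d q x = 0) :
    x ∈ wordSpan k fun a : Fin (q + 1) → Option (Fin d) => wordWeight a = w ∧ a 0 ≠ none := by
  rw [weightPart_eq_wordSpan] at hx
  have := map_mem_of_mem_wordSpan
    (LinearMap.id - insertOne k (TruncPoly k d) 0 ∘ₗ augFace k d q)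
    (wordSpan k fun a : Fin (q + 1) → Option (Fin d) => wordWeight a = w ∧ a 0 ≠ none)
    (fun a ha => by
      rw [LinearMap.sub_apply, LinearMap.comp_apply, LinearMap.id_apply]
      by_cases h : a 0 = none
      · rw [insertOne_zero_augFace_word k h, sub_self]
        exact zero_mem _
      · rw [augFace_word_of_ne k h, map_zero, sub_zero]
        exact word_mem_wordSpan ⟨ha, h⟩) hx
  rwa [LinearMap.sub_apply, LinearMap.comp_apply, h, map_zero, sub_zero] at this

end WordOperations

/-! ### Normalization of words -/

section Normalization

variable {k : Type u} [CommRing k] {d : ℕ}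

/-- Two adjacent non-unit letters multiply to zero. The only other case is i = 0 with a leading
unit, whose absorption leaves a word with a non-unit first letter; `N` must contain such words only
in that case, so `N = ⊥` is allowed if a_0 is not the unit. -/
theorem face_word_mem {n : ℕ} {a : Fin (n + 2) → Option (Fin d)} {i : Fin (n + 1)}
    (h : i ≠ 0 → a i.castSucc ≠ none) (h' : a i.succ ≠ none)
    (N : Submodule k (⨂[k] _ : Fin (n + 1), TruncPoly k d))
    (hN : a 0 = none → ∀ a', wordWeight a' = wordWeight a → a' 0 ≠ none → word k a' ∈ N) :
    face k (TruncPoly k d) n i.castSucc (word k a) ∈ N := by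
  by_cases hi : a i.castSucc = none
  · obtain rfl : i = 0 := by
      by_contra h0
      exact h h0 hi
    rw [face_word_of_castSucc k hi]
    exact hN hi _ (wordWeight_removeNth hi) h'
  · rw [face_word_eq_zero k hi h']
    exact zero_mem _

/-- This is the step of the normalization. Let s insert a unit at position j+1. Modulo `N`, the
homotopy (-1)^j (bs + sb) equals s d_j on words without units at positions 1, …, j. The map s d_j
restores a word with a unit at position j+1 and kills one without. Subtracting the homotopy
therefore deletes the words having a unit at position j+1. -/
theorem sub_homotopy_mem {n : ℕ} (j : Fin (n + 1)) (a : Fin (n + 2) → Option (Fin d))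
    (ha : ∀ i, i ≠ 0 → i ≤ j.castSucc → a i ≠ none)
    (N : Submodule k (⨂[k] _ : Fin (n + 2), TruncPoly k d))
    (hN : a 0 = none → ∀ a', wordWeight a' = wordWeight a → a' 0 ≠ none → word k a' ∈ N) :
    word k a - (-1 : k) ^ (j : ℕ) •
      (hochschildB k (TruncPoly k d) (n + 1) (insertOne k (TruncPoly k d) j.castSucc.succ (word k a)) +
        insertOne k (TruncPoly k d) j.succ (hochschildB k (TruncPoly k d) n (word k a))) -
      (if a j.succ = none then 0 else word k a) ∈ N := by
  have h1 := LinearMap.congr_fun (face_succ_insertOne_self k (TruncPoly k d) n j) (word k a)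
  have h2 := LinearMap.congr_fun (face_insertOne_self k (TruncPoly k d) (n + 1) j.castSucc) (word k a)
  simp only [LinearMap.comp_apply, LinearMap.id_apply] at h1 h2
  have hσ : ∀ (i : Fin (n + 1)) (hi : i ≤ j), face k (TruncPoly k d) n i.castSucc (word k a) ∈
      N.comap (insertOne k (TruncPoly k d) j.succ) ∨ a i.succ = none := fun i hi => by
    by_cases h : a i.succ = none
    · exact .inr h
    refine .inl (face_word_mem (fun h0 => ha _ (by simpa using h0) (by simpa using hi)) h _
      fun h0 a' hw ha' => ?_)
    rw [Submodule.mem_comap, insertOne_word]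
    refine hN h0 _ ((wordWeight_insertNth _ _).trans hw) ?_
    have : (0 : Fin (n + 2)) = j.succ.succAbove 0 := (Fin.succ_succAbove_zero j).symm
    rw [this, Fin.insertNth_apply_succAbove]
    exact ha'
  -- Faces with index below j multiply letters among a_0, …, a_j, so only a leading unit can prevent
  -- them from vanishing.
  have hlt : ∀ i : Fin (n + 2), i < j.castSucc →
      face k (TruncPoly k d) (n + 1) i.castSucc
        (insertOne k (TruncPoly k d) j.castSucc.succ (word k a)) ∈ N ∧
      insertOne k (TruncPoly k d) j.succ (face k (TruncPoly k d) n i (word k a)) ∈ N := fun i hi => by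
    obtain ⟨i, rfl⟩ : ∃ i' : Fin (n + 1), i = i'.castSucc :=
      ⟨⟨i, by have : (i : ℕ) < j := hi; omega⟩, rfl⟩
    have hij : (i : ℕ) < j := hi
    have hs : a i.succ ≠ none := ha _ (Fin.succ_ne_zero i) (by
      rw [Fin.le_def]; simpa using hij)
    have hv : ∀ l : Fin (n + 2), (l : ℕ) ≤ j →
        (Fin.insertNth j.castSucc.succ none a : Fin (n + 3) → Option (Fin d)) l.castSucc = a l :=
      fun l hl => by
        have : l.castSucc = j.castSucc.succ.succAbove l :=
          (Fin.succAbove_of_castSucc_lt _ _ (by rw [Fin.lt_def]; simp; omega)).symm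
        rw [this, Fin.insertNth_apply_succAbove]
    constructor
    · rw [insertOne_word]
      refine face_word_mem (fun h0 => ?_) ?_ N fun h0 a' hw => hN ?_ a' ?_
      · rw [hv _ (by simpa using hij.le)]
        exact ha _ h0 hi.le
      · rw [Fin.succ_castSucc i, hv _ (by simpa using hij)]
        exact hs
      · rw [← hv 0 (by simp)]
        exact h0
      · exact hw.trans (wordWeight_insertNth _ _)
    · exact (hσ i hij.le).resolve_right hs
  -- In bs the faces d_j and d_{j+1} both give the identity, with opposite signs. For i > j the term
  -- d_{i+1} s of bs cancels s d_i of sb. Terms with i < j lie in `N`, which leaves s d_j.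
  have hb : hochschildB k (TruncPoly k d) (n + 1)
        (insertOne k (TruncPoly k d) j.castSucc.succ (word k a)) +
      insertOne k (TruncPoly k d) j.succ (hochschildB k (TruncPoly k d) n (word k a)) -
      (-1 : k) ^ (j : ℕ) • insertOne k (TruncPoly k d) j.succ
        (face k (TruncPoly k d) n j.castSucc (word k a)) ∈ N := by
    simp only [hochschildB, LinearMap.sum_apply, LinearMap.smul_apply, map_sum, map_smul]
    rw [Fin.sum_univ_succAbove _ j.succ.castSucc, h1, add_assoc (_ • word k a), ← Finset.sum_add_distrib,
      Fin.sum_univ_succAbove _ j.castSucc]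
    have e : j.succ.castSucc.succAbove j.castSucc = j.castSucc.castSucc :=
      Fin.succAbove_of_castSucc_lt _ _ (by simp [Fin.lt_def])
    rw [e, h2]
    refine Eq.subst (motive := (· ∈ N)) ?_ (sum_mem (t := Finset.univ) (f := fun i : Fin (n + 1) =>
      (-1 : k) ^ (j.succ.castSucc.succAbove (j.castSucc.succAbove i) : ℕ) •
        face k (TruncPoly k d) (n + 1) (j.succ.castSucc.succAbove (j.castSucc.succAbove i))
          (insertOne k (TruncPoly k d) j.castSucc.succ (word k a)) +
      (-1 : k) ^ (j.castSucc.succAbove i : ℕ) • insertOne k (TruncPoly k d) j.succ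
        (face k (TruncPoly k d) n (j.castSucc.succAbove i) (word k a))) (fun i _ => ?_))
    · simp only [Fin.val_castSucc, Fin.val_succ, pow_succ]
      module
    · have hne := Fin.succAbove_ne j.castSucc i
      generalize j.castSucc.succAbove i = i at hne ⊢
      rcases lt_or_gt_of_ne hne with h | h
      · have e : j.succ.castSucc.succAbove i = i.castSucc :=
          Fin.succAbove_of_castSucc_lt _ _ (by
            have : (i : ℕ) < j := h
            simp [Fin.lt_def]; omega)
        rw [e]
        exact add_mem (Submodule.smul_mem _ _ (hlt i h).1) (Submodule.smul_mem _ _ (hlt i h).2)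
      · have e : j.succ.castSucc.succAbove i = i.succ :=
          Fin.succAbove_of_le_castSucc _ _ (by
            have : (j : ℕ) < i := h
            simp [Fin.le_def]; omega)
        have h3 := LinearMap.congr_fun (face_succ_insertOne_of_lt k (TruncPoly k d) n j i h) (word k a)
        simp only [LinearMap.comp_apply] at h3
        rw [e, h3, Fin.val_succ, pow_succ (-1 : k), mul_neg_one, neg_smul, neg_add_cancel]
        exact zero_mem _
  have hj : word k a - insertOne k (TruncPoly k d) j.succ
      (face k (TruncPoly k d) n j.castSucc (word k a)) -
      (if a j.succ = none then 0 else word k a) ∈ N := by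
    split_ifs with h
    · rw [face_word_of_succ k h, insertOne_word, ← h, Fin.insertNth_self_removeNth, sub_self, sub_zero]
      exact zero_mem _
    · rw [sub_right_comm, sub_self, zero_sub]
      exact neg_mem ((hσ j le_rfl).resolve_right h)
  have hsq : ∀ v : ⨂[k] _ : Fin (n + 2), TruncPoly k d,
      (-1 : k) ^ (j : ℕ) • (-1 : k) ^ (j : ℕ) • v = v := fun v => by
    rw [smul_smul, ← pow_add, ← two_mul, pow_mul, neg_one_sq, one_pow, one_smul]
  have := sub_mem hj (Submodule.smul_mem N ((-1 : k) ^ (j : ℕ)) hb)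
  rw [smul_sub, hsq] at this
  convert this using 1
  abel

/-- The normalization of Hochschild cycles at position `j + 1`. -/
theorem exists_sub_mem_wordSpan {w n : ℕ} (j : Fin (n + 1))
    {P P' : (Fin (n + 2) → Option (Fin d)) → Prop} (hP : ∀ a, P a → wordWeight a = w)
    (hP' : ∀ a, P a →
      word k a - (-1 : k) ^ (j : ℕ) • (hochschildB k (TruncPoly k d) (n + 1)
          (insertOne k (TruncPoly k d) j.castSucc.succ (word k a)) +
        insertOne k (TruncPoly k d) j.succ (hochschildB k (TruncPoly k d) n (word k a))) ∈
        wordSpan k P') {z : ⨂[k] _ : Fin (n + 2), TruncPoly k d} (hz : z ∈ wordSpan k P)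
    (hbz : hochschildB k (TruncPoly k d) n z = 0) :
    ∃ y ∈ weightPart k d w (n + 2), z - hochschildB k (TruncPoly k d) (n + 1) y ∈ wordSpan k P' := by
  refine ⟨(-1 : k) ^ (j : ℕ) • insertOne k (TruncPoly k d) j.castSucc.succ z,
    Submodule.smul_mem _ _ (insertOne_mem_weightPart _ ?_), ?_⟩
  · exact map_mem_of_mem_wordSpan LinearMap.id _ (fun a ha => hP a ha ▸ word_mem_weightPart k a) hz
  · have := map_mem_of_mem_wordSpan (LinearMap.id - (-1 : k) ^ (j : ℕ) •
      (hochschildB k (TruncPoly k d) (n + 1) ∘ₗ insertOne k (TruncPoly k d) j.castSucc.succ +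
        insertOne k (TruncPoly k d) j.succ ∘ₗ hochschildB k (TruncPoly k d) n)) _ hP' hz
    simpa [hbz] using this

theorem wordSpan_mono {n : ℕ} {P P' : (Fin n → Option (Fin d)) → Prop} (h : ∀ a, P a → P' a) :
    wordSpan k P ≤ wordSpan k P' :=
  Submodule.span_mono fun _ ⟨a, ha, e⟩ => ⟨a, h a ha, e⟩

/-- The normalization of Hochschild cycles at the positions `1, …, m`. -/
theorem exists_sub_mem_wordSpan_of_le {w n : ℕ} (P : ℕ → (Fin (n + 2) → Option (Fin d)) → Prop)
    (hP : ∀ m a, P m a → wordWeight a = w)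
    (hP' : ∀ (j : Fin (n + 1)) (a), P j a →
      word k a - (-1 : k) ^ (j : ℕ) • (hochschildB k (TruncPoly k d) (n + 1)
          (insertOne k (TruncPoly k d) j.castSucc.succ (word k a)) +
        insertOne k (TruncPoly k d) j.succ (hochschildB k (TruncPoly k d) n (word k a))) ∈
        wordSpan k (P (j + 1))) {z : ⨂[k] _ : Fin (n + 2), TruncPoly k d} (hz : z ∈ wordSpan k (P 0))
    (hbz : hochschildB k (TruncPoly k d) n z = 0) (m : ℕ) (hm : m ≤ n + 1) :
    ∃ y ∈ weightPart k d w (n + 2),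
      z - hochschildB k (TruncPoly k d) (n + 1) y ∈ wordSpan k (P m) := by
  induction m with
  | zero => exact ⟨0, zero_mem _, by simpa using hz⟩
  | succ m ih =>
    obtain ⟨y, hy, hzy⟩ := ih (by omega)
    obtain ⟨y', hy', hzy'⟩ := exists_sub_mem_wordSpan (⟨m, by omega⟩ : Fin (n + 1)) (hP m)
      (hP' ⟨m, by omega⟩) hzy (by
        rw [map_sub, hbz, zero_sub, neg_eq_zero]
        exact LinearMap.congr_fun (hochschildB_hochschildB k (TruncPoly k d) n) y)
    exact ⟨y + y', add_mem hy hy', by rwa [map_add, ← sub_sub]⟩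

theorem le_wordWeight {n m : ℕ} {a : Fin (n + 2) → Option (Fin d)}
    (h : ∀ i, i ≠ 0 → a i ≠ none) (h0 : m ≤ letterWeight d (a 0)) :
    m + (n + 1) ≤ wordWeight a := by
  rw [wordWeight, Fin.sum_univ_succ]
  refine add_le_add h0 ?_
  refine le_of_eq_of_le ?_ (Finset.card_nsmul_le_sum Finset.univ _ 1 fun i _ => ?_)
  · simp
  · obtain ⟨x, hx⟩ := Option.ne_none_iff_exists'.1 (h i.succ (Fin.succ_ne_zero i))
    simp [hx, letterWeight]

theorem one_le_letterWeight {a : Option (Fin d)} (h : a ≠ none) : 1 ≤ letterWeight d a := by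
  obtain ⟨x, rfl⟩ := Option.ne_none_iff_exists'.1 h
  exact le_rfl

/-- The cycle is a combination of words with non-unit first letter. After normalization at all later
positions the n+2 letters are all non-units, which would force weight n+2 > w; so nothing is left.
-/
theorem exists_hochschildB_eq_of_augFace_eq_zero {w n : ℕ} (hw : w ≤ n + 1)
    {z : ⨂[k] _ : Fin (n + 2), TruncPoly k d} (hz : z ∈ weightPart k d w (n + 1))
    (hz0 : augFace k d (n + 1) z = 0) (hbz : hochschildB k (TruncPoly k d) n z = 0) :
    ∃ y ∈ weightPart k d w (n + 2), hochschildB k (TruncPoly k d) (n + 1) y = z := by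
  obtain ⟨y, hy, h⟩ := exists_sub_mem_wordSpan_of_le (w := w)
    (fun m (a : Fin (n + 2) → Option (Fin d)) => (wordWeight a = w ∧ a 0 ≠ none) ∧
      ∀ i : Fin (n + 2), i ≠ 0 → (i : ℕ) ≤ m → a i ≠ none) (fun m a h => h.1.1)
    (fun j a ⟨h0, ha⟩ => by
      have := sub_homotopy_mem j a ha (⊥ : Submodule k _) (fun h => absurd h h0.2)
      rw [Submodule.mem_bot, sub_eq_zero] at this
      rw [this]
      split_ifs with h
      · exact zero_mem _
      · refine word_mem_wordSpan ⟨h0, fun i hi hij => ?_⟩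
        rcases hij.lt_or_eq with hlt | heq
        · exact ha i hi (Nat.lt_succ_iff.1 hlt)
        · obtain rfl : i = j.succ := Fin.ext heq
          exact h)
    (wordSpan_mono (fun a ha => ⟨ha, fun i hi hi' => absurd (Fin.ext (Nat.le_zero.1 hi')) hi⟩)
      (mem_wordSpan_of_augFace_eq_zero hz hz0)) hbz (n + 1) le_rfl
  refine ⟨y, hy, (sub_eq_zero.1 ?_).symm⟩
  refine (Submodule.mem_bot k).1 (map_mem_of_mem_wordSpan LinearMap.id ⊥ (fun a ha => ?_) h)
  have := le_wordWeight (fun i hi => ha.2 i hi (Nat.lt_succ_iff.1 i.2)) (one_le_letterWeight ha.1.2)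
  omega

/-- Words with a leading unit are normalized until they would have weight n+1 > w, hence disappear.
What remains starts with non-unit letters and is a boundary by the previous case. -/
theorem exists_hochschildB_eq {w n : ℕ} (hw : w ≤ n)
    {z : ⨂[k] _ : Fin (n + 2), TruncPoly k d} (hz : z ∈ weightPart k d w (n + 1))
    (hbz : hochschildB k (TruncPoly k d) n z = 0) :
    ∃ y ∈ weightPart k d w (n + 2), hochschildB k (TruncPoly k d) (n + 1) y = z := by
  obtain ⟨y, hy, h⟩ := exists_sub_mem_wordSpan_of_le (w := w)
    (fun m (a : Fin (n + 2) → Option (Fin d)) => wordWeight a = w ∧ (a 0 ≠ none ∨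
      ∀ i : Fin (n + 2), i ≠ 0 → (i : ℕ) ≤ m → a i ≠ none)) (fun m a h => h.1)
    (fun j a ⟨hw, h0⟩ => by
      by_cases ha0 : a 0 = none
      · have ha := h0.resolve_left (not_not.2 ha0)
        have := sub_homotopy_mem j a ha (wordSpan k fun a : Fin (n + 2) → Option (Fin d) =>
          wordWeight a = w ∧ (a 0 ≠ none ∨
            ∀ i : Fin (n + 2), i ≠ 0 → (i : ℕ) ≤ j + 1 → a i ≠ none))
          (fun h a' hw' ha' => word_mem_wordSpan ⟨hw'.trans hw, .inl ha'⟩)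
        refine (Submodule.sub_mem_iff_left _ ?_).1 this
        split_ifs with h
        · exact zero_mem _
        · refine word_mem_wordSpan ⟨hw, .inr fun i hi hij => ?_⟩
          rcases hij.lt_or_eq with hlt | heq
          · exact ha i hi (Nat.lt_succ_iff.1 hlt)
          · obtain rfl : i = j.succ := Fin.ext heq
            exact h
      -- Words with non-unit first letter need no normalization here: the homotopy maps their span
      -- to itself, since b and insertion at positive positions do.
      · refine wordSpan_mono (fun a ha => ⟨ha.1, .inl ha.2⟩)
          (mem_wordSpan_of_augFace_eq_zero ?_ ?_)
        · have hwd := hw ▸ word_mem_weightPart k a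
          exact sub_mem hwd (Submodule.smul_mem _ _ (add_mem
            (hochschildB_mem_weightPart k d w _ _ (insertOne_mem_weightPart _ hwd))
            (insertOne_mem_weightPart _ (hochschildB_mem_weightPart k d w _ _ hwd))))
        · have hs : (Fin.insertNth j.castSucc.succ none a : Fin (n + 3) → Option (Fin d)) 0 ≠ none := by
            have : (0 : Fin (n + 3)) = j.castSucc.succ.succAbove 0 :=
              (Fin.succ_succAbove_zero j.castSucc).symm
            rw [this, Fin.insertNth_apply_succAbove]
            exact ha0
          have hb := mem_wordSpan_of_augFace_eq_zero
            (hochschildB_mem_weightPart k d w _ _ (hw ▸ word_mem_weightPart k a))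
            (augFace_hochschildB_word_of_ne k ha0)
          have hσ := map_mem_of_mem_wordSpan
            (augFace k d (n + 1) ∘ₗ insertOne k (TruncPoly k d) j.succ) ⊥ (fun a' ha' => by
              rw [LinearMap.comp_apply, insertOne_word, Submodule.mem_bot]
              refine augFace_word_of_ne k ?_
              have : (0 : Fin (n + 2)) = j.succ.succAbove 0 := (Fin.succ_succAbove_zero j).symm
              rw [this, Fin.insertNth_apply_succAbove]
              exact ha'.2) hb
          rw [Submodule.mem_bot, LinearMap.comp_apply] at hσ
          rw [map_sub, map_smul, map_add, hσ, augFace_word_of_ne k ha0, insertOne_word,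
            augFace_hochschildB_word_of_ne k hs, add_zero, smul_zero, sub_zero])
    (wordSpan_mono (fun a ha => ⟨ha, .inr fun i hi hi' => absurd (Fin.ext (Nat.le_zero.1 hi')) hi⟩)
      (weightPart_eq_wordSpan (k := k) (d := d) w (n + 1) ▸ hz)) hbz (n + 1) le_rfl
  have h0 : augFace k d (n + 1) (z - hochschildB k (TruncPoly k d) (n + 1) y) = 0 := by
    refine (Submodule.mem_bot k).1 (map_mem_of_mem_wordSpan _ ⊥ (fun a ha => ?_) h)
    rw [Submodule.mem_bot]
    refine augFace_word_of_ne k (ha.2.resolve_right fun ha' => ?_)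
    have := le_wordWeight (m := 0) (fun i hi => ha' i hi (Nat.lt_succ_iff.1 i.2)) (Nat.zero_le _)
    omega
  obtain ⟨y', hy', e⟩ := exists_hochschildB_eq_of_augFace_eq_zero (w := w) (by omega)
    (sub_mem hz (hochschildB_mem_weightPart k d w _ _ hy)) h0 (by
      rw [map_sub, hbz, zero_sub, neg_eq_zero]
      exact LinearMap.congr_fun (hochschildB_hochschildB k (TruncPoly k d) n) y)
  exact ⟨y + y', add_mem hy hy', by rw [map_add, e, add_sub_cancel]⟩

end Normalization

/-! ### The two-row structure of the weight parts -/

section TwoRow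

variable {k : Type u} [CommRing k] {d : ℕ}

theorem letterWeight_le_one (a : Option (Fin d)) : letterWeight d a ≤ 1 := by
  rcases a <;> simp [letterWeight]

theorem le_wordWeight_of_ne_none {n : ℕ} {a : Fin n → Option (Fin d)} (h : ∀ i, a i ≠ none) :
    n ≤ wordWeight a := by
  refine le_of_eq_of_le ?_ (Finset.card_nsmul_le_sum Finset.univ _ 1
    fun i _ => one_le_letterWeight (h i))
  simp

theorem ne_none_of_wordWeight_eq {n : ℕ} {a : Fin n → Option (Fin d)} (h : wordWeight a = n)
    (i : Fin n) : a i ≠ none := by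
  intro hi
  have : ∑ i, letterWeight d (a i) < ∑ _i : Fin n, 1 :=
    Finset.sum_lt_sum (fun i _ => letterWeight_le_one _) ⟨i, Finset.mem_univ _, by
      rw [hi]; exact Nat.zero_lt_one⟩
  simp only [Finset.sum_const, Finset.card_univ, Fintype.card_fin, smul_eq_mul, mul_one] at this
  exact this.ne h

theorem exists_unique_none {n : ℕ} {a : Fin (n + 1) → Option (Fin d)} (h : wordWeight a = n) :
    ∃ p, a p = none ∧ ∀ j, j ≠ p → a j ≠ none := by
  have hp : ∃ p, a p = none := by
    by_contra! hp
    have := le_wordWeight_of_ne_none hp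
    omega
  obtain ⟨p, hp⟩ := hp
  refine ⟨p, hp, fun j hj h0 => ?_⟩
  obtain ⟨j, rfl⟩ := Fin.exists_succAbove_eq hj
  exact ne_none_of_wordWeight_eq ((wordWeight_removeNth hp).trans h) j h0

/-- The alternating signs make the sum telescope. -/
theorem sum_neg_one_pow_smul_add {n : ℕ} {V : Type*} [AddCommGroup V] [Module k V]
    (f : Fin (n + 2) → V) :
    ∑ i : Fin (n + 1), (-1 : k) ^ (i : ℕ) • (f i.castSucc + f i.succ) =
      f 0 - (-1 : k) ^ (n + 1) • f (Fin.last (n + 1)) := by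
  have h1 := Fin.sum_univ_castSucc fun j : Fin (n + 2) => (-1 : k) ^ (j : ℕ) • f j
  have h2 := Fin.sum_univ_succ fun j : Fin (n + 2) => (-1 : k) ^ (j : ℕ) • f j
  simp only [Fin.val_castSucc, Fin.val_last, Fin.val_succ, Fin.val_zero, pow_zero, one_smul,
    pow_succ (-1 : k), mul_neg_one, neg_smul, Finset.sum_neg_distrib] at h1 h2
  rw [h1, ← sub_eq_zero] at h2
  simp only [smul_add, Finset.sum_add_distrib]
  rw [pow_succ, mul_neg_one, neg_smul, ← sub_eq_zero, ← h2]
  abel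

-- A unit at an interior position is absorbed by the two faces touching it, with opposite signs.
-- Only a unit at either end survives.
variable (k) in
theorem barB_word {n : ℕ} {a : Fin (n + 2) → Option (Fin d)} {p : Fin (n + 2)} (hp : a p = none)
    (hp' : ∀ j, j ≠ p → a j ≠ none) :
    barB k (TruncPoly k d) n (word k a) = (if 0 = p then word k (p.removeNth a) else 0) -
      (-1 : k) ^ (n + 1) • (if Fin.last (n + 1) = p then word k (p.removeNth a) else 0) := by
  set f : Fin (n + 2) → ⨂[k] _ : Fin (n + 1), TruncPoly k d :=
    fun j => if j = p then word k (p.removeNth a) else 0 with hf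
  have h : ∀ i : Fin (n + 1), face k (TruncPoly k d) n i.castSucc (word k a) =
      f i.castSucc + f i.succ := fun i => by
    simp only [hf]
    by_cases h1 : i.castSucc = p
    · have h2 : i.succ ≠ p := fun h2 => (Fin.castSucc_lt_succ (i := i)).ne (h1.trans h2.symm)
      rw [if_pos h1, if_neg h2, add_zero, face_word_of_castSucc k (h1 ▸ hp), h1]
    · by_cases h2 : i.succ = p
      · rw [if_neg h1, if_pos h2, zero_add, face_word_of_succ k (h2 ▸ hp), h2]
      · rw [if_neg h1, if_neg h2, zero_add, face_word_eq_zero k (hp' _ h1) (hp' _ h2)]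
  simp only [barB, LinearMap.sum_apply, LinearMap.smul_apply, h]
  exact sum_neg_one_pow_smul_add f

/-- A word with a single unit has nonzero ρ exactly if the unit comes first, and t brings a final
unit to the front. These are the two end terms of `barB_word`. -/
theorem augFace_one_sub_cyclicT_word {n : ℕ} {a : Fin (n + 2) → Option (Fin d)}
    (ha : wordWeight a = n + 1) :
    augFace k d (n + 1) ((1 - cyclicT k (TruncPoly k d) (n + 1)) (word k a)) =
      barB k (TruncPoly k d) n (word k a) := by
  obtain ⟨p, hp, hp'⟩ := exists_unique_none ha
  rw [barB_word k hp hp', LinearMap.sub_apply, Module.End.one_apply, map_sub, cyclicT_word, map_smul]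
  congr 1
  · split_ifs with h
    · subst h
      exact augFace_word_of_eq k hp
    · exact augFace_word_of_ne k (hp' 0 h)
  · congr 1
    split_ifs with h
    · subst h
      rw [augFace_word_of_eq k (by simpa using hp), Fin.tail_cons]
      congr 1
      ext i
      simp [Fin.removeNth]
    · exact augFace_word_of_ne k (by simpa using hp' _ h)

theorem augFace_one_sub_cyclicT {n : ℕ} {x : ⨂[k] _ : Fin (n + 2), TruncPoly k d}
    (hx : x ∈ weightPart k d (n + 1) (n + 1)) :
    augFace k d (n + 1) ((1 - cyclicT k (TruncPoly k d) (n + 1)) x) =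
      barB k (TruncPoly k d) n x := by
  rw [weightPart_eq_wordSpan] at hx
  have := map_mem_of_mem_wordSpan (augFace k d (n + 1) ∘ₗ (1 - cyclicT k (TruncPoly k d) (n + 1)) -
    barB k (TruncPoly k d) n) ⊥ (fun a ha => by
      rw [Submodule.mem_bot, LinearMap.sub_apply, LinearMap.comp_apply,
        augFace_one_sub_cyclicT_word ha, sub_self]) hx
  rwa [Submodule.mem_bot, LinearMap.sub_apply, LinearMap.comp_apply, sub_eq_zero] at this

/-- From b(1-t) = (1-t)b' and ρ(1-t) = b', the difference b - (1-t)ρ is rotation invariant. So the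
unit may be assumed to come first, where bs = b's - t for the prepending map s, and b' agrees with
ρ. -/
theorem hochschildB_word {n : ℕ} {a : Fin (n + 2) → Option (Fin d)} (ha : wordWeight a = n + 1) :
    hochschildB k (TruncPoly k d) n (word k a) =
      (1 - cyclicT k (TruncPoly k d) n) (augFace k d (n + 1) (word k a)) := by
  obtain ⟨p, hp, -⟩ := exists_unique_none ha
  refine sub_eq_zero.1 (eq_zero_of_rotation k (n + 1) (hochschildB k (TruncPoly k d) n -
    (1 - cyclicT k (TruncPoly k d) n) ∘ₗ augFace k d (n + 1)) (fun a ha => ?_) (· = none)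
    (fun a ha h0 => ?_) a ha p hp)
  · have h1 := LinearMap.congr_fun (hochschildB_one_sub_cyclicT k (TruncPoly k d) n) (word k a)
    have h2 := congrArg (⇑(1 - cyclicT k (TruncPoly k d) n : Module.End k _)) (augFace_one_sub_cyclicT_word (k := k) ha)
    simp only [LinearMap.comp_apply] at h1
    rw [← h2] at h1
    refine (sub_eq_zero.1 ?_).symm
    rw [← map_sub]
    exact sub_eq_zero.2 h1
  · have hw := wordWeight_removeNth h0
    have h1 := LinearMap.congr_fun (hochschildB_insertOne_eq k (TruncPoly k d) n)
      (augFace k d (n + 1) (word k a))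
    have h2 : barB k (TruncPoly k d) n (word k a) = augFace k d (n + 1) (word k a) := by
      obtain ⟨p, hp, hp'⟩ := exists_unique_none ha
      obtain rfl : 0 = p := by
        by_contra h
        exact hp' 0 h h0
      rw [barB_word k hp hp', if_pos rfl, if_neg (Fin.last_pos).ne', smul_zero, sub_zero,
        augFace_word_of_eq k h0]
      rfl
    rw [LinearMap.comp_apply, LinearMap.sub_apply, LinearMap.comp_apply,
      insertOne_zero_augFace_word k h0, h2] at h1
    rw [LinearMap.sub_apply, h1]
    exact sub_self _

theorem hochschildB_eq_one_sub_cyclicT {n : ℕ} {x : ⨂[k] _ : Fin (n + 2), TruncPoly k d}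
    (hx : x ∈ weightPart k d (n + 1) (n + 1)) :
    hochschildB k (TruncPoly k d) n x =
      (1 - cyclicT k (TruncPoly k d) n) (augFace k d (n + 1) x) := by
  rw [weightPart_eq_wordSpan] at hx
  have := map_mem_of_mem_wordSpan (hochschildB k (TruncPoly k d) n -
    (1 - cyclicT k (TruncPoly k d) n) ∘ₗ augFace k d (n + 1)) ⊥ (fun a ha => by
      rw [Submodule.mem_bot, LinearMap.sub_apply, LinearMap.comp_apply, hochschildB_word ha,
        sub_self]) hx
  rwa [Submodule.mem_bot, LinearMap.sub_apply, LinearMap.comp_apply, sub_eq_zero] at this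

/-- Since ρb(1-t) = ρ(1-t)b' = b'b' = 0, the map ρb is rotation invariant. Positive weight provides
a non-unit letter, and once this is in front every face is killed by ρ. -/
theorem augFace_hochschildB {n : ℕ} {x : ⨂[k] _ : Fin (n + 3), TruncPoly k d}
    (hx : x ∈ weightPart k d (n + 1) (n + 2)) :
    augFace k d (n + 1) (hochschildB k (TruncPoly k d) (n + 1) x) = 0 := by
  rw [weightPart_eq_wordSpan] at hx
  refine (Submodule.mem_bot k).1 (map_mem_of_mem_wordSpan
    (augFace k d (n + 1) ∘ₗ hochschildB k (TruncPoly k d) (n + 1)) ⊥ (fun a ha => ?_) hx)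
  have hi : ∃ i, a i ≠ none := by
    by_contra! h
    rw [wordWeight, Finset.sum_eq_zero fun i _ => by rw [h i]; rfl] at ha
    omega
  obtain ⟨i, hi⟩ := hi
  refine (Submodule.mem_bot k).2 (eq_zero_of_rotation k (n + 1) _ (fun a ha => ?_) (· ≠ none)
    (fun a _ h0 => augFace_hochschildB_word_of_ne k h0) a ha i hi)
  have h1 := LinearMap.congr_fun (hochschildB_one_sub_cyclicT k (TruncPoly k d) (n + 1)) (word k a)
  have h2 := LinearMap.congr_fun (barB_barB k (TruncPoly k d) n) (word k a)
  have h3 := augFace_one_sub_cyclicT (barB_mem_weightPart k d (n + 1) (n + 1) _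
    (ha ▸ word_mem_weightPart k a))
  simp only [LinearMap.comp_apply] at h1 h2
  rw [← h1, h2] at h3
  refine (sub_eq_zero.1 ?_).symm
  rw [← map_sub]
  exact h3

variable (k d)

/-- The map `a_0 ⊗ ⋯ ⊗ a_{n+1} ↦ ε(a_0) a_1 ⊗ ⋯ ⊗ a_{n+1}` on the weight `w` part. -/
def weightAugFace (w n : ℕ) : (weightTsygan k d w).obj (n + 1) →ₗ[k] (weightTsygan k d w).obj n :=
  (augFace k d (n + 1)).restrict fun _ => augFace_mem_weightPart

theorem barB_weight_zero_surjective (w : ℕ) : Function.Surjective ((weightTsygan k d w).b' 0) :=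
  fun x => ⟨⟨insertOne k (TruncPoly k d) 0 x.1, insertOne_mem_weightPart 0 x.2⟩,
    Subtype.ext (LinearMap.congr_fun (barB_zero_insertOne k (TruncPoly k d)) x.1)⟩

theorem barB_weight_exact (w q : ℕ) (x : (weightTsygan k d w).obj (q + 1))
    (hx : (weightTsygan k d w).b' q x = 0) : ∃ y, (weightTsygan k d w).b' (q + 1) y = x := by
  have key : ∀ z, barB k (TruncPoly k d) q z = 0 →
      barB k (TruncPoly k d) (q + 1) (insertOne k (TruncPoly k d) 0 z) = z := fun z hz => by
    have h := LinearMap.congr_fun (barB_insertOne k (TruncPoly k d) q) z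
    rwa [LinearMap.add_apply, LinearMap.comp_apply, LinearMap.comp_apply, hz, map_zero,
      add_zero] at h
  exact ⟨⟨insertOne k (TruncPoly k d) 0 x.1, insertOne_mem_weightPart 0 x.2⟩,
    Subtype.ext (key x.1 (congrArg Subtype.val hx))⟩

theorem hochschildB_weight_exact {w q : ℕ} (h : w ≤ q) (x : (weightTsygan k d w).obj (q + 1))
    (hx : (weightTsygan k d w).b q x = 0) : ∃ y, (weightTsygan k d w).b (q + 1) y = x := by
  obtain ⟨y, hy, e⟩ := exists_hochschildB_eq h x.2 (congrArg Subtype.val hx)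
  exact ⟨⟨y, hy⟩, Subtype.ext e⟩

theorem weightTsygan_isTwoRow (r : ℕ) :
    (weightTsygan k d (r + 1)).IsTwoRow r (weightAugFace k d (r + 1) r) where
  subsingleton q hq := by
    have : Subsingleton (weightPart k d (r + 1) q) := by
      rw [weightPart_eq_bot k (by omega)]
      infer_instance
    exact this
  bar_surjective := barB_weight_zero_surjective k d (r + 1)
  bar_exact := barB_weight_exact k d (r + 1)
  b_exact q hq := hochschildB_weight_exact k d hq
  b_exact_of_eq_zero x hx hx' := by
    obtain ⟨y, hy, e⟩ := exists_hochschildB_eq_of_augFace_eq_zero le_rfl x.2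
      (congrArg Subtype.val hx') (congrArg Subtype.val hx)
    exact ⟨⟨y, hy⟩, Subtype.ext e⟩
  b_eq := LinearMap.ext fun x => Subtype.ext (hochschildB_eq_one_sub_cyclicT x.2)
  comp_one_sub_t := LinearMap.ext fun x => Subtype.ext (augFace_one_sub_cyclicT x.2)
  comp_b := LinearMap.ext fun x => Subtype.ext (augFace_hochschildB x.2)
  surjective x := ⟨⟨insertOne k (TruncPoly k d) 0 x.1, insertOne_mem_weightPart 0 x.2⟩,
    Subtype.ext (LinearMap.congr_fun (augFace_insertOne_zero k (r + 1)) x.1)⟩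

end TwoRow

/-! ### The weight `0` part -/

section WeightZero

variable (k : Type u) [CommRing k] (d : ℕ)

theorem hochschildB_zero_of_comm (A : Type u) [CommRing A] [Algebra k A] :
    hochschildB k A 0 = 0 := by
  ext a
  have h : faceTuple (0 : Fin 2) a = faceTuple (1 : Fin 2) a := by
    ext j
    fin_cases j
    simpa [faceTuple] using mul_comm _ _
  simp [hochschildB, Fin.sum_univ_two, h]

theorem cyclicT_zero (M : Type u) [AddCommGroup M] [Module k M] : cyclicT k M 0 = 1 := by
  ext a
  simp only [LinearMap.compMultilinearMap_apply, cyclicT_tprod, pow_zero, one_smul,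
    Module.End.one_apply]
  congr 1
  ext j
  fin_cases j
  rfl

theorem wordWeight_eq_zero_iff {n : ℕ} {a : Fin n → Option (Fin d)} :
    wordWeight a = 0 ↔ a = fun _ => none := by
  rw [wordWeight, Finset.sum_eq_zero_iff, funext_iff]
  refine forall_congr' fun i => ?_
  rcases a i <;> simp [letterWeight]

/-- The augmentation `a ↦ ε(a)` on the tensors with one factor. -/
def augOne : (⨂[k] _ : Fin 1, TruncPoly k d) →ₗ[k] k :=
  (PiTensorProduct.isEmptyEquiv (Fin 0)).toLinearMap ∘ₗ augFace k d 0

theorem augOne_word : augOne k d (word k fun _ => none) = 1 := by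
  rw [augOne, LinearMap.comp_apply, augFace_word_of_eq k rfl, word, LinearEquiv.coe_coe,
    PiTensorProduct.isEmptyEquiv_apply_tprod]

theorem word_none_mem : word k (fun _ : Fin 1 => (none : Option (Fin d))) ∈ weightPart k d 0 0 := by
  have := word_mem_weightPart k (fun _ : Fin 1 => (none : Option (Fin d)))
  rwa [(wordWeight_eq_zero_iff d).2 rfl] at this

theorem augOne_smul_word {x : ⨂[k] _ : Fin 1, TruncPoly k d} (hx : x ∈ weightPart k d 0 0) :
    augOne k d x • word k (fun _ : Fin 1 => (none : Option (Fin d))) = x := by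
  rw [weightPart_eq_wordSpan] at hx
  have := map_mem_of_mem_wordSpan
    (LinearMap.toSpanSingleton k _ (word k fun _ : Fin 1 => (none : Option (Fin d))) ∘ₗ
      augOne k d - LinearMap.id) ⊥
    (fun a ha => by
      obtain rfl := (wordWeight_eq_zero_iff d).1 ha
      rw [Submodule.mem_bot, LinearMap.sub_apply, LinearMap.comp_apply, augOne_word,
        LinearMap.toSpanSingleton_apply, one_smul, LinearMap.id_apply, sub_self]) hx
  exact sub_eq_zero.1 ((Submodule.mem_bot k).1 this)

/-- The weight `0` part of `A` is `k`. -/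
def weightPartZeroEquiv : weightPart k d 0 0 ≃ₗ[k] k :=
  LinearEquiv.ofLinearMap (augOne k d ∘ₗ (weightPart k d 0 0).subtype)
    (LinearMap.toSpanSingleton k _ ⟨_, word_none_mem k d⟩)
    (LinearMap.ext_ring ((congrArg (augOne k d) (one_smul k _)).trans (augOne_word k d)))
    (LinearMap.ext fun x => Subtype.ext (augOne_smul_word k d x.2))

theorem nonempty_HCnegWeight_zero_linearEquiv (n : ℤ) (hn : Even n) (hn' : n ≤ 0) :
    Nonempty (HCnegWeight k d 0 n ≃ₗ[k] k) := by
  obtain ⟨p, rfl⟩ : ∃ p : ℕ, n = -(p : ℤ) := ⟨n.natAbs, by omega⟩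
  have hp : Even p := by simpa using hn
  obtain ⟨e⟩ := (weightTsygan k d 0).nonempty_negHomology_linearEquiv_of_even
    (barB_weight_zero_surjective k d 0) (barB_weight_exact k d 0)
    (fun q => hochschildB_weight_exact k d (Nat.zero_le q))
    (LinearMap.ext fun x => Subtype.ext
      (LinearMap.congr_fun (hochschildB_zero_of_comm k (TruncPoly k d)) x.1))
    (LinearMap.ext fun x => Subtype.ext
      (LinearMap.congr_fun (cyclicT_zero k (TruncPoly k d)) x.1)) p hp
  exact ⟨e ≪≫ₗ weightPartZeroEquiv k d⟩

theorem subsingleton_HCnegWeight_zero (n : ℤ) (hn : ¬ (Even n ∧ n ≤ 0)) :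
    Subsingleton (HCnegWeight k d 0 n) :=
  TsyganData.subsingleton_negHomology_of_not_even
    (barB_weight_zero_surjective k d 0) (barB_weight_exact k d 0)
    (fun q => hochschildB_weight_exact k d (Nat.zero_le q)) n hn

end WeightZero

/-! ### The tensor powers of the cotangent module -/

section Cotangent

variable (k : Type u) [CommRing k] (d : ℕ)

/-- The inclusion `𝔪 / 𝔪² → A`. -/
def cotangentIncl : CotangentMod k d →ₗ[k] TruncPoly k d :=
  (varIdeal k d).cotangentToQuotientSquare.restrictScalars k

theorem cotangentIncl_injective : Function.Injective (cotangentIncl k d) :=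
  (varIdeal k d).cotangentToQuotientSquare_injective

theorem truncProj_mem_range_cotangentIncl (x : TruncPoly k d) :
    truncProj k d true x ∈ LinearMap.range (cotangentIncl k d) := by
  have : Submodule.span k (Set.range (letter k d)) ≤
      (LinearMap.range (cotangentIncl k d)).comap (truncProj k d true) := by
    rw [Submodule.span_le]
    rintro _ ⟨a, rfl⟩
    rw [SetLike.mem_coe, Submodule.mem_comap, truncProj_letter]
    rcases a with _ | i
    · exact zero_mem _
    · exact ⟨(varIdeal k d).toCotangent ⟨MvPolynomial.X i, Ideal.subset_span ⟨i, rfl⟩⟩, rfl⟩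
  exact this (span_range_letter k ▸ Submodule.mem_top)

theorem truncAug_cotangentIncl (m : CotangentMod k d) :
    truncAug k d (cotangentIncl k d m) = 0 := by
  obtain ⟨⟨f, hf⟩, rfl⟩ := (varIdeal k d).toCotangent_surjective m
  have h : varIdeal k d ≤ RingHom.ker (MvPolynomial.aeval fun _ : Fin d => (0 : k)) := by
    rw [Ideal.span_le]
    rintro _ ⟨i, rfl⟩
    simp [RingHom.mem_ker]
  exact (Ideal.Quotient.lift_mk _ _ _).trans (h hf)

theorem truncProj_cotangentIncl (m : CotangentMod k d) :
    truncProj k d true (cotangentIncl k d m) = cotangentIncl k d m := by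
  have h := truncAug_cotangentIncl k d m
  generalize cotangentIncl k d m = x at h
  simp [truncProj, h]

/-- The projection `A → 𝔪 / 𝔪²`. -/
def cotangentProj : TruncPoly k d →ₗ[k] CotangentMod k d :=
  (LinearEquiv.ofInjective _ (cotangentIncl_injective k d)).symm.toLinearMap ∘ₗ
    (truncProj k d true).codRestrict _ (truncProj_mem_range_cotangentIncl k d)

theorem cotangentIncl_cotangentProj (x : TruncPoly k d) :
    cotangentIncl k d (cotangentProj k d x) = truncProj k d true x :=
  congrArg Subtype.val ((LinearEquiv.ofInjective _ (cotangentIncl_injective k d)).apply_symm_apply _)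

theorem cotangentProj_cotangentIncl (m : CotangentMod k d) :
    cotangentProj k d (cotangentIncl k d m) = m :=
  cotangentIncl_injective k d
    ((cotangentIncl_cotangentProj k d _).trans (truncProj_cotangentIncl k d m))

/-- Applying the projection onto m̄ in every factor does not change the image, but kills every word
with a unit and fixes the words of full weight r+1. -/
theorem map_cotangentIncl_mem (r : ℕ) (x : ⨂[k] _ : Fin (r + 1), CotangentMod k d) :
    PiTensorProduct.map (fun _ => cotangentIncl k d) x ∈ weightPart k d (r + 1) r := by
  have h : PiTensorProduct.map (fun _ => cotangentIncl k d) x =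
      PiTensorProduct.map (fun _ => truncProj k d true)
        (PiTensorProduct.map (fun _ => cotangentIncl k d) x) := by
    rw [← LinearMap.comp_apply, ← PiTensorProduct.map_comp]
    congr 2
    ext i m
    exact (truncProj_cotangentIncl k d m).symm
  rw [h]
  refine map_mem_of_mem_wordSpan (P := fun _ => True) _ _ (fun a _ => ?_) (x := _) ?_
  · by_cases ha : ∃ i, a i = none
    · obtain ⟨i, hi⟩ := ha
      rw [word, PiTensorProduct.map_tprod, MultilinearMap.map_coord_zero _ i]
      · exact zero_mem _
      · rw [truncProj_letter, hi]
        rfl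
    · push Not at ha
      have hw : wordWeight a = r + 1 :=
        le_antisymm (wordWeight_le a) (le_wordWeight_of_ne_none ha)
      have : PiTensorProduct.map (fun _ => truncProj k d true) (word k a) = word k a := by
        rw [word, PiTensorProduct.map_tprod]
        congr 1
        ext i
        rw [truncProj_letter, if_pos (Option.isSome_iff_ne_none.2 (ha i)).symm]
      rw [this]
      have := word_mem_weightPart k a
      rwa [hw] at this
  · have : wordSpan k (fun _ : Fin (r + 1) → Option (Fin d) => True) = ⊤ := by
      rw [← span_range_word k, wordSpan]
      congr 1
      ext z
      simp [eq_comm]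
    rw [this]
    trivial

/-- The identification of `(𝔪 / 𝔪²)^{⊗ (r+1)}` with the weight `r + 1` part of `A^{⊗ (r+1)}`. -/
def cotangentPowerEquivWeightPart (r : ℕ) :
    (⨂[k] _ : Fin (r + 1), CotangentMod k d) ≃ₗ[k] weightPart k d (r + 1) r :=
  LinearEquiv.ofLinearMap
    ((PiTensorProduct.map fun _ => cotangentIncl k d).codRestrict _ (map_cotangentIncl_mem k d r))
    ((PiTensorProduct.map fun _ => cotangentProj k d) ∘ₗ (weightPart k d (r + 1) r).subtype)
    (by
      refine LinearMap.ext fun x => Subtype.ext ?_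
      obtain ⟨x, hx⟩ := x
      rw [weightPart_eq_wordSpan] at hx
      have := map_mem_of_mem_wordSpan
        ((PiTensorProduct.map fun _ => cotangentIncl k d) ∘ₗ
          (PiTensorProduct.map fun _ => cotangentProj k d) - LinearMap.id) ⊥
        (fun a ha => by
          rw [Submodule.mem_bot, LinearMap.sub_apply, LinearMap.comp_apply, LinearMap.id_apply, word,
            PiTensorProduct.map_tprod, PiTensorProduct.map_tprod, sub_eq_zero]
          congr 1
          ext i
          rw [cotangentIncl_cotangentProj, truncProj_letter, if_pos
            (Option.isSome_iff_ne_none.2 (ne_none_of_wordWeight_eq ha i)).symm]) hx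
      exact sub_eq_zero.1 ((Submodule.mem_bot k).1 this))
    (by
      ext x
      simp [PiTensorProduct.map_tprod, cotangentProj_cotangentIncl])

/-- The identification of the lowest nonzero row of the weight `r + 1` part. -/
def cotangentPowerEquiv (r : ℕ) :
    (⨂[k] _ : Fin (r + 1), CotangentMod k d) ≃ₗ[k] (weightTsygan k d (r + 1)).obj r :=
  cotangentPowerEquivWeightPart k d r

theorem cotangentPowerEquiv_cyclicT (r : ℕ) (x : ⨂[k] _ : Fin (r + 1), CotangentMod k d) :
    cotangentPowerEquiv k d r (cyclicT k (CotangentMod k d) r x) =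
      (weightTsygan k d (r + 1)).t r (cotangentPowerEquiv k d r x) := by
  refine Subtype.ext ?_
  change PiTensorProduct.map (fun _ => cotangentIncl k d) (cyclicT k (CotangentMod k d) r x) =
    cyclicT k (TruncPoly k d) r (PiTensorProduct.map (fun _ => cotangentIncl k d) x)
  rw [← LinearMap.comp_apply, ← LinearMap.comp_apply]
  congr 1
  ext a
  simp only [LinearMap.compMultilinearMap_apply, LinearMap.comp_apply, cyclicT_tprod, map_smul,
    PiTensorProduct.map_tprod]
  congr 2
  ext i
  refine Fin.cases ?_ (fun i => ?_) i <;> simp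

end Cotangent

/-! ### The cohomology of the cyclic group -/

section CyclicGroupCohomology

variable (k : Type u) [CommRing k] (d : ℕ)

theorem Cyc.gen_pow (w n : ℕ) :
    Cyc.gen.{u} w ^ n = ULift.up (Multiplicative.ofAdd (n : ZMod w)) := by
  rw [Cyc.gen]
  refine ULift.ext _ _ ?_
  rw [ULift.pow_down, ← ofAdd_nsmul, nsmul_one]

theorem Cyc.mem_zpowers_gen (w : ℕ) [NeZero w] (x : Cyc.{u} w) :
    x ∈ Subgroup.zpowers (Cyc.gen.{u} w) := by
  refine Subgroup.mem_zpowers_iff.2 ⟨(Multiplicative.toAdd x.down).val, ?_⟩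
  rw [zpow_natCast, Cyc.gen_pow, ZMod.natCast_zmod_val]
  rfl

instance (w : ℕ) [NeZero w] : Fintype (Cyc.{u} w) :=
  Fintype.ofEquiv (ZMod w) (Multiplicative.ofAdd.trans Equiv.ulift.symm)

theorem Cyc.sum_eq (r : ℕ) {V : Type*} [AddCommMonoid V] (f : Cyc.{u} (r + 1) → V) :
    ∑ x, f x = ∑ i ∈ Finset.range (r + 1), f (Cyc.gen (r + 1) ^ i) := by
  rw [← (Multiplicative.ofAdd.trans Equiv.ulift.symm : ZMod (r + 1) ≃ Cyc.{u} (r + 1)).sum_comp,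
    ← Fin.sum_univ_eq_sum_range fun i => f (Cyc.gen (r + 1) ^ i)]
  refine Finset.sum_congr rfl fun (i : Fin (r + 1)) _ => ?_
  rw [Cyc.gen_pow]
  exact congrArg (fun i : ZMod (r + 1) => f (ULift.up (Multiplicative.ofAdd i)))
    (Fin.cast_val_eq_self i).symm

theorem cycRep_gen (r : ℕ) :
    cycRep k d (r + 1) (Cyc.gen (r + 1)) = cyclicT k (CotangentMod k d) r := by
  rw [cycRep, MonoidHom.comp_apply, Cyc.toPerm_gen, cyclicT_eq_signedPerm]

theorem cotangentPowerEquiv_cyclicT_pow (r i : ℕ) (x : ⨂[k] _ : Fin (r + 1), CotangentMod k d) :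
    cotangentPowerEquiv k d r ((cyclicT k (CotangentMod k d) r ^ i) x) =
      ((weightTsygan k d (r + 1)).t r ^ i) (cotangentPowerEquiv k d r x) := by
  induction i with
  | zero => rfl
  | succ i ih =>
    rw [pow_succ' (cyclicT k (CotangentMod k d) r), Module.End.mul_apply,
      cotangentPowerEquiv_cyclicT, ih, pow_succ' ((weightTsygan k d (r + 1)).t r),
      Module.End.mul_apply]

theorem cotangentPowerEquiv_norm (r : ℕ) (x : ⨂[k] _ : Fin (r + 1), CotangentMod k d) :
    cotangentPowerEquiv k d r ((cycRep k d (r + 1)).norm x) =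
      (weightTsygan k d (r + 1)).norm r (cotangentPowerEquiv k d r x) := by
  rw [Representation.norm, LinearMap.sum_apply, Cyc.sum_eq, map_sum, TsyganData.norm,
    LinearMap.sum_apply]
  refine Finset.sum_congr rfl fun i _ => ?_
  rw [map_pow, cycRep_gen, cotangentPowerEquiv_cyclicT_pow]

/-- The differential of the periodic complex computing the cohomology of the cyclic group. -/
theorem cotangentPowerEquiv_periodicD (r i : ℕ) (x : ⨂[k] _ : Fin (r + 1), CotangentMod k d) :
    (weightTsygan k d (r + 1)).periodicD r i (cotangentPowerEquiv k d r x) =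
      cotangentPowerEquiv k d r (if Even i then x - cycRep k d (r + 1) (Cyc.gen (r + 1)) x
        else (cycRep k d (r + 1)).norm x) := by
  rw [TsyganData.periodicD]
  split_ifs with h
  · rw [map_sub, cycRep_gen, cotangentPowerEquiv_cyclicT]
    rfl
  · exact (cotangentPowerEquiv_norm k d r x).symm

/-- The periodic complex computing the cohomology of `C_{r+1}`. -/
abbrev cycPeriodicComplex (r : ℕ) : CochainComplex (ModuleCat.{u} k) ℕ :=
  Rep.FiniteCyclicGroup.moduleCatCochainComplex (Rep.of (cycRep k d (r + 1))) (Cyc.gen (r + 1))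

theorem cycPeriodicComplex_d_apply (r i : ℕ) (x : ⨂[k] _ : Fin (r + 1), CotangentMod k d) :
    (cycPeriodicComplex k d r).d i (i + 1) x =
      if Even i then cycRep k d (r + 1) (Cyc.gen (r + 1)) x - x
        else (cycRep k d (r + 1)).norm x := by
  by_cases h : Even i
  · simp [h]
    rfl
  · simp [h]
    rfl

/-- Group cohomology is computed here from the periodic resolution attached to the generator of
C_{r+1}. -/
theorem nonempty_cycCohomology_linearEquiv (r i : ℕ) :
    Nonempty (cycCohomology k d (r + 1) i ≃ₗ[k] (cycPeriodicComplex k d r).homology i) :=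
  ⟨(groupCohomologyIso _ i (Rep.FiniteCyclicGroup.resolution k (Cyc.gen (r + 1))
      (Cyc.mem_zpowers_gen (r + 1))) ≪≫
    HomologicalComplex.homologyMapIso (Rep.FiniteCyclicGroup.homResolutionIso _ (Cyc.gen (r + 1))
      (Cyc.mem_zpowers_gen (r + 1))) i).toLinearEquiv⟩

/-- The group cohomology complex has α - 1 where the row complex has 1 - t. Kernels and ranges are
the same, with -y in place of y as preimage. -/
theorem nonempty_HCnegWeight_linearEquiv_cycCohomology (r i : ℕ) (n : ℤ) (hi : n + i = r + 1) :
    Nonempty (HCnegWeight k d (r + 1) n ≃ₗ[k] cycCohomology k d (r + 1) i) := by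
  obtain ⟨e⟩ := (weightTsygan_isTwoRow k d r).nonempty_negHomology_linearEquiv
    (cycPeriodicComplex k d r) n i hi (fun _ => cotangentPowerEquiv k d r)
    (fun i (x : ⨂[k] _ : Fin (r + 1), CotangentMod k d) => by
      have h := cotangentPowerEquiv_periodicD k d r i x
      refine Iff.trans ?_ (Eq.congr_left h).symm
      refine Iff.trans ?_ (LinearEquiv.map_eq_zero_iff (cotangentPowerEquiv k d r)).symm
      refine (Eq.congr_left (cycPeriodicComplex_d_apply k d r i x)).trans ?_
      by_cases h : Even i
      · rw [if_pos h, if_pos h, sub_eq_zero, eq_comm]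
        exact sub_eq_zero
      · rw [if_neg h, if_neg h]
        rfl)
    (fun i (x : ⨂[k] _ : Fin (r + 1), CotangentMod k d) => by
      constructor
      · rintro ⟨(y : ⨂[k] _ : Fin (r + 1), CotangentMod k d), hy⟩
        replace hy := (cycPeriodicComplex_d_apply k d r i y).symm.trans hy
        by_cases h : Even i
        · refine ⟨cotangentPowerEquiv k d r (-y),
            (cotangentPowerEquiv_periodicD k d r i _).trans (congrArg _ ?_)⟩
          rw [if_pos h] at hy ⊢
          rw [← hy, map_neg]
          abel
        · refine ⟨cotangentPowerEquiv k d r y,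
            (cotangentPowerEquiv_periodicD k d r i _).trans (congrArg _ ?_)⟩
          rw [if_neg h] at hy ⊢
          exact hy
      · rintro ⟨y, hy⟩
        obtain ⟨y, rfl⟩ := (cotangentPowerEquiv k d r).surjective y
        replace hy := (cotangentPowerEquiv k d r).injective
          ((cotangentPowerEquiv_periodicD k d r i y).symm.trans hy)
        by_cases h : Even i
        · refine ⟨-y, (cycPeriodicComplex_d_apply k d r i (-y)).trans ?_⟩
          rw [if_pos h] at hy ⊢
          rw [← hy, map_neg]
          abel
        · refine ⟨y, (cycPeriodicComplex_d_apply k d r i y).trans ?_⟩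
          rw [if_neg h] at hy ⊢
          exact hy)
  obtain ⟨e'⟩ := nonempty_cycCohomology_linearEquiv k d r i
  exact ⟨e ≪≫ₗ e'.symm⟩

end CyclicGroupCohomology

end

/-! ### Assembly of the weight decomposition, weight 0 and positive weights. -/

theorem mainTheorem3 (k : Type u) [CommRing k] (d : ℕ) :
    (∀ q : ℕ, DirectSum.IsInternal fun w : ℕ => weightPart k d w q) ∧
    (∃ π : ∀ w : ℕ, TsyganData.Hom (truncTsygan k d) (weightTsygan k d w),
      (∀ w q x, (π w).app q ((weightInclusion k d w).app q x) = x) ∧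
      (∀ v w, v ≠ w → ∀ q x, (π w).app q ((weightInclusion k d v).app q x) = 0) ∧
      ∀ n : ℤ, Function.Bijective
        (fun (z : HCneg k d n) (w : ℕ) => (π w).negHomologyMap n z :
          HCneg k d n → ∀ w : ℕ, HCnegWeight k d w n)) ∧
    (∀ n : ℤ,
      (Even n ∧ n ≤ 0 → Nonempty (HCnegWeight k d 0 n ≃ₗ[k] k)) ∧
      (¬ (Even n ∧ n ≤ 0) → Subsingleton (HCnegWeight k d 0 n))) ∧
    (∀ w : ℕ, 0 < w → ∀ n : ℤ,
      ((w : ℤ) < n → Subsingleton (HCnegWeight k d w n)) ∧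
      (n ≤ (w : ℤ) →
        Nonempty (HCnegWeight k d w n ≃ₗ[k] cycExt k d w ((w : ℤ) - n).toNat) ∧
        Nonempty (HCnegWeight k d w n ≃ₗ[k] cycCohomology k d w ((w : ℤ) - n).toNat))) := by
  refine ⟨weightPart_isInternal k, ⟨weightProjection k d, weightProjection_inclusion_self k,
    weightProjection_inclusion_of_ne k, TsyganData.negHomologyMap_bijective (weightProjection k d)
      (weightProjection_bijective k)⟩, fun n => ⟨fun h =>
    nonempty_HCnegWeight_zero_linearEquiv k d n h.1 h.2, subsingleton_HCnegWeight_zero k d n⟩, ?_⟩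
  intro w hw n
  -- Row r = w-1 is the lowest row that can be nonzero in weight w.
  obtain ⟨r, rfl⟩ : ∃ r, w = r + 1 := ⟨w - 1, by omega⟩
  refine ⟨fun hn => (weightTsygan_isTwoRow k d r).subsingleton_negHomology n (by exact_mod_cast hn),
    fun hn => ?_⟩
  obtain ⟨e⟩ := nonempty_HCnegWeight_linearEquiv_cycCohomology k d r
    (((r + 1 : ℕ) : ℤ) - n).toNat n (by omega)
  obtain ⟨e'⟩ := nonempty_extModule_linearEquiv_groupCohomology
    (Rep.of (cycRep k d (r + 1))) (((r + 1 : ℕ) : ℤ) - n).toNat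
  exact ⟨⟨e ≪≫ₗ e'.symm⟩, ⟨e⟩⟩
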